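/- Let $p$ be a prime and let $\pi\colon Y\to X$ be a finite surjective morphism of Noetherian, separated, integral, normal schemes of characteristic $p$ that are $F$-finite (i.e. whose Frobenius endomorphisms are finite). Assume that $\pi$ is separable, i.e. the induced extension of function fields $K(X)\subseteq K(Y)$ is separable, and let $\mathrm{Tr}\colon K(Y)\to K(X)$ be the field trace. Let $\Delta_X$ be a $\mathbb{Q}$-divisor on $X$ (not necessarily effective), $\mathfrak a\subseteq\mathcal O_X$ a non-zero coherent ideal sheaf, and $t\ge 0$ a real number. Notation. The pull-back $\pi^*\Delta_X$ is the $\mathbb Q$-divisor on $Y$ whose coefficient along a prime divisor $E$ is the coefficient of $\Delta_X$ along $\pi(E)$ times the ramification index of $\pi$ along $E$; the ramification divisor $\mathrm{Ram}_\pi$ is the divisor whose coefficient along $E$ is $\operatorname{length}_{\mathcal O_{Y,E}}(\Omega_{Y/X,E})$. For an $F$-finite normal domain $R$ with fraction field $K$, an effective $\mathbb Q$-divisor $\Delta$ on $\operatorname{Spec}R$ and a non-zero ideal $\mathfrak b\subseteq R$, the big test ideal $\tau_b(R;\Delta,\mathfrak b^t)$ is the smallest non-zero ideal $J\subseteq R$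 such that $\varphi\big(F^e_*(\mathfrak b^{\lceil t(p^e-1)\rceil}J)\big)\subseteq J$ for all $e\ge 0$ and all $\varphi$ in the image of $\operatorname{Hom}_R(F^e_*R(\lceil (p^e-1)\Delta\rceil),R)\to\operatorname{Hom}_R(F^e_*R,R)$. For a possibly non-effective $\Delta$ it is the fractional ideal $\tau_b(R;\Delta,\mathfrak b^t)=\frac1f\,\tau_b(R;\Delta+\operatorname{div}f,\mathfrak b^t)\subseteq K$, where $0\ne f\in R$ is any element with $\Delta+\operatorname{div}f\ge 0$. On a non-affine scheme $\tau_b$ is obtained by gluing over affine open subsets. Then these big test ideals exist on every affine open subset below, independently of the choice of $f$, and $$\mathrm{Tr}\Big(\pi_*\,\tau_b\big(Y;\ \pi^*\Delta_X-\mathrm{Ram}_\pi,\ (\mathfrak a\cdot\mathcal O_Y)^t\big)\Big)=\tau_b\big(X;\ \Delta_X,\ \mathfrak a^t\big),$$ that is, for every non-empty affine open $U\subseteq X$, with $V=\pi^{-1}(U)$, $$\mathrm{Tr}\Big(\tau_b\big(V;\ (\pi^*\Delta_X-\mathrm{Ram}_\pi)|_{V},\ (\mathfrak a\cdot\mathcal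 O_Y)|_{V}^t\big)\Big)=\tau_b\big(U;\ \Delta_X|_U,\ \mathfrak a|_U^t\big)$$ as $\mathcal O_X(U)$-submodules of $K(X)$. -/

import Mathlib

open AlgebraicGeometry CategoryTheory

universe u

noncomputable section

namespace TestIdeal

/-- A scheme is normal if all of its local rings are integrally closed. -/
class IsNormalScheme (X : Scheme.{u}) : Prop where
  isIntegrallyClosed_stalk : ∀ x : X, IsIntegrallyClosed (X.presheaf.stalk x)

/-- `X` has characteristic `p` and its Frobenius endomorphism is finite. The hypothesis
`ExpChar Γ(X, U) p` only serves to form `frobenius Γ(X, U) p`: for `p` prime it follows from `char`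
whenever `U` is nonempty. -/
structure IsFFinite (p : ℕ) (X : Scheme.{u}) : Prop where
  char : (p : Γ(X, ⊤)) = 0
  finite_frobenius : ∀ U : X.affineOpens, ∀ _ : ExpChar Γ(X, U.1) p,
    (frobenius Γ(X, U.1) p).Finite

/-! ### Divisors -/

/-- Prime divisors of `X`, represented by their generic points (the points of codimension one). -/
abbrev PrimeDivisor (X : Scheme.{u}) : Type u := {x : X // Order.coheight x = 1}

theorem isDiscreteValuationRing_stalk {X : Scheme.{u}} [IsIntegral X] [IsLocallyNoetherian X]
    [IsNormalScheme X] (x : PrimeDivisor X) : IsDiscreteValuationRing (X.presheaf.stalk x.1) := by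
  have : Ring.KrullDimLE 1 (X.presheaf.stalk x.1) := krullDimLE_of_coheight_le x.2.le
  have := IsNormalScheme.isIntegrallyClosed_stalk x.1
  have hnf : ¬ IsField (X.presheaf.stalk x.1) := by
    intro h
    have h0 := ringKrullDim_eq_zero_of_isField h
    rw [ringKrullDim_stalk_eq_coheight, x.2] at h0
    exact absurd h0 (by decide)
  have hdim : Ring.DimensionLEOne (X.presheaf.stalk x.1) :=
    ⟨fun {P} h0 hP => Ring.krullDimLE_one_iff_of_noZeroDivisors.mp inferInstance P h0 hP⟩
  have : IsDedekindRing (X.presheaf.stalk x.1) := { }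
  have hD : IsDedekindDomain (X.presheaf.stalk x.1) := IsDedekindDomain.mk
  exact ((IsDiscreteValuationRing.TFAE (X.presheaf.stalk x.1) hnf).out 0 2).mpr hD

section Affine

variable {X : Scheme.{u}} [IsIntegral X] [IsLocallyNoetherian X]

/-- The coefficients of `Δ + div f`. -/
def addDiv (Δ : PrimeDivisor X → ℚ) (f : X.functionField) : PrimeDivisor X → ℚ :=
  fun x => Δ x + (Scheme.ord f x.1 : ℚ)

/-- The restriction of `Δ` to `U` is effective. -/
def EffectiveOn (U : X.Opens) (Δ : PrimeDivisor X → ℚ) : Prop :=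
  ∀ x : PrimeDivisor X, x.1 ∈ U → 0 ≤ Δ x

variable [IsNormalScheme X] (U : X.Opens) [Nonempty U]

/-- `Γ(U, 𝒪_X(D))` as a submodule of the function field: `0` together with the rational functions
`f` such that `div f + D` is effective on `U`. -/
def divisorSections (D : PrimeDivisor X → ℤ) : Submodule Γ(X, U) X.functionField where
  carrier := {f | f ≠ 0 → ∀ x : PrimeDivisor X, x.1 ∈ U → 0 ≤ Scheme.ord f x.1 + D x}
  zero_mem' := fun h => absurd rfl h
  add_mem' := by
    intro f g hf hg hfg x hx
    have := isDiscreteValuationRing_stalk x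
    by_cases hf0 : f = 0
    · subst hf0
      rw [zero_add] at hfg ⊢
      exact hg hfg x hx
    by_cases hg0 : g = 0
    · subst hg0
      rw [add_zero] at hfg ⊢
      exact hf hfg x hx
    have h := Scheme.ord_add (x := x.1) hfg
    have h1 := hf hf0 x hx
    have h2 := hg hg0 x hx
    rcases min_le_iff.mp h with h | h <;> omega
  smul_mem' := by
    intro a f hf haf x hx
    have ha : a ≠ 0 := fun h => haf (by rw [h, zero_smul])
    have hf0 : f ≠ 0 := fun h => haf (by rw [h, smul_zero])
    have h := Scheme.ord_le_smul hx ha f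
    have h1 := hf hf0 x hx
    omega

/-- `p^{-e}`-linearity of an additive map between modules over a ring of characteristic `p`,
i.e. `R`-linearity as a map `F^e_* M → N`. -/
def IsPInvLinear (R : Type*) [CommRing R] {M N : Type*} [AddCommGroup M] [Module R M]
    [AddCommGroup N] [Module R N] (p e : ℕ) (φ : M →+ N) : Prop :=
  ∀ (r : R) (x : M), φ (r ^ p ^ e • x) = r • φ x

/-- The integral divisor `⌈(p^e - 1) Δ⌉`. -/
def ceilMul (p e : ℕ) (Δ : PrimeDivisor X → ℚ) : PrimeDivisor X → ℤ :=
  fun x => ⌈((p : ℚ) ^ e - 1) * Δ x⌉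

/-- With `R = Γ(X, U)`: the maps in the image of
`Hom_R(F^e_* R(⌈(p^e - 1) Δ⌉), R) → Hom_R(F^e_* R, R)`. This is used for `Δ` effective on `U`, so
that `R ⊆ R(⌈(p^e - 1) Δ⌉)`. -/
def IsCompatibleMap (p e : ℕ) (Δ : PrimeDivisor X → ℚ) (φ : Γ(X, U) →+ Γ(X, U)) : Prop :=
  IsPInvLinear Γ(X, U) p e φ ∧
    ∃ ψ : divisorSections U (ceilMul p e Δ) →+ Γ(X, U), IsPInvLinear Γ(X, U) p e ψ ∧
      ∀ (r : Γ(X, U)) (hr : algebraMap Γ(X, U) X.functionField r ∈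
        divisorSections U (ceilMul p e Δ)), ψ ⟨_, hr⟩ = φ r

/-- The nonzero ideals `J` with `φ(F^e_*(𝔞^{⌈t(p^e - 1)⌉} J)) ⊆ J` for all `e ≥ 0` and all `φ`
compatible with `Δ`. -/
def stableIdeals (p : ℕ) (Δ : PrimeDivisor X → ℚ) (𝔞 : Ideal Γ(X, U)) (t : ℝ) :
    Set (Ideal Γ(X, U)) :=
  {J | J ≠ ⊥ ∧ ∀ (e : ℕ) (φ : Γ(X, U) →+ Γ(X, U)), IsCompatibleMap U p e Δ φ →
    ∀ x ∈ 𝔞 ^ ⌈t * ((p : ℝ) ^ e - 1)⌉₊ * J, φ x ∈ J}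

/-- For `U` affine: the fractional ideal `M` is the big test ideal `τ_b(U; Δ|_U, 𝔞^t)`, where `Δ`
need not be effective. That is, some nonzero section `f` of `𝒪_X` over `U` makes `Δ + div f`
effective on `U`, and for every such `f` there is a smallest nonzero stable ideal `J` for
`Δ + div f` (the big test ideal `τ_b(U; Δ + div f, 𝔞^t)`) and `M = (1 / f) J`. -/
structure IsBigTestIdeal (p : ℕ) (Δ : PrimeDivisor X → ℚ) (𝔞 : Ideal Γ(X, U)) (t : ℝ)
    (M : Submodule Γ(X, U) X.functionField) : Prop where
  exists_effective : ∃ f : Γ(X, U), f ≠ 0 ∧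
    EffectiveOn U (addDiv Δ (algebraMap Γ(X, U) X.functionField f))
  eq_div : ∀ f : Γ(X, U), f ≠ 0 →
    EffectiveOn U (addDiv Δ (algebraMap Γ(X, U) X.functionField f)) →
    ∃ J : Ideal Γ(X, U),
      IsLeast (stableIdeals U p (addDiv Δ (algebraMap Γ(X, U) X.functionField f)) 𝔞 t) J ∧
      (M : Set X.functionField) =
        {y | ∃ x ∈ J, y = algebraMap Γ(X, U) X.functionField x /
          algebraMap Γ(X, U) X.functionField f}

theorem IsBigTestIdeal.unique {p : ℕ} {Δ : PrimeDivisor X → ℚ} {𝔞 : Ideal Γ(X, U)} {t : ℝ}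
    {M N : Submodule Γ(X, U) X.functionField} (hM : IsBigTestIdeal U p Δ 𝔞 t M)
    (hN : IsBigTestIdeal U p Δ 𝔞 t N) : M = N := by
  obtain ⟨f, hf, hf'⟩ := hM.exists_effective
  obtain ⟨J, hJ, hMJ⟩ := hM.eq_div f hf hf'
  obtain ⟨J', hJ', hNJ⟩ := hN.eq_div f hf hf'
  obtain rfl := hJ.unique hJ'
  exact SetLike.coe_injective (hMJ.trans hNJ.symm)

end Affine

/-! ### Finite surjective morphisms -/

section Morphism

variable {X Y : Scheme.{u}} (π : Y ⟶ X)

instance nonempty_preimage [Surjective π] (U : X.Opens) [h : Nonempty U] :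
    Nonempty (π ⁻¹ᵁ U) := by
  obtain ⟨x, hx⟩ := h
  obtain ⟨y, rfl⟩ := π.surjective x
  exact ⟨⟨y, hx⟩⟩

theorem map_genericPoint_specializes [IrreducibleSpace X] [IrreducibleSpace Y] [Surjective π] :
    π (genericPoint Y) ⤳ genericPoint X := by
  obtain ⟨y, hy⟩ := π.surjective (genericPoint X)
  rw [← hy]
  exact (genericPoint_specializes y).map π.continuous

/-- The inclusion of function fields `K(X) → K(Y)` induced by `π`. -/
def functionFieldMap [IsIntegral X] [IsIntegral Y] [Surjective π] :
    X.functionField →+* Y.functionField :=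
  (X.presheaf.stalkSpecializes (map_genericPoint_specializes π) ≫
    π.stalkMap (genericPoint Y)).hom

/-- `K(Y)` is a separable extension of `K(X)`. -/
def IsSeparableMorphism [IsIntegral X] [IsIntegral Y] [Surjective π] : Prop :=
  letI := (functionFieldMap π).toAlgebra
  Algebra.IsSeparable X.functionField Y.functionField

/-- The field trace `K(Y) → K(X)`. -/
def fieldTrace [IsIntegral X] [IsIntegral Y] [Surjective π] :
    Y.functionField → X.functionField :=
  letI := (functionFieldMap π).toAlgebra
  Algebra.trace X.functionField Y.functionField

/-- The ramification index at `y`: the length of `𝒪_{Y,y} / 𝔪_{π(y)} 𝒪_{Y,y}`. If both local rings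
are discrete valuation rings, this is the valuation at `y` of a uniformizer of `𝒪_{X,π(y)}`. -/
def ramificationIndex (y : Y) : ℕ :=
  (Module.length (Y.presheaf.stalk y) (Y.presheaf.stalk y ⧸
    (IsLocalRing.maximalIdeal (X.presheaf.stalk (π y))).map (π.stalkMap y).hom)).toNat

open scoped Classical in
/-- The coefficients of `π^* Δ`. (For `π` finite surjective and `X`, `Y` normal, the image of a
point of codimension one has codimension one, so the second branch does not occur.) -/
def pullbackDivisor (Δ : PrimeDivisor X → ℚ) : PrimeDivisor Y → ℚ :=
  fun y => if h : Order.coheight (π y.1) = 1 then Δ ⟨π y.1, h⟩ * ramificationIndex π y.1 else 0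

/-- The coefficients of the ramification divisor: the length at `y` of the stalk of the sheaf of
relative differentials `Ω_{Y/X}`. -/
def ramificationDivisor : PrimeDivisor Y → ℚ :=
  fun y =>
    letI := (π.stalkMap y.1).hom.toAlgebra
    ((Module.length (Y.presheaf.stalk y.1)
      (Ω[Y.presheaf.stalk y.1⁄X.presheaf.stalk (π y.1)])).toNat : ℚ)

end Morphism

end TestIdeal

end

set_option linter.unusedSectionVars false

/-! ### The Cartier operator in one variable -/

section Cartier

open Polynomial

theorem Polynomial.coeff_pow_pred_mul_derivative {R : Type*} [CommRing R] (p : ℕ) [hp : Fact p.Prime]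
    [CharP R p] (P : R[X]) (k : ℕ) :
    (P ^ (p - 1) * derivative P).coeff (k * p + (p - 1)) = (k + 1) * P.coeff (k + 1) ^ p := by
  have hp1 : 1 ≤ p := hp.out.one_le
  let σ : MvPolynomial R ℤ →+* R := MvPolynomial.eval₂Hom (Int.castRingHom R) id
  have hσ : Function.Surjective σ := fun r => ⟨MvPolynomial.X r, by simp [σ]⟩
  obtain ⟨Q, rfl⟩ := Polynomial.map_surjective σ hσ P
  have key : (Q ^ (p - 1) * derivative Q).coeff (k * p + (p - 1))
      = (k + 1) * (Q ^ p).coeff ((k + 1) * p) := by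
    have h1 : derivative (Q ^ p) = (p : (MvPolynomial R ℤ)[X]) * (Q ^ (p - 1) * derivative Q) := by
      rw [derivative_pow, mul_assoc]; simp
    have h2 := congrArg (fun T => T.coeff (k * p + (p - 1))) h1
    have e1 : k * p + (p - 1) + 1 = (k + 1) * p := by
      rw [add_assoc, Nat.sub_add_cancel hp1, add_mul, one_mul]
    have e2 : ((k * p + (p - 1) : ℕ) : MvPolynomial R ℤ) + 1 = (k + 1) * p := by
      exact_mod_cast congrArg (Nat.cast : ℕ → MvPolynomial R ℤ) e1
    simp only [coeff_derivative, e1, e2, coeff_natCast_mul] at h2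
    have hp0 : (p : MvPolynomial R ℤ) ≠ 0 := by exact_mod_cast hp.out.ne_zero
    apply mul_left_cancel₀ hp0
    rw [← h2]; ring
  have h3 := congrArg σ key
  rw [← coeff_map] at h3
  simp only [Polynomial.map_mul, Polynomial.map_pow, ← derivative_map] at h3
  rw [h3, map_mul, ← coeff_map, Polynomial.map_pow]
  congr 1
  · simp
  · rw [← Polynomial.map_frobenius_expand, coeff_map, Polynomial.coeff_expand_mul hp.out.pos,
      frobenius_def]

variable {F L : Type*} [Field F] [Field L] [Algebra F L] (p : ℕ) [hp : Fact p.Prime]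

/-- `c` reads off the coefficient of `y ^ (p - 1)`. -/
def IsTopCoeff (y : L) (c : L →ₗ[F] F) : Prop :=
  ∀ j < p, c (y ^ j) = if j = p - 1 then 1 else 0

variable {p}

theorem IsTopCoeff.apply_pow {y : L} {b : F} (hb : algebraMap F L b = y ^ p) {c : L →ₗ[F] F}
    (hc : IsTopCoeff p y c) (m : ℕ) :
    c (y ^ m) = if m % p = p - 1 then b ^ (m / p) else 0 := by
  conv_lhs => rw [← Nat.div_add_mod m p, pow_add, pow_mul, ← hb, ← map_pow, ← Algebra.smul_def]
  rw [map_smul, hc _ (Nat.mod_lt _ hp.out.pos)]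
  split_ifs <;> simp

theorem IsTopCoeff.aeval_eq_sum {y : L} {b : F} (hb : algebraMap F L b = y ^ p) {c : L →ₗ[F] F}
    (hc : IsTopCoeff p y c) (Q : F[X]) {N : ℕ} (hN : Q.natDegree < N * p) :
    c (aeval y Q) = ∑ k ∈ Finset.range N, Q.coeff (k * p + (p - 1)) * b ^ k := by
  have hp0 : 0 < p := hp.out.pos
  rw [aeval_eq_sum_range' hN, map_sum, Finset.sum_congr rfl fun i _ => by
    rw [map_smul, hc.apply_pow hb, smul_eq_mul]]
  rw [← Finset.sum_subset (s₁ := (Finset.range N).image fun k => k * p + (p - 1))]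
  · rw [Finset.sum_image]
    · refine Finset.sum_congr rfl fun k _ => ?_
      have h1 : (k * p + (p - 1)) % p = p - 1 := by
        rw [Nat.mul_comm, Nat.mul_add_mod, Nat.mod_eq_of_lt (by omega)]
      have h2 : (k * p + (p - 1)) / p = k := by
        rw [Nat.mul_comm, Nat.mul_add_div hp0, Nat.div_eq_of_lt (by omega), add_zero]
      rw [if_pos h1, h2]
    · intro a _ a' _ h
      exact Nat.eq_of_mul_eq_mul_right hp0 (Nat.add_right_cancel h)
  · intro m hm
    simp only [Finset.mem_image, Finset.mem_range] at hm ⊢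
    obtain ⟨k, hk, rfl⟩ := hm
    have : (k + 1) * p ≤ N * p := Nat.mul_le_mul_right p hk
    rw [add_mul, one_mul] at this
    omega
  · intro m hm hm'
    rw [if_neg, mul_zero]
    intro h
    apply hm'
    simp only [Finset.mem_image, Finset.mem_range] at hm ⊢
    refine ⟨m / p, Nat.div_lt_of_lt_mul (by rwa [mul_comm]), ?_⟩
    rw [← h, mul_comm]; exact Nat.div_add_mod m p

variable [CharP F p]

theorem IsTopCoeff.derivative_eq_zero {y : L} {b : F} (hb : algebraMap F L b = y ^ p)
    {c : L →ₗ[F] F} (hc : IsTopCoeff p y c) (P : F[X]) : c (aeval y (derivative P)) = 0 := by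
  have hp0 : 0 < p := hp.out.pos
  rw [hc.aeval_eq_sum hb _ (N := (derivative P).natDegree + 1)]
  · refine Finset.sum_eq_zero fun k _ => ?_
    have : ((k * p + (p - 1) : ℕ) : F) + 1 = 0 := by
      have : ((k * p + (p - 1) + 1 : ℕ) : F) = 0 := by
        rw [CharP.cast_eq_zero_iff F p, add_assoc, Nat.sub_add_cancel hp0]
        exact Dvd.intro_left (k + 1) (by ring)
      exact_mod_cast this
    rw [coeff_derivative, this]; simp
  · nlinarith

theorem IsTopCoeff.deriv_mul_pow {y : L} {b : F} (hb : algebraMap F L b = y ^ p)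
    {c : L →ₗ[F] F} (hc : IsTopCoeff p y c) (P : F[X]) {j : ℕ} (hj : j < p) :
    algebraMap F L (c (aeval y (derivative P) * aeval y P ^ j)) =
      if j = p - 1 then aeval y (derivative P) ^ p else 0 := by
  have hp0 : 0 < p := hp.out.pos
  have : CharP L p := charP_of_injective_algebraMap (algebraMap F L).injective p
  rw [← map_pow, ← map_mul]
  split_ifs with h
  · subst h
    rw [mul_comm, hc.aeval_eq_sum hb _ (N := (P ^ (p - 1) * derivative P).natDegree +
      P.natDegree + 1)]
    · simp_rw [Polynomial.coeff_pow_pred_mul_derivative]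
      rw [aeval_eq_sum_range' (n := (P ^ (p - 1) * derivative P).natDegree +
        P.natDegree + 1), sum_pow_char, map_sum]
      · refine Finset.sum_congr rfl fun k _ => ?_
        rw [map_mul, map_pow, hb, coeff_derivative, Algebra.smul_def, mul_pow, ← pow_mul, ← pow_mul,
          mul_comm p k, map_mul, map_mul, mul_pow, ← map_pow, mul_comm (algebraMap F L _)]
        have : ((k : L) + 1) ^ p = k + 1 := by
          have h := map_natCast (frobenius L p) (k + 1)
          rw [frobenius_def] at h
          exact_mod_cast h
        rw [map_add, map_natCast, map_one, this, map_pow]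
      · have := natDegree_derivative_le P
        omega
    · nlinarith
  · have hj1 : ((j + 1 : ℕ) : F) ≠ 0 := by
      rw [Ne, CharP.cast_eq_zero_iff F p]
      intro hd
      have := Nat.le_of_dvd (by omega) hd
      omega
    have h1 : derivative (P ^ (j + 1)) = ((j + 1 : ℕ) : F) • (derivative P * P ^ j) := by
      rw [derivative_pow, Polynomial.smul_eq_C_mul]; simp; ring
    have h2 := hc.derivative_eq_zero hb (P ^ (j + 1))
    rw [h1, map_smul, map_smul, smul_eq_mul] at h2
    rw [(mul_eq_zero.mp h2).resolve_left hj1, map_zero]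

theorem IsTopCoeff.deriv_mul {y : L} {b : F} (hb : algebraMap F L b = y ^ p)
    {c d : L →ₗ[F] F} (hc : IsTopCoeff p y c) (P : F[X]) (hd : IsTopCoeff p (aeval y P) d)
    (Q : F[X]) :
    algebraMap F L (c (aeval y (derivative P) * aeval (aeval y P) Q)) =
      aeval y (derivative P) ^ p * algebraMap F L (d (aeval (aeval y P) Q)) := by
  have hp0 : 0 < p := hp.out.pos
  have : CharP L p := charP_of_injective_algebraMap (algebraMap F L).injective p
  set x := aeval y P with hx
  obtain ⟨b', hb'⟩ : ∃ b' : F, algebraMap F L b' = x ^ p := by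
    refine ⟨∑ i ∈ Finset.range (P.natDegree + 1), P.coeff i ^ p * b ^ i, ?_⟩
    rw [hx, aeval_eq_sum_range, sum_pow_char, map_sum]
    refine Finset.sum_congr rfl fun i _ => ?_
    rw [map_mul, map_pow, map_pow, hb, Algebra.smul_def, mul_pow, ← pow_mul, ← pow_mul, mul_comm p i]
  rw [aeval_eq_sum_range (p := Q), Finset.mul_sum, map_sum, map_sum, map_sum, map_sum,
    Finset.mul_sum]
  refine Finset.sum_congr rfl fun m _ => ?_
  rw [mul_smul_comm, c.map_smul, d.map_smul, smul_eq_mul, smul_eq_mul, (algebraMap F L).map_mul,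
    (algebraMap F L).map_mul, mul_left_comm]
  congr 1
  have e : x ^ m = b' ^ (m / p) • x ^ (m % p) := by
    conv_lhs => rw [← Nat.div_add_mod m p, pow_add, pow_mul, ← hb', ← map_pow, ← Algebra.smul_def]
  rw [e, mul_smul_comm, c.map_smul, d.map_smul, smul_eq_mul, smul_eq_mul, (algebraMap F L).map_mul,
    (algebraMap F L).map_mul, mul_left_comm, hc.deriv_mul_pow hb P (Nat.mod_lt m hp0), hd _ (Nat.mod_lt m hp0)]
  congr 1
  split_ifs <;> simp

end Cartier

/-! ### Discrete valuations, additively -/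

section IsOrd

variable {L : Type*} [Field L]

/-- `ord` is a normalized discrete valuation, with a junk value at `0`. -/
structure IsOrd (ord : L → ℤ) : Prop where
  map_mul : ∀ {f g : L}, f ≠ 0 → g ≠ 0 → ord (f * g) = ord f + ord g
  map_add : ∀ {f g : L}, f ≠ 0 → g ≠ 0 → f + g ≠ 0 → min (ord f) (ord g) ≤ ord (f + g)
  exists_eq_one : ∃ w : L, w ≠ 0 ∧ ord w = 1

namespace IsOrd

variable {ord : L → ℤ} (h : IsOrd ord)
include h

theorem map_one : ord 1 = 0 := by
  have := h.map_mul (one_ne_zero (α := L)) one_ne_zero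
  rw [one_mul] at this; omega

theorem map_inv {f : L} (hf : f ≠ 0) : ord f⁻¹ = -ord f := by
  have := h.map_mul hf (inv_ne_zero hf)
  rw [mul_inv_cancel₀ hf, h.map_one] at this; omega

theorem map_neg (f : L) : ord (-f) = ord f := by
  rcases eq_or_ne f 0 with rfl | hf
  · simp
  have h1 : ord (-1) = 0 := by
    have := h.map_mul (f := -1) (g := -1) (by simp) (by simp)
    rw [neg_one_mul, neg_neg, h.map_one] at this; omega
  rw [← neg_one_mul, h.map_mul (by simp) hf, h1, zero_add]

theorem map_pow {f : L} (hf : f ≠ 0) (n : ℕ) : ord (f ^ n) = n * ord f := by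
  induction n with
  | zero => simp [h.map_one]
  | succ n ih => rw [pow_succ, h.map_mul (pow_ne_zero _ hf) hf, ih]; push_cast; ring

theorem map_zpow {f : L} (hf : f ≠ 0) (n : ℤ) : ord (f ^ n) = n * ord f := by
  obtain ⟨n, rfl | rfl⟩ := n.eq_nat_or_neg
  · rw [zpow_natCast, h.map_pow hf]
  · rw [zpow_neg, zpow_natCast, h.map_inv (pow_ne_zero _ hf), h.map_pow hf]; ring

/-- The elements of valuation at least `n`. -/
def filt (n : ℤ) : AddSubgroup L where
  carrier := {f | f ≠ 0 → n ≤ ord f}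
  zero_mem' := fun h => absurd rfl h
  add_mem' := by
    intro f g hf hg hfg
    rcases eq_or_ne f 0 with rfl | hf0
    · rw [zero_add] at hfg ⊢; exact hg hfg
    rcases eq_or_ne g 0 with rfl | hg0
    · rw [add_zero] at hfg ⊢; exact hf hfg
    exact (le_min (hf hf0) (hg hg0)).trans (h.map_add hf0 hg0 hfg)
  neg_mem' := by
    intro f hf hf0
    rw [h.map_neg]; exact hf (by simpa using hf0)

theorem mem_filt_of_ne {n : ℤ} {f : L} (hf : f ≠ 0) : f ∈ h.filt n ↔ n ≤ ord f :=
  ⟨fun hn => hn hf, fun hn _ => hn⟩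

theorem filt_mono {m n : ℤ} (hmn : m ≤ n) {f : L} (hf : f ∈ h.filt n) : f ∈ h.filt m :=
  fun hf0 => hmn.trans (hf hf0)

theorem one_mem : (1 : L) ∈ h.filt 0 := fun _ => h.map_one.ge

theorem mul_mem {m n : ℤ} {f g : L} (hf : f ∈ h.filt m) (hg : g ∈ h.filt n) :
    f * g ∈ h.filt (m + n) := by
  intro h0
  have hf0 := left_ne_zero_of_mul h0
  have hg0 := right_ne_zero_of_mul h0
  rw [h.map_mul hf0 hg0]
  exact add_le_add (hf hf0) (hg hg0)

theorem mul_mem_zero {f g : L} (hf : f ∈ h.filt 0) (hg : g ∈ h.filt 0) : f * g ∈ h.filt 0 := by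
  simpa using h.mul_mem hf hg

theorem mul_mem_iff {n : ℤ} {f g : L} (hf : f ≠ 0) :
    f * g ∈ h.filt n ↔ g ∈ h.filt (n - ord f) := by
  rcases eq_or_ne g 0 with rfl | hg
  · simp
  rw [h.mem_filt_of_ne (mul_ne_zero hf hg), h.mem_filt_of_ne hg, h.map_mul hf hg]
  omega

theorem pow_mem {f : L} (hf : f ∈ h.filt 0) (n : ℕ) : f ^ n ∈ h.filt 0 := by
  induction n with
  | zero => simpa using h.one_mem
  | succ n ih => rw [pow_succ]; exact h.mul_mem_zero ih hf

theorem of_pow_mem {f : L} {n : ℕ} (hn : n ≠ 0) (hf : f ^ n ∈ h.filt 0) : f ∈ h.filt 0 := by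
  intro hf0
  have := hf (pow_ne_zero _ hf0)
  rw [h.map_pow hf0] at this
  exact (mul_nonneg_iff_of_pos_left (by exact_mod_cast Nat.pos_of_ne_zero hn)).mp this

theorem forall_mem_of_sum_mem {ι : Type*} (s : Finset ι) (f : ι → L)
    (hinj : ∀ i ∈ s, ∀ j ∈ s, f i ≠ 0 → f j ≠ 0 → ord (f i) = ord (f j) → i = j) {n : ℤ}
    (hs : ∑ i ∈ s, f i ∈ h.filt n) : ∀ i ∈ s, f i ∈ h.filt n := by
  classical
  by_contra! hcon
  obtain ⟨i, his, hi⟩ := hcon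
  obtain ⟨j, hj, hmin⟩ := Finset.exists_min_image (s.filter fun i => f i ∉ h.filt n)
    (fun i => ord (f i)) ⟨i, by simp [his, hi]⟩
  simp only [Finset.mem_filter] at hj hmin
  have hj0 : f j ≠ 0 := fun h0 => hj.2 (h0 ▸ zero_mem _)
  have hjn : ord (f j) < n := by
    by_contra! hc; exact hj.2 fun _ => hc
  have hrest : ∀ i ∈ s.erase j, f i ∈ h.filt (ord (f j) + 1) := by
    intro i hi hi0
    have hi' := Finset.mem_erase.mp hi
    by_cases hin : f i ∈ h.filt n
    · have := hin hi0; omega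
    · have h1 := hmin i ⟨hi'.2, hin⟩
      have h2 : ord (f i) ≠ ord (f j) := fun he => hi'.1 (hinj i hi'.2 j hj.1 hi0 hj0 he)
      omega
  rw [← Finset.add_sum_erase s f hj.1] at hs
  have h1 := sub_mem (h.filt_mono (by omega : ord (f j) + 1 ≤ n) hs) (sum_mem hrest)
  rw [add_sub_cancel_right] at h1
  have := h1 hj0
  omega

/-- The valuation ring. -/
def integers : Subring L where
  __ := h.filt 0
  one_mem' := h.one_mem
  mul_mem' := h.mul_mem_zero

/-- The maximal ideal of the valuation ring. -/
def maxIdeal : Ideal h.integers where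
  carrier := {x | (x : L) ∈ h.filt 1}
  zero_mem' := by simp
  add_mem' := fun {a b} ha hb => by
    simp only [Set.mem_ofPred_eq] at ha hb ⊢
    simpa using add_mem ha hb
  smul_mem' := fun c x hx => by
    simp only [Set.mem_ofPred_eq] at hx ⊢
    simpa using h.mul_mem c.2 hx

theorem mem_maxIdeal {x : h.integers} : x ∈ h.maxIdeal ↔ (x : L) ∈ h.filt 1 := Iff.rfl

theorem isMaximal_maxIdeal : h.maxIdeal.IsMaximal := by
  rw [Ideal.isMaximal_iff]
  refine ⟨fun h1 => ?_, fun J x hJ hx hxJ => ?_⟩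
  · have := (h.mem_maxIdeal.mp h1) (by simp)
    simp [h.map_one] at this
  · have hx0 : (x : L) ≠ 0 := fun h0 => hx (h.mem_maxIdeal.mpr (h0 ▸ zero_mem _))
    have h1 : ord (x : L) ≤ 0 := by
      by_contra! hc
      exact hx (h.mem_maxIdeal.mpr fun _ => hc)
    have hinv : (x : L)⁻¹ ∈ h.integers := fun _ => by rw [h.map_inv hx0]; omega
    have : (⟨_, hinv⟩ : h.integers) * x = 1 := Subtype.ext (by simp [hx0])
    rw [← this]
    exact J.mul_mem_left _ hxJ

end IsOrd

end IsOrd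

/-! ### Purely inseparable extensions of degree `p` -/

section Inseparable

open Polynomial

variable {F L : Type*} [Field F] [Field L] [Algebra F L] {p : ℕ} [hp : Fact p.Prime] [CharP F p]

theorem minpoly_eq_X_pow_sub_C {y : L} (hy : y ∉ (algebraMap F L).range) {b : F}
    (hb : algebraMap F L b = y ^ p) : minpoly F y = X ^ p - C b := by
  have : CharP L p := charP_of_injective_algebraMap (algebraMap F L).injective p
  have hirr : Irreducible (X ^ p - C b : F[X]) := by
    refine X_pow_sub_C_irreducible_of_prime hp.out fun a ha => hy ⟨a, ?_⟩
    apply frobenius_inj L p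
    rw [frobenius_def, frobenius_def, ← hb, ← map_pow, ha]
  exact (minpoly.eq_of_irreducible_of_monic hirr (by simp [hb])
    (monic_X_pow_sub_C _ hp.out.ne_zero)).symm

omit [CharP F p] in
theorem isIntegral_of_pow_eq {y : L} {b : F} (hb : algebraMap F L b = y ^ p) : IsIntegral F y :=
  ⟨X ^ p - C b, monic_X_pow_sub_C _ hp.out.ne_zero, by simp [hb]⟩

theorem eq_zero_of_aeval_eq_zero {y : L} (hy : y ∉ (algebraMap F L).range) {b : F}
    (hb : algebraMap F L b = y ^ p) {P : F[X]} (hP : P.natDegree < p) (h : aeval y P = 0) :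
    P = 0 := by
  by_contra hP0
  have h1 := natDegree_le_of_dvd (minpoly.dvd F y h) hP0
  rw [minpoly_eq_X_pow_sub_C hy hb, natDegree_X_pow_sub_C] at h1
  omega

theorem exists_aeval_eq {y z : L} (hy : y ∉ (algebraMap F L).range) {b : F}
    (hb : algebraMap F L b = y ^ p) (hz : z ∈ IntermediateField.adjoin F {y}) :
    ∃ P : F[X], P.natDegree < p ∧ aeval y P = z := by
  have hint := isIntegral_of_pow_eq hb
  rw [← IntermediateField.mem_toSubalgebra,
    IntermediateField.adjoin_simple_toSubalgebra_of_isAlgebraic hint.isAlgebraic,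
    Algebra.adjoin_singleton_eq_range_aeval] at hz
  obtain ⟨P, rfl⟩ := hz
  refine ⟨P %ₘ minpoly F y, ?_, minpoly.aeval_modByMonic_minpoly P y⟩
  have h1 : (minpoly F y).natDegree = p := by
    rw [minpoly_eq_X_pow_sub_C hy hb, natDegree_X_pow_sub_C]
  conv_rhs => rw [← h1]
  exact natDegree_modByMonic_lt P (minpoly.monic hint) fun h => by
    rw [h, natDegree_one] at h1; exact hp.out.ne_zero h1.symm

theorem finrank_adjoin_eq {y : L} (hy : y ∉ (algebraMap F L).range) {b : F}
    (hb : algebraMap F L b = y ^ p) :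
    Module.finrank F (IntermediateField.adjoin F {y}) = p := by
  rw [IntermediateField.adjoin.finrank (isIntegral_of_pow_eq hb), minpoly_eq_X_pow_sub_C hy hb,
    natDegree_X_pow_sub_C]

theorem adjoin_eq_of_mem {y t : L} (hy : y ∉ (algebraMap F L).range) {b : F}
    (hb : algebraMap F L b = y ^ p) (ht : t ∉ (algebraMap F L).range) {b' : F}
    (hb' : algebraMap F L b' = t ^ p) (hyt : y ∈ IntermediateField.adjoin F {t}) :
    IntermediateField.adjoin F {y} = IntermediateField.adjoin F {t} := by
  have : FiniteDimensional F (IntermediateField.adjoin F {t}) :=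
    IntermediateField.adjoin.finiteDimensional (isIntegral_of_pow_eq hb')
  exact IntermediateField.eq_of_le_of_finrank_eq
    (IntermediateField.adjoin_simple_le_iff.mpr hyt)
    ((finrank_adjoin_eq hy hb).trans (finrank_adjoin_eq ht hb').symm)

theorem exists_isTopCoeff {y : L} (hy : y ∉ (algebraMap F L).range) {b : F}
    (hb : algebraMap F L b = y ^ p) : ∃ c : L →ₗ[F] F, IsTopCoeff p y c := by
  have hli : LinearIndependent F fun i : Fin p => y ^ (i : ℕ) := by
    have := linearIndependent_pow (K := F) y
    rw [minpoly_eq_X_pow_sub_C hy hb, natDegree_X_pow_sub_C] at this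
    exact this
  let g : Submodule.span F (Set.range fun i : Fin p => y ^ (i : ℕ)) →ₗ[F] F :=
    (Module.Basis.span hli).constr F fun i => if (i : ℕ) = p - 1 then 1 else 0
  obtain ⟨c, hc⟩ := g.exists_extend
  refine ⟨c, fun j hj => ?_⟩
  have h1 : c (Module.Basis.span hli ⟨j, hj⟩ : L) = g (Module.Basis.span hli ⟨j, hj⟩) :=
    congrArg (fun f => f (Module.Basis.span hli ⟨j, hj⟩)) hc
  have h2 : (Module.Basis.span hli ⟨j, hj⟩ : L) = y ^ j :=
    congrArg Subtype.val (Module.Basis.span_apply hli ⟨j, hj⟩)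
  rw [h2] at h1
  rw [h1]
  exact Module.Basis.constr_basis _ _ _ _

/-- A derivation that kills `x ^ p` extends to `F(x)` with any prescribed value at `x`. -/
theorem exists_derivation_extend {x : L} (hx : x ∉ (algebraMap F L).range) {b : F}
    (hb : algebraMap F L b = x ^ p) (D : Derivation ℤ F L) (hD : D b = 0) (w : L) :
    ∃ D' : Derivation ℤ (IntermediateField.adjoin F {x}) L,
      (∀ a : F, D' (algebraMap F _ a) = D a) ∧
      D' (IntermediateField.AdjoinSimple.gen F x) = w := by
  have : CharP L p := charP_of_injective_algebraMap (algebraMap F L).injective p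
  let σ : F →+* TrivSqZeroExt L L :=
    { toFun := fun a => TrivSqZeroExt.inl (algebraMap F L a) + TrivSqZeroExt.inr (D a)
      map_one' := by simp
      map_zero' := by simp
      map_add' := fun a b => by ext <;> simp
      map_mul' := fun a b => by
        ext
        · simp
        · simp only [TrivSqZeroExt.snd_add, TrivSqZeroExt.snd_inl, TrivSqZeroExt.snd_inr,
            TrivSqZeroExt.snd_mul, TrivSqZeroExt.fst_add, TrivSqZeroExt.fst_inl,
            TrivSqZeroExt.fst_inr, Derivation.leibniz, Algebra.smul_def,
            MulOpposite.smul_eq_mul_unop, MulOpposite.unop_op]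
          simp [mul_comm] }
  let : Algebra F (TrivSqZeroExt L L) := σ.toAlgebra
  let pb := IntermediateField.adjoin.powerBasis (isIntegral_of_pow_eq hb)
  have hgen : pb.gen = IntermediateField.AdjoinSimple.gen F x := rfl
  let z : TrivSqZeroExt L L := TrivSqZeroExt.inl x + TrivSqZeroExt.inr w
  have : CharP (TrivSqZeroExt L L) p :=
    charP_of_injective_ringHom (f := TrivSqZeroExt.inlHom L L) TrivSqZeroExt.inl_injective p
  have hz : aeval z (minpoly F pb.gen) = 0 := by
    rw [hgen, IntermediateField.minpoly_gen, minpoly_eq_X_pow_sub_C hx hb]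
    have h1 : z ^ p = TrivSqZeroExt.inl (x ^ p) := by
      ext
      · simp [z]
      · simp [z, TrivSqZeroExt.snd_pow]
    have h2 : algebraMap F (TrivSqZeroExt L L) b = TrivSqZeroExt.inl (x ^ p) := by
      change σ b = _
      simp [σ, hD, hb]
    simp [h1, h2]
  let Θ := pb.lift z hz
  have hfst : ∀ e, (Θ e).fst = (e : L) := by
    intro e
    let f1 : IntermediateField.adjoin F {x} →+* L :=
      ((TrivSqZeroExt.fstHom ℤ L L).toRingHom).comp Θ.toRingHom
    have hf1 : ∀ a : F, f1 (algebraMap F _ a) = algebraMap F L a := fun a => by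
      change (Θ (algebraMap F _ a)).fst = _
      rw [Θ.commutes]
      change (σ a).fst = _
      simp [σ]
    let f2 : IntermediateField.adjoin F {x} →ₐ[F] L := { f1 with commutes' := hf1 }
    have : f2 = (IntermediateField.adjoin F {x}).val := by
      apply pb.algHom_ext
      change (Θ pb.gen).fst = _
      rw [pb.lift_gen]
      simp [z, hgen]
    exact congrArg (fun f => f e) this
  refine ⟨Derivation.mk' { toFun := fun e => (Θ e).snd, map_add' := by simp, map_smul' := by simp }
    ?_, fun a => ?_, ?_⟩
  · intro a b
    change (Θ (a * b)).snd = _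
    rw [map_mul, TrivSqZeroExt.snd_mul, hfst, hfst]
    rw [MulOpposite.smul_eq_mul_unop, MulOpposite.unop_op, mul_comm (Θ a).snd]
    rfl
  · change (Θ (algebraMap F _ a)).snd = _
    rw [Θ.commutes]
    change (σ a).snd = _
    simp [σ]
  · change (Θ _).snd = _
    rw [← hgen, pb.lift_gen]
    simp [z]

end Inseparable

/-! ### Integral generators of purely inseparable extensions of degree `p` -/

section Generator

open Polynomial

theorem le_of_forall_exists_add_mul {C B : Type*} [CommRing C] [IsLocalRing C] [IsNoetherianRing C]
    [CommRing B] (f : C →+* B) (hf : f.Finite) (M N : AddSubgroup B)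
    (hM : ∀ (c : C), ∀ m ∈ M, f c * m ∈ M) (hN : ∀ (c : C), ∀ n ∈ N, f c * n ∈ N) {c : C}
    (hc : c ∈ IsLocalRing.maximalIdeal C)
    (h : ∀ m ∈ M, ∃ n ∈ N, ∃ m' ∈ M, m = n + f c * m') : M ≤ N := by
  let : Algebra C B := f.toAlgebra
  have : Module.Finite C B := hf
  let M' : Submodule C B := { M with smul_mem' := fun c x hx => hM c x hx }
  let N' : Submodule C B := { N with smul_mem' := fun c x hx => hN c x hx }
  have : M' ≤ N' := by
    refine Submodule.le_of_le_smul_of_le_jacobson_bot (IsNoetherian.noetherian M')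
      (IsLocalRing.maximalIdeal_le_jacobson _) fun m hm => ?_
    obtain ⟨n, hn, m', hm', rfl⟩ := h m hm
    exact Submodule.add_mem_sup hn (Submodule.smul_mem_smul hc (n := m') hm')
  exact this

variable {L : Type*} [Field L] {p : ℕ} [hp : Fact p.Prime] [CharP L p] {ord : L → ℤ}

theorem Subfield.mem_range_algebraMap {F : Subfield L} {y : L} :
    y ∈ (algebraMap F L).range ↔ y ∈ F :=
  ⟨by rintro ⟨a, rfl⟩; exact a.2, fun h => ⟨⟨y, h⟩, rfl⟩⟩

omit [CharP L p] in
/-- A ramified generator. -/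
theorem IsOrd.coeff_mem_of_ord_eq_one (h : IsOrd ord) {F : Subfield L}
    (hF : ∀ a ∈ F, a ≠ 0 → (p : ℤ) ∣ ord a) {y : L} (hy0 : y ≠ 0) (hy : ord y = 1) {P : F[X]}
    (hP : P.natDegree < p) (hPy : aeval y P ∈ h.filt 0) (j : ℕ) : (P.coeff j : L) ∈ h.filt 0 := by
  rcases lt_or_ge j p with hj | hj
  swap
  · rw [coeff_eq_zero_of_natDegree_lt (by omega)]; exact zero_mem _
  rw [aeval_eq_sum_range' hP] at hPy
  have key := h.forall_mem_of_sum_mem (Finset.range p) _ ?_ hPy j (Finset.mem_range.mpr hj)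
  · rw [Algebra.smul_def, mul_comm, h.mul_mem_iff (pow_ne_zero _ hy0), h.map_pow hy0, hy] at key
    intro h0
    have h1 := key h0
    change _ ≤ ord (P.coeff j : L) at h1
    obtain ⟨q, hq⟩ := hF _ (P.coeff j).2 h0
    rw [hq] at h1 ⊢
    have hp0 : (0 : ℤ) < p := by exact_mod_cast hp.out.pos
    have : -1 < q := by
      by_contra! hc
      have : (p : ℤ) * q ≤ p * (-1) := mul_le_mul_of_nonneg_left hc hp0.le
      omega
    exact mul_nonneg hp0.le (by omega)
  · intro i hi i' hi' h0 h0' he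
    rw [Finset.mem_range] at hi hi'
    rw [Algebra.smul_def] at h0 h0' he
    have ha := left_ne_zero_of_mul h0
    have ha' := left_ne_zero_of_mul h0'
    rw [Algebra.smul_def, h.map_mul ha (pow_ne_zero _ hy0), h.map_mul ha' (pow_ne_zero _ hy0),
      h.map_pow hy0, h.map_pow hy0, hy] at he
    have h1 := hF _ (P.coeff i).2 ha
    have h2 := hF _ (P.coeff i').2 ha'
    change ord (P.coeff i : L) + _ = ord (P.coeff i' : L) + _ at he
    have h3 : (p : ℤ) ∣ (i : ℤ) - i' := by
      have : (i : ℤ) - i' = ord (P.coeff i' : L) - ord (P.coeff i : L) := by omega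
      rw [this]; exact dvd_sub h2 h1
    have h4 := Int.eq_zero_of_abs_lt_dvd h3 (by rw [abs_lt]; omega)
    omega

/-- A generator of the residue field extension. -/
theorem IsOrd.coeff_mem_filt_one (h : IsOrd ord) {F : Subfield L} (hF : ∀ z : L, z ^ p ∈ F)
    {y : L} (hy : y ∈ h.filt 0) (hyF : ∀ a ∈ F, a ∈ h.filt 0 → y - a ∉ h.filt 1) {P : F[X]}
    (hP : P.natDegree < p) (hP0 : ∀ j, (P.coeff j : L) ∈ h.filt 0)
    (hPy : aeval y P ∈ h.filt 1) (j : ℕ) : (P.coeff j : L) ∈ h.filt 1 := by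
  have := h.isMaximal_maxIdeal
  let : Field (h.integers ⧸ h.maxIdeal) := Ideal.Quotient.field _
  let q := Ideal.Quotient.mk h.maxIdeal
  have hq0 : ∀ x : h.integers, q x = 0 ↔ (x : L) ∈ h.filt 1 := fun x =>
    Ideal.Quotient.eq_zero_iff_mem
  have hcharO : CharP h.integers p :=
    (h.integers.subtype).charP Subtype.val_injective p
  have hchar : CharP (h.integers ⧸ h.maxIdeal) p := by
    rw [CharP.charP_iff_prime_eq_zero hp.out]
    have := congrArg q (CharP.cast_eq_zero h.integers p)
    rwa [map_natCast, map_zero] at this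
  let OF : Subring h.integers := F.toSubring.comap h.integers.subtype
  have hsub : ∀ z : h.integers ⧸ h.maxIdeal, z ∈ OF.map q → z⁻¹ ∈ OF.map q := by
    rintro _ ⟨a, ha, rfl⟩
    rcases eq_or_ne (q a) 0 with h0 | h0
    · rw [h0, inv_zero]; exact zero_mem _
    have ha1 : (a : L) ∉ h.filt 1 := fun hc => h0 ((hq0 a).mpr hc)
    have ha0 : (a : L) ≠ 0 := fun hc => ha1 (hc ▸ zero_mem _)
    have hinv : (a : L)⁻¹ ∈ h.integers := fun _ => by
      rw [h.map_inv ha0]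
      by_contra! hc
      exact ha1 fun _ => by omega
    refine ⟨⟨_, hinv⟩, F.inv_mem ha, ?_⟩
    refine eq_inv_of_mul_eq_one_left ?_
    rw [← _root_.map_mul, ← _root_.map_one q]
    congr 1
    exact Subtype.ext (inv_mul_cancel₀ ha0)
  let kF : Subfield (h.integers ⧸ h.maxIdeal) := { OF.map q with inv_mem' := hsub }
  have hyk : q ⟨y, hy⟩ ∉ (algebraMap kF _).range := by
    rw [Subfield.mem_range_algebraMap]
    rintro ⟨a, ha, hay⟩
    refine hyF a ha a.2 ?_
    have : q (⟨y, hy⟩ - a) = 0 := by rw [map_sub, hay, sub_self]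
    exact (hq0 _).mp this
  have hykp : q ⟨y, hy⟩ ^ p ∈ kF := ⟨⟨y, hy⟩ ^ p, hF y, _root_.map_pow q _ _⟩
  let c : ℕ → kF := fun j => ⟨q ⟨P.coeff j, hP0 j⟩, ⟨P.coeff j, hP0 j⟩, (P.coeff j).2, rfl⟩
  let Pbar : kF[X] := ∑ i ∈ Finset.range p, C (c i) * X ^ i
  have hcoeff : ∀ j < p, Pbar.coeff j = c j := by
    intro j hj
    simp only [Pbar, finsetSum_coeff, coeff_C_mul, coeff_X_pow]
    simp [hj]
  have hdeg : Pbar.natDegree < p := by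
    have h1 : Pbar.natDegree ≤ p - 1 := by
      refine natDegree_sum_le_of_forall_le _ _ fun i hi => ?_
      have := natDegree_C_mul_X_pow_le (c i) i
      rw [Finset.mem_range] at hi
      omega
    have := hp.out.pos
    omega
  have hev : aeval (q ⟨y, hy⟩) Pbar = 0 := by
    have : aeval (q ⟨y, hy⟩) Pbar
        = q (∑ i ∈ Finset.range p, ⟨P.coeff i, hP0 i⟩ * ⟨y, hy⟩ ^ i) := by
      simp only [Pbar, map_sum, _root_.map_mul, _root_.map_pow, aeval_C, aeval_X]
      rfl
    rw [this, hq0]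
    rw [aeval_eq_sum_range' hP] at hPy
    convert hPy
    push_cast
    rfl
  have hzero := eq_zero_of_aeval_eq_zero hyk (b := ⟨_, hykp⟩) rfl hdeg hev
  rcases lt_or_ge j p with hj | hj
  swap
  · rw [coeff_eq_zero_of_natDegree_lt (by omega)]; exact zero_mem _
  have h1 := hcoeff j hj
  rw [hzero, coeff_zero] at h1
  exact (hq0 ⟨P.coeff j, hP0 j⟩).mp (congrArg Subtype.val h1).symm

theorem IsOrd.exists_integral_generator (h : IsOrd ord) {B : Type*} [CommRing B] [IsLocalRing B]
    [IsNoetherianRing B] [CharP B p] [Algebra B L]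
    (hinj : Function.Injective (algebraMap B L))
    (hB : ∀ f : L, f ∈ (algebraMap B L).range ↔ f ∈ h.filt 0)
    (hfin : (frobenius B p).Finite) {F E : Subfield L} (hF : ∀ z : L, z ^ p ∈ F)
    (hFE : F < E) :
    ∃ y ∈ E, y ∉ F ∧ y ∈ h.filt 0 ∧ ∀ P : F[X], P.natDegree < p → aeval y P ∈ h.filt 0 →
      ∀ j, (P.coeff j : L) ∈ h.filt 0 := by
  classical
  obtain ⟨w, hw0, hw⟩ := h.exists_eq_one
  have hp0 : (0 : ℤ) < p := by exact_mod_cast hp.out.pos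
  have bezout : ∀ S : Subfield L, F ≤ S → ∀ x ∈ S, x ≠ 0 → ¬ (p : ℤ) ∣ ord x →
      ∃ y ∈ S, y ≠ 0 ∧ ord y = 1 := by
    intro S hS x hx hx0 hpx
    have hcop : IsCoprime (p : ℤ) (ord x) :=
      (Prime.coprime_iff_not_dvd (Nat.prime_iff_prime_int.mp hp.out)).mpr hpx
    obtain ⟨a, b, hab⟩ := hcop
    refine ⟨(w ^ p) ^ a * x ^ b, S.mul_mem (zpow_mem (hS (hF w)) _) (zpow_mem hx _),
      mul_ne_zero (zpow_ne_zero _ (pow_ne_zero _ hw0)) (zpow_ne_zero _ hx0), ?_⟩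
    rw [h.map_mul (zpow_ne_zero _ (pow_ne_zero _ hw0)) (zpow_ne_zero _ hx0),
      h.map_zpow (pow_ne_zero _ hw0), h.map_zpow hx0, h.map_pow hw0, hw, mul_one, hab]
  have unramified : ∀ ϖ ∈ F, 0 < ord ϖ → ϖ ≠ 0 → (∀ z ∈ E, z ≠ 0 → ord ϖ ∣ ord z) →
      ∃ y ∈ E, y ∉ F ∧ y ∈ h.filt 0 ∧ ∀ P : F[X], P.natDegree < p → aeval y P ∈ h.filt 0 →
      ∀ j, (P.coeff j : L) ∈ h.filt 0 := by
    intro ϖ hϖF hϖ hϖ0 hdvd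
    by_cases hres : ∃ y ∈ E, y ∈ h.filt 0 ∧ ∀ a ∈ F, a ∈ h.filt 0 → y - a ∉ h.filt 1
    · obtain ⟨y, hyE, hy, hya⟩ := hres
      refine ⟨y, hyE, fun hyF => hya y hyF hy (by simp), hy, fun P hP hPy => ?_⟩
      by_contra! hcon
      obtain ⟨j, hj⟩ := hcon
      obtain ⟨i, hi, hmin⟩ := Finset.exists_min_image
        ((Finset.range p).filter fun i => (P.coeff i : L) ∉ h.filt 0)
        (fun i => ord (P.coeff i : L)) ⟨j, by
          simp only [Finset.mem_filter, Finset.mem_range, hj, not_false_eq_true, and_true]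
          by_contra! hc
          rw [coeff_eq_zero_of_natDegree_lt (by omega)] at hj
          exact hj (zero_mem _)⟩
      simp only [Finset.mem_filter, Finset.mem_range] at hi hmin
      have hi0 : (P.coeff i : L) ≠ 0 := fun h0 => hi.2 (h0 ▸ zero_mem _)
      have hineg : ord (P.coeff i : L) < 0 := by
        by_contra! hc; exact hi.2 fun _ => hc
      obtain ⟨m, hm⟩ := hdvd _ (hFE.le (P.coeff i).2) hi0
      set s : F := ⟨ϖ, hϖF⟩ ^ (-m) with hs
      have hsL : (s : L) = ϖ ^ (-m) := by rw [hs]; rfl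
      have hs0 : (s : L) ≠ 0 := by rw [hsL]; exact zpow_ne_zero _ hϖ0
      have hsord : ord (s : L) = - ord (P.coeff i : L) := by
        rw [hsL, h.map_zpow hϖ0, hm]; ring
      have key := h.coeff_mem_filt_one hF hy hya (P := C s * P) (by
        rwa [natDegree_C_mul (fun h0 => hs0 (by rw [h0]; rfl))]) (fun k => ?_) (by
          rw [_root_.map_mul, aeval_C]
          change (s : L) * _ ∈ _
          rw [h.mul_mem_iff hs0]
          exact h.filt_mono (by omega) hPy) i
      · rw [coeff_C_mul] at key
        change (s : L) * (P.coeff i : L) ∈ _ at key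
        have := (h.mem_filt_of_ne (mul_ne_zero hs0 hi0)).mp key
        rw [h.map_mul hs0 hi0] at this
        omega
      · rw [coeff_C_mul]
        change (s : L) * (P.coeff k : L) ∈ _
        rw [h.mul_mem_iff hs0, hsord]
        by_cases hk : (P.coeff k : L) ∈ h.filt 0
        · exact h.filt_mono (by omega) hk
        · have hkp : k < p := by
            by_contra! hc
            rw [coeff_eq_zero_of_natDegree_lt (by omega)] at hk
            exact hk (zero_mem _)
          exact fun _ => by have := hmin k ⟨hkp, hk⟩; omega
    · exfalso
      push Not at hres
      have hϖfilt : ϖ ∈ h.filt 0 := fun _ => hϖ.le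
      have hstep : ∀ y ∈ E, y ∈ h.filt 0 → ∃ a ∈ F, a ∈ h.filt 0 ∧ ∃ z ∈ E, z ∈ h.filt 0 ∧
          y = a + ϖ * z := by
        intro y hyE hy
        obtain ⟨a, haF, ha, hya⟩ := hres y hyE hy
        have hmem : ϖ⁻¹ * (y - a) ∈ E :=
          E.mul_mem (E.inv_mem (hFE.le hϖF)) (E.sub_mem hyE (hFE.le haF))
        refine ⟨a, haF, ha, ϖ⁻¹ * (y - a), hmem, ?_, by field_simp; ring⟩
        rw [h.mul_mem_iff (inv_ne_zero hϖ0), h.map_inv hϖ0]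
        intro h0
        have h1 := hya h0
        have h2 := Int.le_of_dvd (by omega) (hdvd _ (E.sub_mem hyE (hFE.le haF)) h0)
        omega
      have hiter : ∀ k : ℕ, ∀ y ∈ E, y ∈ h.filt 0 → ∃ a ∈ F, a ∈ h.filt 0 ∧ ∃ z ∈ E,
          z ∈ h.filt 0 ∧ y = a + ϖ ^ k * z := by
        intro k
        induction k with
        | zero => exact fun y hyE hy => ⟨0, F.zero_mem, zero_mem _, y, hyE, hy, by simp⟩
        | succ k ih =>
          intro y hyE hy
          obtain ⟨a, haF, ha, z, hzE, hz, rfl⟩ := ih y hyE hy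
          obtain ⟨b, hbF, hb, z', hz'E, hz', rfl⟩ := hstep z hzE hz
          exact ⟨a + ϖ ^ k * b, F.add_mem haF (F.mul_mem (_root_.pow_mem hϖF k) hbF),
            add_mem ha (h.mul_mem_zero (h.pow_mem hϖfilt k) hb), z', hz'E, hz', by ring⟩
      obtain ⟨c, hc⟩ := (hB ϖ).mpr hϖfilt
      have hcm : c ∈ IsLocalRing.maximalIdeal B := by
        rw [IsLocalRing.mem_maximalIdeal, mem_nonunits_iff]
        rintro ⟨u, rfl⟩
        have h1 : algebraMap B L (↑u⁻¹) ∈ h.filt 0 := (hB _).mp ⟨_, rfl⟩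
        have h2 : algebraMap B L (↑u⁻¹) = ϖ⁻¹ := by
          apply eq_inv_of_mul_eq_one_left
          rw [← hc, ← _root_.map_mul, Units.inv_mul, _root_.map_one]
        rw [h2] at h1
        have := h1 (inv_ne_zero hϖ0)
        rw [h.map_inv hϖ0] at this
        omega
      have hfrob : ∀ b : B, algebraMap B L (frobenius B p b) = algebraMap B L b ^ p := fun b => by
        rw [frobenius_def, _root_.map_pow]
      have hle := le_of_forall_exists_add_mul (frobenius B p) hfin
        (E.toSubring.comap (algebraMap B L)).toAddSubgroup
        (F.toSubring.comap (algebraMap B L)).toAddSubgroup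
        (fun b m hm => by
          change algebraMap B L (_ * m) ∈ E
          rw [_root_.map_mul, hfrob]
          exact E.mul_mem (hFE.le (hF _)) hm)
        (fun b m hm => by
          change algebraMap B L (_ * m) ∈ F
          rw [_root_.map_mul, hfrob]
          exact F.mul_mem (hF _) hm) hcm (fun m hm => by
          obtain ⟨a, haF, ha, z, hzE, hz, he⟩ := hiter p _ hm ((hB _).mp ⟨m, rfl⟩)
          obtain ⟨n, rfl⟩ := (hB _).mpr ha
          obtain ⟨m', rfl⟩ := (hB _).mpr hz
          refine ⟨n, haF, m', hzE, ?_⟩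
          apply hinj
          rw [he, _root_.map_add, _root_.map_mul, hfrob, hc])
      obtain ⟨t, htE, htF⟩ := SetLike.exists_of_lt hFE
      have ht0 : t ≠ 0 := fun h0 => htF (h0 ▸ F.zero_mem)
      have hmem : (w ^ p) ^ (ord t).natAbs * t ∈ h.filt 0 := by
        rw [h.mul_mem_iff (pow_ne_zero _ (pow_ne_zero _ hw0)), h.map_pow (pow_ne_zero _ hw0),
          h.map_pow hw0, hw]
        intro _
        have h1 : (1 : ℤ) ≤ p := by omega
        have h2 : -((ord t).natAbs : ℤ) ≤ ord t := by omega
        nlinarith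
      obtain ⟨b, hb⟩ := (hB _).mpr hmem
      have hbF : algebraMap B L b ∈ F := hle (show algebraMap B L b ∈ E by
        rw [hb]; exact E.mul_mem (_root_.pow_mem (hFE.le (hF w)) _) htE)
      rw [hb] at hbF
      apply htF
      have := F.mul_mem (F.inv_mem (_root_.pow_mem (hF w) (ord t).natAbs)) hbF
      rwa [inv_mul_cancel_left₀ (pow_ne_zero _ (pow_ne_zero _ hw0))] at this
  by_cases hdF : ∀ a ∈ F, a ≠ 0 → (p : ℤ) ∣ ord a
  · by_cases hdE : ∀ a ∈ E, a ≠ 0 → (p : ℤ) ∣ ord a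
    · have hwp : ord (w ^ p) = p := by rw [h.map_pow hw0, hw, mul_one]
      exact unramified (w ^ p) (hF w) (by omega) (pow_ne_zero _ hw0) (by rwa [hwp])
    · push Not at hdE
      obtain ⟨x, hxE, hx0, hx⟩ := hdE
      obtain ⟨y, hyE, hy0, hy⟩ := bezout E hFE.le x hxE hx0 hx
      refine ⟨y, hyE, fun hyF => ?_, fun _ => by omega, fun P hP hPy =>
        h.coeff_mem_of_ord_eq_one hdF hy0 hy hP hPy⟩
      have := hdF y hyF hy0
      rw [hy] at this
      exact hp.out.one_lt.ne' (by exact_mod_cast Int.eq_one_of_dvd_one hp0.le this)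
  · push Not at hdF
    obtain ⟨x, hxF, hx0, hx⟩ := hdF
    obtain ⟨y, hyF, hy0, hy⟩ := bezout F le_rfl x hxF hx0 hx
    exact unramified y hyF (by omega) hy0 fun z _ _ => by rw [hy]; exact one_dvd _

end Generator

section Step

open Polynomial

variable {L : Type*} [Field L] {p : ℕ} [hp : Fact p.Prime] {ord : L → ℤ}

/-- `E` is obtained from `F` by adjoining the `p`-th root `y`, and likewise for the rings of
integers. -/
structure IsStep (p : ℕ) {ord : L → ℤ} (h : IsOrd ord) (F E : Subfield L) (y : L) : Prop where
  le : F ≤ E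
  mem : y ∈ E
  notMem : y ∉ F
  integral : y ∈ h.filt 0
  pow_mem : y ^ p ∈ F
  exists_aeval : ∀ z ∈ E, ∃ P : F[X], P.natDegree < p ∧ aeval y P = z
  coeff_mem : ∀ P : F[X], P.natDegree < p → aeval y P ∈ h.filt 0 → ∀ j, (P.coeff j : L) ∈ h.filt 0

theorem IsTopCoeff.apply_pow_mul_aeval {F L : Type*} [Field F] [Field L] [Algebra F L] {y : L}
    {b : F} (hb : algebraMap F L b = y ^ p) {c : L →ₗ[F] F} (hc : IsTopCoeff p y c) {P : F[X]}
    (hP : P.natDegree < p) {k : ℕ} (hk : k < p) : c (y ^ k * aeval y P) = P.coeff (p - 1 - k) := by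
  rw [aeval_eq_sum_range' hP, Finset.mul_sum, map_sum,
    Finset.sum_eq_single_of_mem (p - 1 - k) (Finset.mem_range.mpr (by omega))]
  · rw [mul_smul_comm, ← pow_add, map_smul, hc.apply_pow hb,
      show k + (p - 1 - k) = p - 1 by omega, Nat.mod_eq_of_lt (by omega), if_pos rfl,
      Nat.div_eq_of_lt (by omega)]
    simp
  · intro j hj hjk
    rw [Finset.mem_range] at hj
    rw [mul_smul_comm, ← pow_add, map_smul, hc.apply_pow hb, if_neg, smul_zero]
    intro hmod
    have h1 := Nat.div_add_mod (k + j) p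
    rw [hmod] at h1
    rcases Nat.eq_zero_or_pos ((k + j) / p) with h2 | h2
    · rw [h2, mul_zero] at h1; omega
    · have : p * 1 ≤ p * ((k + j) / p) := Nat.mul_le_mul_left p h2
      omega

theorem IsOrd.aeval_mem (h : IsOrd ord) {F : Subfield L} {y : L} (hy : y ∈ h.filt 0) {P : F[X]}
    (hP : ∀ j, (P.coeff j : L) ∈ h.filt 0) : aeval y P ∈ h.filt 0 := by
  rw [aeval_eq_sum_range]
  exact sum_mem fun j _ => h.mul_mem_zero (hP j) (h.pow_mem hy j)

theorem IsOrd.natCast_mem (h : IsOrd ord) (n : ℕ) : (n : L) ∈ h.filt 0 := by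
  simpa using nsmul_mem h.one_mem n

theorem IsOrd.aeval_derivative_mem (h : IsOrd ord) {F : Subfield L} {y : L} (hy : y ∈ h.filt 0)
    {P : F[X]} (hP : ∀ j, (P.coeff j : L) ∈ h.filt 0) : aeval y (derivative P) ∈ h.filt 0 := by
  refine h.aeval_mem hy fun j => ?_
  rw [coeff_derivative]
  have := h.mul_mem_zero (hP (j + 1)) (h.natCast_mem (j + 1))
  exact_mod_cast this

namespace IsStep

variable {h : IsOrd ord} {F E : Subfield L} {y : L}

omit hp in
theorem notMem_range (hs : IsStep p h F E y) : y ∉ (algebraMap F L).range := by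
  rw [Subfield.mem_range_algebraMap]; exact hs.notMem

omit hp in
theorem aeval_mem (hs : IsStep p h F E y) (P : F[X]) : aeval y P ∈ E := by
  rw [aeval_eq_sum_range]
  exact sum_mem fun j _ => E.mul_mem (hs.le (P.coeff j).2) (_root_.pow_mem hs.mem j)

theorem mem_filt_iff (hs : IsStep p h F E y) {c : L →ₗ[F] F} (hc : IsTopCoeff p y c) {z : L}
    (hz : z ∈ E) : (∀ k < p, (c (y ^ k * z) : L) ∈ h.filt 0) ↔ z ∈ h.filt 0 := by
  obtain ⟨P, hP, rfl⟩ := hs.exists_aeval z hz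
  constructor
  · intro H
    refine h.aeval_mem hs.integral fun j => ?_
    rcases lt_or_ge j p with hj | hj
    · have := H (p - 1 - j) (by omega)
      rw [hc.apply_pow_mul_aeval (b := ⟨_, hs.pow_mem⟩) rfl hP (by omega),
        show p - 1 - (p - 1 - j) = j by omega] at this
      exact this
    · rw [coeff_eq_zero_of_natDegree_lt (by omega)]; exact zero_mem _
  · intro H k hk
    rw [hc.apply_pow_mul_aeval (b := ⟨_, hs.pow_mem⟩) rfl hP hk]
    exact hs.coeff_mem P hP H _

variable [CharP L p]

theorem exists_isTopCoeff (hs : IsStep p h F E y) : ∃ c : L →ₗ[F] F, IsTopCoeff p y c :=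
  _root_.exists_isTopCoeff hs.notMem_range (b := ⟨_, hs.pow_mem⟩) rfl

theorem exists_of_lt {B : Type*} [CommRing B] [IsLocalRing B]
    [IsNoetherianRing B] [CharP B p] [Algebra B L] (hinj : Function.Injective (algebraMap B L))
    (h : IsOrd ord) (hB : ∀ f : L, f ∈ (algebraMap B L).range ↔ f ∈ h.filt 0)
    (hfin : (frobenius B p).Finite) {F : Subfield L} (hF : ∀ z : L, z ^ p ∈ F)
    {t : L} (ht : t ∉ F) :
    ∃ y, IsStep p h F (IntermediateField.adjoin F {t}).toSubfield y := by
  have hle : F ≤ (IntermediateField.adjoin F {t}).toSubfield := fun a ha =>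
    (IntermediateField.adjoin F {t}).algebraMap_mem ⟨a, ha⟩
  have htE : t ∈ (IntermediateField.adjoin F {t}).toSubfield :=
    IntermediateField.mem_adjoin_simple_self F t
  obtain ⟨y, hyE, hyF, hy, hcoeff⟩ := h.exists_integral_generator hinj hB hfin hF
    (lt_of_le_of_ne hle fun he => ht (he ▸ htE))
  have hyr : y ∉ (algebraMap F L).range := by rwa [Subfield.mem_range_algebraMap]
  have htr : t ∉ (algebraMap F L).range := by rwa [Subfield.mem_range_algebraMap]
  refine ⟨y, hle, hyE, hyF, hy, hF y, fun z hz => ?_, hcoeff⟩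
  have := adjoin_eq_of_mem hyr (b := ⟨_, hF y⟩) rfl htr (b' := ⟨_, hF t⟩) rfl hyE
  exact exists_aeval_eq hyr (b := ⟨_, hF y⟩) rfl (this.symm ▸ hz)

end IsStep

/-- `d` restricts to a derivation on `F`. -/
structure IsDerivOn (F : Subfield L) (d : L → L) : Prop where
  add : ∀ a ∈ F, ∀ b ∈ F, d (a + b) = d a + d b
  mul : ∀ a ∈ F, ∀ b ∈ F, d (a * b) = a * d b + b * d a

namespace IsDerivOn

variable {F E : Subfield L} {d : L → L}

theorem map_sum (hd : IsDerivOn F d) {ι : Type*} (s : Finset ι) (f : ι → L) (hf : ∀ i, f i ∈ F) :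
    d (∑ i ∈ s, f i) = ∑ i ∈ s, d (f i) := by
  classical
  have h0 : d 0 = 0 := by simpa using hd.add 0 F.zero_mem 0 F.zero_mem
  induction s using Finset.induction_on with
  | empty => simpa
  | insert a s ha ih =>
    rw [Finset.sum_insert ha, Finset.sum_insert ha, hd.add _ (hf a) _ (sum_mem fun i _ => hf i), ih]

theorem map_pow (hd : IsDerivOn F d) {a : L} (ha : a ∈ F) (n : ℕ) :
    d (a ^ n) = n * a ^ (n - 1) * d a := by
  have h1 : d 1 = 0 := by simpa using hd.mul 1 F.one_mem 1 F.one_mem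
  induction n with
  | zero => simpa
  | succ n ih =>
    rw [pow_succ, hd.mul _ (pow_mem ha n) _ ha, ih]
    rcases n with _ | n
    · simp
    · simp only [Nat.add_sub_cancel]; push_cast; ring

theorem map_aeval (hd : IsDerivOn E d) (hFE : F ≤ E) {y : L} (hy : y ∈ E) (P : F[X]) :
    d (aeval y P) = ∑ j ∈ Finset.range (P.natDegree + 1), d (P.coeff j) * y ^ j +
      aeval y (derivative P) * d y := by
  have h1 : aeval y (derivative P) = ∑ j ∈ Finset.range (P.natDegree + 1),
      (P.coeff j : L) * (j * y ^ (j - 1)) := by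
    conv_lhs => rw [P.as_sum_range_C_mul_X_pow]
    simp only [derivative_C_mul_X_pow, _root_.map_sum, map_mul, aeval_C,
      _root_.map_pow, aeval_X, map_natCast, mul_assoc]
    rfl
  have h2 : aeval y P = ∑ j ∈ Finset.range (P.natDegree + 1), (P.coeff j : L) * y ^ j :=
    aeval_eq_sum_range y
  rw [h1, h2, hd.map_sum _ _ fun i => E.mul_mem (hFE (P.coeff i).2) (pow_mem hy i),
    Finset.sum_mul, ← Finset.sum_add_distrib]
  refine Finset.sum_congr rfl fun j _ => ?_
  rw [hd.mul _ (hFE (P.coeff j).2) _ (pow_mem hy j), hd.map_pow hy]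
  ring

theorem exists_extend [CharP L p] (hd : IsDerivOn F d) {x : L} (hx : x ∉ F) (hxp : x ^ p ∈ F)
    (hdx : d (x ^ p) = 0) (w : L) :
    ∃ d', IsDerivOn (IntermediateField.adjoin F {x}).toSubfield d' ∧ (∀ a ∈ F, d' a = d a) ∧
      d' x = w := by
  have hxr : x ∉ (algebraMap F L).range := by rwa [Subfield.mem_range_algebraMap]
  let D : Derivation ℤ F L := Derivation.mk'
    (AddMonoidHom.toIntLinearMap
      { toFun := fun a => d a
        map_zero' := by simpa using hd.add 0 F.zero_mem 0 F.zero_mem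
        map_add' := fun a b => hd.add a a.2 b b.2 })
    (fun a b => hd.mul a a.2 b b.2)
  obtain ⟨D', hD', hw⟩ := exists_derivation_extend hxr (b := ⟨_, hxp⟩) rfl D hdx w
  classical
  let d' : L → L := fun z => if hz : z ∈ IntermediateField.adjoin F {x} then D' ⟨z, hz⟩ else 0
  have hd' : ∀ z (hz : z ∈ IntermediateField.adjoin F {x}), d' z = D' ⟨z, hz⟩ :=
    fun z hz => dif_pos hz
  refine ⟨d', ⟨fun a ha b hb => ?_, fun a ha b hb => ?_⟩, fun a ha => ?_, ?_⟩
  · rw [hd' _ ha, hd' _ hb, hd' _ (add_mem ha hb), ← map_add]; rfl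
  · rw [hd' _ ha, hd' _ hb, hd' _ (mul_mem ha hb)]
    exact D'.leibniz ⟨a, ha⟩ ⟨b, hb⟩
  · rw [hd' a ((IntermediateField.adjoin F {x}).algebraMap_mem ⟨a, ha⟩)]
    exact hD' ⟨a, ha⟩
  · rw [hd' x (IntermediateField.mem_adjoin_simple_self F x)]
    exact hw

end IsDerivOn

end Step

/-! ### The ramification formula for discrete valuation rings -/

/-- `B` is an `F`-finite discrete valuation ring with fraction field `L` and valuation `ord`. -/
structure IsFFiniteDVR (p : ℕ) (B : Type*) {L : Type*} [CommRing B] [Field L] [Algebra B L]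
    [ExpChar B p] (ord : L → ℤ) : Prop where
  isOrd : IsOrd ord
  injective : Function.Injective (algebraMap B L)
  mem_range_iff : ∀ f : L, f ∈ (algebraMap B L).range ↔ f ∈ isOrd.filt 0
  finite_frobenius : (frobenius B p).Finite
  length_eq : ∀ b : B, b ≠ 0 →
    Module.length B (B ⧸ Ideal.span {b}) = ((ord (algebraMap B L b)).toNat : ℕ∞)

section Chain

open Polynomial

variable {p : ℕ} [hp : Fact p.Prime] {A B K L : Type*} [CommRing A] [CommRing B] [Field K] [Field L]
  [Algebra A B] [Algebra A K] [Algebra B L] [Algebra K L] [Algebra A L] [IsScalarTower A B L]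
  [IsScalarTower A K L] [CharP A p] [CharP B p] [CharP K p] [CharP L p]
  {ordK : K → ℤ} {ordL : L → ℤ}

variable (A B) in
/-- The submodule of differentials generated by `dO_F` and `dA`. -/
noncomputable def diffSpan (F : Subfield L) : Submodule B (Ω[B⁄ℤ]) :=
  Submodule.span B ({ω | ∃ o : B, algebraMap B L o ∈ F ∧ ω = KaehlerDifferential.D ℤ B o} ∪
    {ω | ∃ a : A, ω = KaehlerDifferential.D ℤ B (algebraMap A B a)})

/-- The inductive statement along a tower of purely inseparable extensions `F ⊆ L`, `G ⊆ K`: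
`Φ` and `Ψ` generate the functionals on the integers of `K` and `L`, and they differ by the
Jacobian factor `J`. -/
def ChainData (p : ℕ) (A B : Type*) {K L : Type*} [CommRing A] [CommRing B] [Field K] [Field L]
    [Algebra A B] [Algebra B L] [Algebra K L] [Algebra A L]
    {ordK : K → ℤ} {ordL : L → ℤ} (hK : IsOrd ordK) (hL : IsOrd ordL)
    (F : Subfield L) (G : Subfield K) : Prop :=
  ∃ (Φ Ψ : L →ₗ[F] F) (J : L), J ≠ 0 ∧ J ∈ hL.filt 0 ∧
    (∀ k : K, ∃ g ∈ G, (Φ (algebraMap K L k) : L) = algebraMap K L g) ∧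
    (∀ f : K, (∀ a ∈ hK.filt 0, (Φ (algebraMap K L (f * a)) : L) ∈ hL.filt 0) ↔ f ∈ hK.filt 0) ∧
    (∀ f : L, (∀ b ∈ hL.filt 0, (Ψ (f * b) : L) ∈ hL.filt 0) ↔ f ∈ hL.filt 0) ∧
    (∀ f : L, (Ψ (J * f) : L) = J ^ p * Φ f) ∧
    Module.length B (Ω[B⁄ℤ] ⧸ diffSpan A B F) = ((ordL J).toNat : ℕ∞) ∧
    ∀ d, IsDerivOn F d → (∀ z : L, d (z ^ p) = 0) →
      (∀ g ∈ G, g ∈ hK.filt 0 → d (algebraMap K L g) ∈ hL.filt 0) →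
      ∃ d', IsDerivOn ⊤ d' ∧ (∀ a ∈ F, d' a = d a) ∧
        ∀ a : A, d' (algebraMap A L a) ∈ hL.filt 0

theorem chainData_top (hKA : IsFFiniteDVR p A ordK) (hLB : IsFFiniteDVR p B ordL)
    (hKL : ∀ k : K, algebraMap K L k ∈ hLB.isOrd.filt 0 ↔ k ∈ hKA.isOrd.filt 0) :
    ChainData p A B hKA.isOrd hLB.isOrd (⊤ : Subfield L) (⊤ : Subfield K) := by
  let Θ : L →ₗ[(⊤ : Subfield L)] (⊤ : Subfield L) :=
    { toFun := fun x => ⟨x, trivial⟩, map_add' := fun _ _ => rfl, map_smul' := fun _ _ => rfl }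
  have hΘ : ∀ x, (Θ x : L) = x := fun _ => rfl
  refine ⟨Θ, Θ, 1, one_ne_zero, hLB.isOrd.one_mem, fun k => ⟨k, trivial, rfl⟩, fun f => ?_,
    fun f => ?_, fun f => by rw [one_mul, one_pow, one_mul], ?_, fun d hd _ hdG =>
      ⟨d, hd, fun _ _ => rfl, fun a => ?_⟩⟩
  · simp only [hΘ, hKL]
    exact ⟨fun H => by simpa using H 1 hKA.isOrd.one_mem,
      fun hf a ha => hKA.isOrd.mul_mem_zero hf ha⟩
  · simp only [hΘ]
    exact ⟨fun H => by simpa using H 1 hLB.isOrd.one_mem,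
      fun hf a ha => hLB.isOrd.mul_mem_zero hf ha⟩
  · have : diffSpan A B (⊤ : Subfield L) = ⊤ := by
      rw [eq_top_iff, ← KaehlerDifferential.span_range_derivation ℤ B]
      apply Submodule.span_mono
      rintro _ ⟨o, rfl⟩
      exact Or.inl ⟨o, trivial, rfl⟩
    rw [hLB.isOrd.map_one, this]
    have : Subsingleton (Ω[B⁄ℤ] ⧸ (⊤ : Submodule B (Ω[B⁄ℤ]))) :=
      Submodule.Quotient.subsingleton_iff.mpr rfl
    simp [Module.length_eq_zero]
  · rw [IsScalarTower.algebraMap_apply A K L]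
    exact hdG _ trivial ((hKA.mem_range_iff _).mp ⟨a, rfl⟩)

theorem length_quotient_eq_add {R W : Type*} [CommRing R] [AddCommGroup W] [Module R W]
    {N N' : Submodule R W} (hN : N ≤ N') (w : W) (hw : w ∈ N') (hN' : N' ≤ N ⊔ Submodule.span R {w})
    (j : R) (hj : ∀ r : R, r • w ∈ N ↔ j ∣ r) :
    Module.length R (W ⧸ N) = Module.length R (R ⧸ Ideal.span {j}) + Module.length R (W ⧸ N') := by
  let f0 : R →ₗ[R] W ⧸ N := LinearMap.toSpanSingleton R _ (N.mkQ w)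
  have hf0 : ∀ r, f0 r = N.mkQ (r • w) := fun r => by simp [f0]
  have hker : f0.ker = Ideal.span {j} := by
    ext r
    rw [LinearMap.mem_ker, hf0, Submodule.mkQ_apply, Submodule.Quotient.mk_eq_zero, hj,
      Ideal.mem_span_singleton]
  let f : (R ⧸ Ideal.span {j}) →ₗ[R] W ⧸ N := Submodule.liftQ _ f0 hker.ge
  have hf : ∀ r : R, f (Submodule.Quotient.mk r) = N.mkQ (r • w) := fun r =>
    (Submodule.liftQ_apply _ _ _).trans (hf0 r)
  refine Module.length_eq_add_of_exact f (Submodule.factor hN) ?_ (Submodule.factor_surjective hN) ?_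
  · rw [← LinearMap.ker_eq_bot]
    exact Submodule.ker_liftQ_eq_bot _ _ _ hker.le
  · intro x
    obtain ⟨x, rfl⟩ := N.mkQ_surjective x
    have hfac : Submodule.factor hN (N.mkQ x) = 0 ↔ x ∈ N' := Submodule.Quotient.mk_eq_zero N'
    rw [hfac]
    constructor
    · intro hx
      obtain ⟨n, hn, _, hm, rfl⟩ := Submodule.mem_sup.mp (hN' hx)
      obtain ⟨r, rfl⟩ := Submodule.mem_span_singleton.mp hm
      refine ⟨Submodule.Quotient.mk r, ?_⟩
      rw [hf, Submodule.mkQ_apply]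
      exact ((Submodule.Quotient.eq _).mpr (by simpa using hn)).symm
    · rintro ⟨r, hr⟩
      obtain ⟨r, rfl⟩ := Submodule.Quotient.mk_surjective _ r
      rw [hf] at hr
      replace hr := (Submodule.Quotient.eq N).mp hr
      have := N'.sub_mem (N'.smul_mem r hw) (hN hr)
      simpa using this

/-- The differential of a polynomial expression in `y` with coefficients in `O_F`. -/
theorem D_sub_smul_mem_diffSpan (hLB : IsFFiniteDVR p B ordL) {F : Subfield L} {y o j : B}
    {P : F[X]} (hP : ∀ i, (P.coeff i : L) ∈ hLB.isOrd.filt 0)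
    (ho : algebraMap B L o = aeval (algebraMap B L y) P)
    (hj : algebraMap B L j = aeval (algebraMap B L y) (derivative P)) :
    KaehlerDifferential.D ℤ B o - j • KaehlerDifferential.D ℤ B y ∈ diffSpan A B F := by
  choose a ha using fun i => (hLB.mem_range_iff _).mpr (hP i)
  have ho' : o = ∑ i ∈ Finset.range (P.natDegree + 1), a i * y ^ i := by
    apply hLB.injective
    rw [ho, aeval_eq_sum_range, map_sum]
    refine Finset.sum_congr rfl fun i _ => ?_
    rw [map_mul, map_pow, ha]; rfl
  have hj' : j = ∑ i ∈ Finset.range (P.natDegree + 1), a i * (i * y ^ (i - 1)) := by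
    apply hLB.injective
    rw [hj, map_sum]
    conv_lhs => rw [P.as_sum_range_C_mul_X_pow]
    simp only [derivative_C_mul_X_pow, map_sum, map_mul, aeval_C,
      map_pow, aeval_X, map_natCast, mul_assoc, ha]
    rfl
  rw [ho', hj', map_sum, Finset.sum_smul, ← Finset.sum_sub_distrib]
  refine sum_mem fun i _ => ?_
  rw [Derivation.leibniz, Derivation.leibniz_pow, mul_smul, mul_smul, Nat.cast_smul_eq_nsmul,
    add_sub_cancel_left]
  exact Submodule.smul_mem _ _ (Submodule.subset_span (Or.inl ⟨a i, by rw [ha]; exact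
    (P.coeff i).2, rfl⟩))

theorem chainData_step [IsLocalRing A] [IsNoetherianRing A] [IsLocalRing B] [IsNoetherianRing B]
    (hKA : IsFFiniteDVR p A ordK) (hLB : IsFFiniteDVR p B ordL)
    (hKL : ∀ k : K, algebraMap K L k ∈ hLB.isOrd.filt 0 ↔ k ∈ hKA.isOrd.filt 0)
    {F : Subfield L} {G : Subfield K} (hF : ∀ z : L, z ^ p ∈ F) (hG : ∀ z : K, z ^ p ∈ G)
    (hGF : ∀ g ∈ G, algebraMap K L g ∈ F) {t : K} (ht : algebraMap K L t ∉ F)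
    (ih : ChainData p A B hKA.isOrd hLB.isOrd
      (IntermediateField.adjoin F {algebraMap K L t}).toSubfield
      (IntermediateField.adjoin G {t}).toSubfield) :
    ChainData p A B hKA.isOrd hLB.isOrd F G := by
  have htG : t ∉ G := fun h => ht (hGF t h)
  obtain ⟨y, hy⟩ := IsStep.exists_of_lt hLB.injective hLB.isOrd hLB.mem_range_iff
    hLB.finite_frobenius hF ht
  obtain ⟨x, hx⟩ := IsStep.exists_of_lt hKA.injective hKA.isOrd hKA.mem_range_iff
    hKA.finite_frobenius hG htG
  set E := (IntermediateField.adjoin F {algebraMap K L t}).toSubfield with hE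
  set G' := (IntermediateField.adjoin G {t}).toSubfield with hG'
  have hle := hy.le
  let ι : G →+* F := ((algebraMap K L).comp G.subtype).codRestrict F fun g => hGF g g.2
  have hι : ∀ g, (ι g : L) = algebraMap K L g := fun _ => rfl
  have haev : ∀ (z : K) (Q : G[X]), aeval (algebraMap K L z) (Q.map ι) =
      algebraMap K L (aeval z Q) := by
    intro z Q
    rw [aeval_def, eval₂_map, aeval_def, hom_eval₂]
    rfl
  have haevF : ∀ z ∈ F, ∀ P : F[X], aeval z P ∈ F := fun z hz P => by
    rw [aeval_eq_sum_range]
    exact sum_mem fun j _ => F.mul_mem (P.coeff j).2 (pow_mem hz j)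
  have htG' : t ∈ G' := IntermediateField.mem_adjoin_simple_self G t
  set xL := algebraMap K L x with hxL
  have hxF : xL ∉ F := by
    intro hc
    obtain ⟨Q, -, hQ⟩ := hx.exists_aeval t htG'
    apply ht
    rw [← hQ, ← haev]
    exact haevF _ hc _
  have htE : algebraMap K L t ∈ E := IntermediateField.mem_adjoin_simple_self F _
  have hG'E : ∀ g ∈ G', algebraMap K L g ∈ E := by
    intro g hg
    have htr : t ∉ (algebraMap G K).range := by rwa [Subfield.mem_range_algebraMap]
    obtain ⟨Q, -, hQ⟩ := exists_aeval_eq htr (b := ⟨_, hG t⟩) rfl hg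
    rw [← hQ, ← haev, aeval_eq_sum_range]
    exact sum_mem fun j _ => E.mul_mem (hle (SetLike.coe_mem _)) (pow_mem htE j)
  have hxE : xL ∈ E := hG'E x hx.mem
  have hxint : xL ∈ hLB.isOrd.filt 0 := (hKL x).mpr hx.integral
  have htr : algebraMap K L t ∉ (algebraMap F L).range := by rwa [Subfield.mem_range_algebraMap]
  have hxr : xL ∉ (algebraMap F L).range := by rwa [Subfield.mem_range_algebraMap]
  have hadj : IntermediateField.adjoin F {xL} = IntermediateField.adjoin F {algebraMap K L t} :=
    adjoin_eq_of_mem hxr (b := ⟨_, hF xL⟩) rfl htr (b' := ⟨_, hF _⟩) rfl hxE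
  have hxaev : ∀ z ∈ E, ∃ Q : F[X], Q.natDegree < p ∧ aeval xL Q = z := fun z hz =>
    exists_aeval_eq hxr (b := ⟨_, hF xL⟩) rfl (hadj ▸ hz)
  obtain ⟨c, hc⟩ := hy.exists_isTopCoeff
  obtain ⟨d, hd⟩ := exists_isTopCoeff hxr (b := ⟨_, hF xL⟩) rfl
  obtain ⟨P, hPdeg, hPx⟩ := hy.exists_aeval xL hxE
  have hPcoeff := hy.coeff_mem P hPdeg (by rwa [hPx])
  set J₀ := aeval y (derivative P) with hJ₀
  have hJ₀int : J₀ ∈ hLB.isOrd.filt 0 := hLB.isOrd.aeval_derivative_mem hy.integral hPcoeff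
  have hJ₀E : J₀ ∈ E := hy.aeval_mem _
  have hJ₀0 : J₀ ≠ 0 := by
    intro h0
    have hder : derivative P = 0 := by
      refine eq_zero_of_aeval_eq_zero hy.notMem_range (b := ⟨_, hy.pow_mem⟩) rfl ?_ h0
      exact (natDegree_derivative_le P).trans_lt (by omega)
    have hP0 : P.natDegree = 0 := by
      by_contra hne
      have h1 := congrArg (fun T => T.coeff (P.natDegree - 1)) hder
      simp only [coeff_derivative, coeff_zero, Nat.sub_add_cancel (Nat.pos_of_ne_zero hne)] at h1
      rcases mul_eq_zero.mp h1 with h2 | h2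
      · exact hne (by rw [leadingCoeff_eq_zero.mp h2, natDegree_zero])
      · have h3 : ((P.natDegree : ℕ) : F) = 0 := by
          have : ((P.natDegree - 1 : ℕ) : F) + 1 = (P.natDegree : F) := by
            exact_mod_cast congrArg (Nat.cast : ℕ → F) (Nat.sub_add_cancel (Nat.pos_of_ne_zero hne))
          rwa [this] at h2
        rw [CharP.cast_eq_zero_iff F p] at h3
        exact absurd (Nat.le_of_dvd (Nat.pos_of_ne_zero hne) h3) (by omega)
    rw [natDegree_eq_zero] at hP0
    obtain ⟨a, rfl⟩ := hP0
    apply hxF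
    rw [← hPx, aeval_C]
    exact a.2
  obtain ⟨Φ, Ψ, J, hJ0, hJint, hΦK, hΦ, hΨ, hJ, hlen, hder⟩ := ih
  have comp : ∀ (f : L →ₗ[F] F) (g : L →ₗ[E] E), ∃ k : L →ₗ[F] F, ∀ z, k z = f (g z : L) := by
    intro f g
    refine ⟨{ toFun := fun z => f (g z : L), map_add' := by simp, map_smul' := fun a z => ?_ }, 
      fun _ => rfl⟩
    have : a • z = (⟨a, hle a.2⟩ : E) • z := rfl
    rw [this, map_smul]
    exact map_smul f a (g z : L)
  obtain ⟨Φ', hΦ'⟩ := comp d Φ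
  obtain ⟨Ψ', hΨ'⟩ := comp c Ψ
  have hsmul : ∀ (g : L →ₗ[E] E) (e z : L), e ∈ E → (g (e * z) : L) = e * g z := fun g e z he => by
    have : e * z = (⟨e, he⟩ : E) • z := rfl
    rw [this, map_smul]; rfl
  have hdG : ∀ g ∈ G', ∀ k < p, ∃ b ∈ G, (d (xL ^ k * algebraMap K L g) : L) = algebraMap K L b ∧
      (g ∈ hKA.isOrd.filt 0 → b ∈ hKA.isOrd.filt 0) := by
    intro g hg k hk
    obtain ⟨Q, hQdeg, hQ⟩ := hx.exists_aeval g hg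
    refine ⟨Q.coeff (p - 1 - k), (Q.coeff _).2, ?_, fun hgint => ?_⟩
    · rw [← hQ, ← haev, hd.apply_pow_mul_aeval (b := ⟨_, hF xL⟩) rfl
        (natDegree_map_le.trans_lt hQdeg) hk, coeff_map, hι]
    · exact hx.coeff_mem Q hQdeg (by rwa [hQ]) _
  have hdG' : ∀ g ∈ G', (∀ k < p, (d (xL ^ k * algebraMap K L g) : L) ∈ hLB.isOrd.filt 0) →
      g ∈ hKA.isOrd.filt 0 := by
    intro g hg H
    obtain ⟨Q, hQdeg, rfl⟩ := hx.exists_aeval g hg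
    refine hKA.isOrd.aeval_mem hx.integral fun j => ?_
    rcases lt_or_ge j p with hj | hj
    · have := H (p - 1 - j) (by omega)
      rw [← haev, hd.apply_pow_mul_aeval (b := ⟨_, hF xL⟩) rfl
        (natDegree_map_le.trans_lt hQdeg) (by omega), coeff_map,
        show p - 1 - (p - 1 - j) = j by omega, hι, hKL] at this
      exact this
    · rw [coeff_eq_zero_of_natDegree_lt (by omega)]; exact zero_mem _
  have hp0 := hp.out.pos
  have hext : ∀ δ, IsDerivOn F δ → (∀ z : L, δ (z ^ p) = 0) →
      (∀ g ∈ G, g ∈ hKA.isOrd.filt 0 → δ (algebraMap K L g) ∈ hLB.isOrd.filt 0) →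
      ∀ w ∈ hLB.isOrd.filt 0, ∃ δ', IsDerivOn ⊤ δ' ∧ (∀ a ∈ F, δ' a = δ a) ∧ δ' xL = w ∧
        ∀ a : A, δ' (algebraMap A L a) ∈ hLB.isOrd.filt 0 := by
    intro δ hδ hδp hδG w hw
    obtain ⟨δ₁, hδ₁, hδ₁F, hδ₁x⟩ := hδ.exists_extend hxF (hF xL) (hδp xL) w
    rw [hadj] at hδ₁
    have hint : ∀ g ∈ G', g ∈ hKA.isOrd.filt 0 → δ₁ (algebraMap K L g) ∈ hLB.isOrd.filt 0 := by
      intro g hg hgint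
      obtain ⟨Q, hQdeg, rfl⟩ := hx.exists_aeval g hg
      have hQcoeff := hx.coeff_mem Q hQdeg hgint
      have hQ' : ∀ j, ((Q.map ι).coeff j : L) ∈ hLB.isOrd.filt 0 := fun j => by
        rw [coeff_map, hι, hKL]; exact hQcoeff j
      rw [← haev, hδ₁.map_aeval hle hxE, hδ₁x]
      refine add_mem (sum_mem fun j _ => ?_)
        (hLB.isOrd.mul_mem_zero (hLB.isOrd.aeval_derivative_mem hxint hQ') hw)
      refine hLB.isOrd.mul_mem_zero ?_ (hLB.isOrd.pow_mem hxint j)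
      rw [hδ₁F _ (SetLike.coe_mem _), coeff_map, hι]
      exact hδG _ (Q.coeff j).2 (hQcoeff j)
    obtain ⟨δ', hδ', hδ'E, hδ'A⟩ := hder δ₁ hδ₁ (fun z => by rw [hδ₁F _ (hF z), hδp]) hint
    refine ⟨δ', hδ', fun a ha => by rw [hδ'E a (hle ha), hδ₁F a ha], ?_, hδ'A⟩
    rw [hδ'E _ hxE, hδ₁x]
  refine ⟨Φ', Ψ', J₀ * J, mul_ne_zero hJ₀0 hJ0, hLB.isOrd.mul_mem_zero hJ₀int hJint, ?_, ?_, ?_, ?_,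
    ?_, ?_⟩
  · intro k
    obtain ⟨g, hg, hgk⟩ := hΦK k
    obtain ⟨b, hb, hbg, -⟩ := hdG g hg 0 hp0
    exact ⟨b, hb, by rw [hΦ', hgk, ← hbg, pow_zero, one_mul]⟩
  · intro f
    rw [← hΦ f]
    constructor
    · intro H a ha
      obtain ⟨g, hg, hga⟩ := hΦK (f * a)
      rw [hga, hKL]
      refine hdG' g hg fun k hk => ?_
      have := H (x ^ k * a) (hKA.isOrd.mul_mem_zero (hKA.isOrd.pow_mem hx.integral k) ha)
      rw [hΦ', mul_left_comm, map_mul, map_pow, hsmul _ _ _ (pow_mem hxE k), hga] at this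
      exact this
    · intro H a ha
      obtain ⟨g, hg, hga⟩ := hΦK (f * a)
      have h1 := H a ha
      rw [hga, hKL] at h1
      obtain ⟨b, hb, hbg, hbint⟩ := hdG g hg 0 hp0
      rw [pow_zero, one_mul] at hbg
      rw [hΦ', hga, hbg, hKL]
      exact hbint h1
  · intro f
    rw [← hΨ f]
    constructor
    · intro H b hb
      rw [← hy.mem_filt_iff hc (SetLike.coe_mem _)]
      intro k hk
      have := H (y ^ k * b) (hLB.isOrd.mul_mem_zero (hLB.isOrd.pow_mem hy.integral k) hb)
      rwa [hΨ', mul_left_comm, hsmul _ _ _ (pow_mem hy.mem k)] at this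
    · intro H b hb
      have := (hy.mem_filt_iff hc (SetLike.coe_mem (Ψ (f * b)))).mpr (H b hb) 0 hp0
      rwa [pow_zero, one_mul, ← hΨ'] at this
  · intro f
    obtain ⟨Q, -, hQ⟩ := hxaev _ (SetLike.coe_mem (Φ f))
    have h1 := hc.deriv_mul (b := ⟨_, hy.pow_mem⟩) rfl P (d := d) (by rw [hPx]; exact hd) Q
    rw [hPx, hQ] at h1
    have h2 : J₀ * (J ^ p * (Φ f : L)) = (⟨_, hF J⟩ : F) • (J₀ * (Φ f : L)) := by
      rw [Algebra.smul_def]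
      change _ = J ^ p * _
      ring
    rw [hΨ', mul_assoc, hsmul _ _ _ hJ₀E, hJ, h2, map_smul]
    change J ^ p * (c _ : L) = _
    have h3 : (c (J₀ * (Φ f : L)) : L) = J₀ ^ p * (d (Φ f : L) : L) := h1
    rw [h3, hΦ']
    ring
  · obtain ⟨yB, hyB⟩ := (hLB.mem_range_iff y).mpr hy.integral
    obtain ⟨jB, hjB⟩ := (hLB.mem_range_iff J₀).mpr hJ₀int
    obtain ⟨xA, hxA⟩ := (hKA.mem_range_iff x).mpr hx.integral
    have hxB : algebraMap B L (algebraMap A B xA) = xL := by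
      rw [← IsScalarTower.algebraMap_apply, IsScalarTower.algebraMap_apply A K L, hxA]
    have hjB0 : jB ≠ 0 := by
      rintro rfl; rw [map_zero] at hjB; exact hJ₀0 hjB.symm
    have key := length_quotient_eq_add (N := diffSpan A B F) (N' := diffSpan A B E)
      (Submodule.span_mono (Set.union_subset_union_left _ fun ω ⟨o, ho, hω⟩ => ⟨o, hle ho, hω⟩))
      (KaehlerDifferential.D ℤ B yB)
      (Submodule.subset_span (Or.inl ⟨yB, by rw [hyB]; exact hy.mem, rfl⟩)) ?_ jB ?_
    · rw [key, hLB.length_eq jB hjB0, hlen, hjB, hLB.isOrd.map_mul hJ₀0 hJ0,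
        Int.toNat_add (hJ₀int hJ₀0) (hJint hJ0), Nat.cast_add]
    · refine Submodule.span_le.mpr ?_
      rintro _ (⟨o, ho, rfl⟩ | ⟨a, rfl⟩)
      · obtain ⟨Q, hQdeg, hQ⟩ := hy.exists_aeval _ ho
        have hQc := hy.coeff_mem Q hQdeg (by
          rw [hQ]; exact (hLB.mem_range_iff _).mp ⟨o, rfl⟩)
        obtain ⟨j, hj⟩ := (hLB.mem_range_iff _).mpr
          (hLB.isOrd.aeval_derivative_mem hy.integral hQc)
        have := D_sub_smul_mem_diffSpan (A := A) hLB (y := yB) (o := o) (j := j) hQc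
          (by rw [hyB, hQ]) (by rw [hyB, hj])
        rw [SetLike.mem_coe, ← sub_add_cancel (KaehlerDifferential.D ℤ B o)
          (j • KaehlerDifferential.D ℤ B yB)]
        exact Submodule.add_mem_sup this
          (Submodule.smul_mem _ _ (Submodule.mem_span_singleton_self _))
      · exact Submodule.mem_sup_left (Submodule.subset_span (Or.inr ⟨a, rfl⟩))
    · intro r
      constructor
      · intro hr
        obtain ⟨δ, hδ, hδF, hδx, hδA⟩ := hext (fun _ => 0) ⟨by simp, by simp⟩ (by simp)
          (fun _ _ _ => zero_mem _) 1 hLB.isOrd.one_mem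
        let D₁ : Derivation ℤ B L := Derivation.mk'
          (AddMonoidHom.toIntLinearMap
            { toFun := fun b => δ (algebraMap B L b)
              map_zero' := by
                rw [map_zero]; simpa using hδ.add 0 trivial 0 trivial
              map_add' := fun a b => by rw [map_add]; exact hδ.add _ trivial _ trivial })
          (fun a b => by
            rw [Algebra.smul_def, Algebra.smul_def]
            change δ (algebraMap B L (a * b)) = _
            rw [map_mul]; exact hδ.mul _ trivial _ trivial)
        have hD₁ : ∀ b, D₁.liftKaehlerDifferential (KaehlerDifferential.D ℤ B b)
            = δ (algebraMap B L b) := fun b => D₁.liftKaehlerDifferential_comp_D b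
        have hmem : ∀ ω ∈ diffSpan A B F, D₁.liftKaehlerDifferential ω ∈ hLB.isOrd.filt 0 := by
          intro ω hω
          induction hω using Submodule.span_induction with
          | mem ω h =>
            rcases h with ⟨o, ho, rfl⟩ | ⟨a, rfl⟩
            · rw [hD₁, hδF _ ho]; exact zero_mem _
            · rw [hD₁, ← IsScalarTower.algebraMap_apply]; exact hδA a
          | zero => rw [map_zero]; exact zero_mem _
          | add _ _ _ _ h1 h2 => rw [map_add]; exact add_mem h1 h2
          | smul b _ _ h =>
            rw [map_smul, Algebra.smul_def]
            exact hLB.isOrd.mul_mem_zero ((hLB.mem_range_iff _).mp ⟨b, rfl⟩) h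
        have h1 := hmem _ hr
        rw [map_smul, hD₁, hyB, Algebra.smul_def] at h1
        have h2 : J₀ * δ y = 1 := by
          have := hδ.map_aeval (F := F) le_top (y := y) trivial P
          rw [hPx, hδx] at this
          rw [this]
          simp [hδF _ (SetLike.coe_mem _), hJ₀]
        obtain ⟨s, hs⟩ := (hLB.mem_range_iff _).mpr h1
        refine ⟨s, hLB.injective ?_⟩
        rw [map_mul, hjB, hs, mul_left_comm, h2, mul_one]
      · rintro ⟨s, rfl⟩
        rw [mul_comm, mul_smul]
        refine Submodule.smul_mem _ _ ?_
        have := D_sub_smul_mem_diffSpan (A := A) hLB (y := yB) (o := algebraMap A B xA) (j := jB)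
          hPcoeff (by rw [hyB, hPx, hxB]) (by rw [hyB, hjB])
        have h2 : KaehlerDifferential.D ℤ B (algebraMap A B xA) ∈ diffSpan A B F :=
          Submodule.subset_span (Or.inr ⟨xA, rfl⟩)
        simpa using sub_mem h2 this
  · intro δ hδ hδp hδG
    obtain ⟨δ', h1, h2, -, h3⟩ := hext δ hδ hδp hδG 0 (zero_mem _)
    exact ⟨δ', h1, h2, h3⟩

end Chain

section FrobeniusFinite

theorem RingHom.Finite.of_comp_eq {R R' S S' : Type*} [CommRing R] [CommRing R'] [CommRing S]
    [CommRing S'] {f : R →+* R'} {g : S →+* S'} (i : R →+* S) (j : R' →+* S')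
    (hcomm : g.comp i = j.comp f) (hf : f.Finite) (hfrac : ∀ z : S', ∃ (s : S) (a : R'),
      z = g s * j a) : g.Finite := by
  let : Algebra R R' := f.toAlgebra
  let : Algebra S S' := g.toAlgebra
  have : Module.Finite R R' := hf
  obtain ⟨t, ht⟩ := this.fg_top
  classical
  refine ⟨⟨t.image j, ?_⟩⟩
  rw [eq_top_iff]
  rintro z -
  obtain ⟨s, a, rfl⟩ := hfrac z
  refine Submodule.smul_mem _ s ?_
  have ha : a ∈ Submodule.span R (t : Set R') := ht ▸ Submodule.mem_top
  induction ha using Submodule.span_induction with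
  | mem x hx => exact Submodule.subset_span (Finset.mem_image_of_mem j hx)
  | zero => rw [map_zero]; exact zero_mem _
  | add x y _ _ hx hy => rw [map_add]; exact add_mem hx hy
  | smul r x _ hx =>
    have : j (r • x) = i r • j x := by
      change j (f r * x) = g (i r) * j x
      rw [map_mul]
      exact congrArg (· * j x) (congrArg (fun h => h r) hcomm).symm
    rw [this]
    exact Submodule.smul_mem _ _ hx

theorem frobenius_finite_of_isLocalization {R S : Type*} [CommRing R] [CommRing S] [Algebra R S]
    {p : ℕ} [hp : Fact p.Prime] [CharP R p] [CharP S p] (M : Submonoid R) [IsLocalization M S]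
    (hf : (frobenius R p).Finite) : (frobenius S p).Finite := by
  refine hf.of_comp_eq (algebraMap R S) (algebraMap R S) (by ext x; simp [frobenius_def]) fun z => ?_
  obtain ⟨a, s, rfl⟩ := IsLocalization.exists_mk'_eq M z
  refine ⟨IsLocalization.mk' S 1 s, a * s ^ (p - 1), ?_⟩
  have h1 : IsLocalization.mk' S 1 s * algebraMap R S s = 1 := by
    rw [IsLocalization.mk'_spec, map_one]
  rw [IsLocalization.mk'_eq_mul_mk'_one, frobenius_def, map_mul, map_pow]
  obtain ⟨k, hk⟩ : ∃ k, p = k + 1 := ⟨p - 1, (Nat.sub_add_cancel hp.out.pos).symm⟩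
  rw [show p - 1 = k by omega]
  calc _ = algebraMap R S a * IsLocalization.mk' S 1 s *
      (IsLocalization.mk' S 1 s * algebraMap R S s) ^ k := by rw [h1]; ring
    _ = _ := by rw [hk]; ring

theorem RingHom.Finite.finiteDimensional_fieldRange {R S : Type*} [Field R] [Field S] {f : R →+* S}
    (hf : f.Finite) : FiniteDimensional f.fieldRange S := by
  let : Algebra R S := f.toAlgebra
  let : Algebra R f.fieldRange := f.rangeRestrictField.toAlgebra
  have : IsScalarTower R f.fieldRange S := IsScalarTower.of_algebraMap_eq fun _ => rfl
  have : Module.Finite R S := hf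
  exact Module.Finite.of_restrictScalars_finite R f.fieldRange S

end FrobeniusFinite

section Core

variable {p : ℕ} [hp : Fact p.Prime] {A B K L : Type*} [CommRing A] [CommRing B] [Field K] [Field L]
  [Algebra A B] [Algebra A K] [Algebra B L] [Algebra K L] [Algebra A L] [IsScalarTower A B L]
  [IsScalarTower A K L] [CharP A p] [CharP B p] [CharP K p] [CharP L p]
  [IsLocalRing A] [IsNoetherianRing A] [IsLocalRing B] [IsNoetherianRing B]
  {ordK : K → ℤ} {ordL : L → ℤ}

theorem chainData_of_finrank_eq
    (hKA : IsFFiniteDVR p A ordK) (hLB : IsFFiniteDVR p B ordL)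
    (hKL : ∀ k : K, algebraMap K L k ∈ hLB.isOrd.filt 0 ↔ k ∈ hKA.isOrd.filt 0)
    (hgen : ∀ F : Subfield L, (∀ z : L, z ^ p ∈ F) → (∀ k : K, algebraMap K L k ∈ F) → F = ⊤)
    (n : ℕ) : ∀ (F : Subfield L) (G : Subfield K), FiniteDimensional F L → FiniteDimensional G K →
      Module.finrank F L = n → Module.finrank G K = n → (∀ z : L, z ^ p ∈ F) →
      (∀ z : K, z ^ p ∈ G) → (∀ g ∈ G, algebraMap K L g ∈ F) →
      ChainData p A B hKA.isOrd hLB.isOrd F G := by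
  induction n using Nat.strong_induction_on with
  | _ n ih =>
  intro F G hFfin hGfin hFn hGn hF hG hGF
  by_cases hFtop : F = ⊤
  · subst hFtop
    have h1 : Module.finrank (⊤ : Subfield L) L = 1 := by
      rw [finrank_eq_one_iff_of_nonzero' (1 : L) one_ne_zero]
      exact fun w => ⟨⟨w, trivial⟩, by simp [Subfield.smul_def]⟩
    have hGtop : G = ⊤ := by
      rw [← hFn, h1, finrank_eq_one_iff_of_nonzero' (1 : K) one_ne_zero] at hGn
      rw [eq_top_iff]
      intro w _
      obtain ⟨c, hc⟩ := hGn w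
      rw [← hc, Subfield.smul_def, smul_eq_mul, mul_one]
      exact c.2
    subst hGtop
    exact chainData_top hKA hLB hKL
  · obtain ⟨t, ht⟩ : ∃ t : K, algebraMap K L t ∉ F := by
      by_contra! hc
      exact hFtop (hgen F hF hc)
    have htG : t ∉ G := fun h => ht (hGF t h)
    have htr : algebraMap K L t ∉ (algebraMap F L).range := by rwa [Subfield.mem_range_algebraMap]
    have htGr : t ∉ (algebraMap G K).range := by rwa [Subfield.mem_range_algebraMap]
    have h1 := Module.finrank_mul_finrank F (IntermediateField.adjoin F {algebraMap K L t}) L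
    have h2 := Module.finrank_mul_finrank G (IntermediateField.adjoin G {t}) K
    rw [finrank_adjoin_eq htr (b := ⟨_, hF _⟩) rfl, hFn] at h1
    rw [finrank_adjoin_eq htGr (b := ⟨_, hG _⟩) rfl, hGn, ← h1] at h2
    have h3 := Nat.eq_of_mul_eq_mul_left hp.out.pos h2
    have hle : ∀ a ∈ F, a ∈ (IntermediateField.adjoin F {algebraMap K L t}).toSubfield :=
      fun a ha => (IntermediateField.adjoin F {algebraMap K L t}).algebraMap_mem ⟨a, ha⟩
    have hfin1 : FiniteDimensional (IntermediateField.adjoin F {algebraMap K L t}) L :=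
      Module.Finite.of_restrictScalars_finite F _ L
    have hfin2 : FiniteDimensional (IntermediateField.adjoin G {t}) K :=
      Module.Finite.of_restrictScalars_finite G _ K
    have hpos : 0 < Module.finrank (IntermediateField.adjoin F {algebraMap K L t}) L :=
      Module.finrank_pos
    refine chainData_step hKA hLB hKL hF hG hGF ht (ih _ ?_ _ _ hfin1 hfin2 rfl h3
      (fun z => hle _ (hF z))
      (fun z => (IntermediateField.adjoin G {t}).algebraMap_mem ⟨_, hG z⟩) ?_)
    · change Module.finrank (IntermediateField.adjoin F {algebraMap K L t}) L < n
      rw [← h1]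
      exact lt_mul_of_one_lt_left hpos hp.out.one_lt
    · intro g hg
      obtain ⟨Q, -, rfl⟩ := exists_aeval_eq htGr (b := ⟨_, hG t⟩) rfl hg
      rw [Polynomial.aeval_eq_sum_range, map_sum]
      refine sum_mem fun j _ => ?_
      rw [Subfield.smul_def, smul_eq_mul, map_mul, map_pow]
      exact mul_mem (hle _ (hGF _ (SetLike.coe_mem _)))
        (pow_mem (IntermediateField.mem_adjoin_simple_self F _) j)

theorem finrank_frobenius_fieldRange [FiniteDimensional K L] :
    Module.finrank (frobenius K p).fieldRange K = Module.finrank (frobenius L p).fieldRange L := by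
  let k : Subfield L := (algebraMap K L).fieldRange
  have hk : k = (⊤ : Subfield K).map (algebraMap K L) :=
    RingHom.fieldRange_eq_map _
  have hL : (frobenius L p).fieldRange = (⊤ : Subfield L).map (frobenius L p) :=
    RingHom.fieldRange_eq_map _
  have hK : (frobenius K p).fieldRange.map (algebraMap K L) = k.map (frobenius L p) := by
    rw [hk, RingHom.fieldRange_eq_map, Subfield.map_map, Subfield.map_map]
    congr 1
    ext; simp [frobenius_def]
  have hkle : k.map (frobenius L p) ≤ k := by
    rw [← hK, hk]; exact (Subfield.gc_map_comap _).monotone_l le_top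
  have e1 : Subfield.relfinrank (k.map (frobenius L p)) k * Subfield.relfinrank k ⊤ =
      Subfield.relfinrank (k.map (frobenius L p)) ⊤ :=
    Subfield.relfinrank_mul_relfinrank hkle le_top
  have e2 : Subfield.relfinrank (k.map (frobenius L p)) ((⊤ : Subfield L).map (frobenius L p)) *
      Subfield.relfinrank ((⊤ : Subfield L).map (frobenius L p)) ⊤ =
      Subfield.relfinrank (k.map (frobenius L p)) ⊤ :=
    Subfield.relfinrank_mul_relfinrank ((Subfield.gc_map_comap _).monotone_l le_top) le_top
  rw [Subfield.relfinrank_map_map] at e2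
  have e3 : Subfield.relfinrank (k.map (frobenius L p)) k =
      Module.finrank (frobenius K p).fieldRange K := by
    rw [← hK, hk, Subfield.relfinrank_map_map, Subfield.relfinrank_top_right]
  have e4 : Subfield.relfinrank k ⊤ ≠ 0 := by
    rw [Subfield.relfinrank_top_right]
    have : FiniteDimensional k L := by
      let : Algebra K k := (algebraMap K L).rangeRestrictField.toAlgebra
      have : IsScalarTower K k L := IsScalarTower.of_algebraMap_eq fun _ => rfl
      exact Module.Finite.of_restrictScalars_finite K k L
    exact Module.finrank_pos.ne'
  rw [← e3, ← Subfield.relfinrank_top_right, hL]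
  apply Nat.eq_of_mul_eq_mul_right (Nat.pos_of_ne_zero e4)
  rw [e1, ← e2, mul_comm]

open TestIdeal in
/-- A generator of `Hom(F_* A, A)` extends to `L`, and it becomes the `J ^ (1 - p)`-multiple of a
generator of `Hom(F_* B, B)`, where the order of `J` is the length of `Ω[B⁄A]`. -/
theorem exists_frobenius_generator [IsFractionRing A K] [FiniteDimensional K L]
    [Algebra.IsSeparable K L]
    (hKA : IsFFiniteDVR p A ordK) (hLB : IsFFiniteDVR p B ordL)
    (hKL : ∀ k : K, algebraMap K L k ∈ hLB.isOrd.filt 0 ↔ k ∈ hKA.isOrd.filt 0) :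
    ∃ (φ : K →+ K) (ψ : L →+ L) (n : ℕ), IsPInvLinear K p 1 φ ∧ IsPInvLinear L p 1 ψ ∧
      (∀ k, ψ (algebraMap K L k) = algebraMap K L (φ k)) ∧
      (∀ f : K, (∀ a ∈ hKA.isOrd.filt 0, φ (f * a) ∈ hKA.isOrd.filt 0) ↔ f ∈ hKA.isOrd.filt 0) ∧
      (∀ f : L, (∀ b ∈ hLB.isOrd.filt 0, ψ (f * b) ∈ hLB.isOrd.filt 0) ↔
        f ∈ hLB.isOrd.filt (((p : ℤ) - 1) * n)) ∧
      Module.length B (Ω[B⁄A]) = n := by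
  have hGfin : FiniteDimensional (frobenius K p).fieldRange K :=
    (frobenius_finite_of_isLocalization (nonZeroDivisors A)
      hKA.finite_frobenius).finiteDimensional_fieldRange
  have hrank := finrank_frobenius_fieldRange (p := p) (K := K) (L := L)
  have hFfin : FiniteDimensional (frobenius L p).fieldRange L := by
    apply FiniteDimensional.of_finrank_pos
    rw [← hrank]
    exact Module.finrank_pos
  obtain ⟨Φ, Ψ, J, hJ0, hJint, hΦK, hΦ, hΨ, hJ, hlen, -⟩ :=
    chainData_of_finrank_eq hKA hLB hKL (fun F hF hK => by
      have h1 := Field.span_map_pow_expChar_pow_eq_top_of_isSeparable (F := K) (E := L) p 1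
        (v := (id : L → L)) (by simp)
      rw [eq_top_iff]
      intro z _
      have hz : z ∈ Submodule.span K (Set.range fun x : L => id x ^ p ^ 1) := h1 ▸ Submodule.mem_top
      induction hz using Submodule.span_induction with
      | mem x hx => obtain ⟨y, rfl⟩ := hx; simpa using hF y
      | zero => exact F.zero_mem
      | add x y _ _ hx hy => exact F.add_mem (hx trivial) (hy trivial)
      | smul k x _ hx => rw [Algebra.smul_def]; exact F.mul_mem (hK k) (hx trivial))
    _ (frobenius L p).fieldRange (frobenius K p).fieldRange hFfin hGfin rfl hrank
    (fun z => ⟨z, rfl⟩) (fun z => ⟨z, rfl⟩) (by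
      rintro _ ⟨z, rfl⟩
      exact ⟨algebraMap K L z, by simp [frobenius_def]⟩)
  have hroot : ∀ z : L, ∃ w : L, w ^ p = (Φ z : L) := fun z => by
    obtain ⟨w, hw⟩ := (Φ z).2
    exact ⟨w, hw⟩
  choose ψ hψ using hroot
  have inj : ∀ {a b : L}, a ^ p = b ^ p → a = b := fun {a b} h => frobenius_inj L p h
  have hΦsmul : ∀ r z : L, (Φ (r ^ p * z) : L) = r ^ p * Φ z := fun r z => by
    have : r ^ p * z = (⟨r ^ p, r, rfl⟩ : (frobenius L p).fieldRange) • z := rfl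
    rw [this, map_smul]; rfl
  let ψ' : L →+ L :=
    { toFun := ψ
      map_zero' := inj (by rw [hψ, map_zero, zero_pow hp.out.ne_zero]; rfl)
      map_add' := fun a b => inj (by rw [hψ, add_pow_char, hψ, hψ, map_add]; rfl) }
  have hrootK : ∀ k : K, ∃ w : K, algebraMap K L w = ψ (algebraMap K L k) := fun k => by
    obtain ⟨_, ⟨w, rfl⟩, hw⟩ := hΦK k
    refine ⟨w, inj ?_⟩
    rw [hψ, hw, frobenius_def, map_pow]
  choose φ hφ using hrootK
  have injK := (algebraMap K L).injective
  let φ' : K →+ K :=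
    { toFun := φ
      map_zero' := injK (by rw [hφ, map_zero]; exact ψ'.map_zero)
      map_add' := fun a b => injK (by
        rw [hφ, map_add, map_add, hφ, hφ]; exact ψ'.map_add _ _) }
  have hψlin : ∀ r z, ψ (r ^ p * z) = r * ψ z := fun r z => inj (by
    rw [hψ, hΦsmul, mul_pow, hψ])
  have hmem : ∀ z, ψ z ∈ hLB.isOrd.filt 0 ↔ (Φ z : L) ∈ hLB.isOrd.filt 0 := fun z => by
    rw [← hψ z]
    exact ⟨fun h => hLB.isOrd.pow_mem h p, hLB.isOrd.of_pow_mem hp.out.ne_zero⟩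
  have hJord := hJint hJ0
  refine ⟨φ', ψ', (ordL J).toNat, fun r z => ?_, fun r z => ?_, fun k => (hφ k).symm, fun f => ?_,
    fun f => ?_, ?_⟩
  · change φ (r ^ p ^ 1 * z) = r * φ z
    apply injK
    rw [hφ, map_mul, map_mul, hφ, map_pow, pow_one, hψlin]
  · change ψ (r ^ p ^ 1 * z) = r * ψ z
    rw [pow_one, hψlin]
  · rw [← hΦ f]
    refine forall₂_congr fun a _ => ?_
    change φ _ ∈ _ ↔ _
    rw [← hKL, hφ, hmem]
  · have h1 : ∀ z, (Φ z : L) = Ψ (J⁻¹ ^ p * (J * z)) := fun z => by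
      have : J⁻¹ ^ p * (J * z) = (⟨J⁻¹ ^ p, J⁻¹, rfl⟩ : (frobenius L p).fieldRange) • (J * z) := rfl
      rw [this, map_smul]
      change _ = J⁻¹ ^ p * (Ψ (J * z) : L)
      rw [hJ, inv_pow, inv_mul_cancel_left₀ (pow_ne_zero _ hJ0)]
    have h2 : J⁻¹ ^ p * J ≠ 0 := mul_ne_zero (pow_ne_zero _ (inv_ne_zero hJ0)) hJ0
    have h3 : ordL (J⁻¹ ^ p * J) = (1 - p) * ordL J := by
      rw [hLB.isOrd.map_mul (pow_ne_zero _ (inv_ne_zero hJ0)) hJ0,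
        hLB.isOrd.map_pow (inv_ne_zero hJ0), hLB.isOrd.map_inv hJ0]
      ring
    rw [show ((p : ℤ) - 1) * (ordL J).toNat = 0 - ordL (J⁻¹ ^ p * J) by
      rw [h3, Int.toNat_of_nonneg hJord]; ring, ← hLB.isOrd.mul_mem_iff h2, ← hΨ]
    refine forall₂_congr fun b _ => ?_
    change ψ _ ∈ _ ↔ _
    rw [hmem, h1, ← mul_assoc, ← mul_assoc]
  · rw [← hlen]
    have hsurj := KaehlerDifferential.map_surjective ℤ A B
    have hker : (KaehlerDifferential.map ℤ A B B).ker =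
        diffSpan A B (frobenius L p).fieldRange := by
      rw [(KaehlerDifferential.exact_mapBaseChange_map ℤ A B).linearMap_ker_eq]
      apply le_antisymm
      · rintro _ ⟨x, rfl⟩
        induction x using TensorProduct.induction_on with
        | zero => rw [map_zero]; exact zero_mem _
        | add x y hx hy => rw [map_add]; exact add_mem hx hy
        | tmul b ω =>
          rw [KaehlerDifferential.mapBaseChange_tmul]
          refine Submodule.smul_mem _ _ ?_
          have hω : ω ∈ Submodule.span A (Set.range (KaehlerDifferential.D ℤ A)) := by
            rw [KaehlerDifferential.span_range_derivation]; trivial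
          induction hω using Submodule.span_induction with
          | mem x hx =>
            obtain ⟨a, rfl⟩ := hx
            rw [KaehlerDifferential.map_D]
            exact Submodule.subset_span (Or.inr ⟨a, rfl⟩)
          | zero => rw [map_zero]; exact zero_mem _
          | add x y _ _ hx hy => rw [map_add]; exact add_mem hx hy
          | smul a x _ hx =>
            rw [map_smul, ← algebraMap_smul B a]; exact Submodule.smul_mem _ _ hx
      · refine Submodule.span_le.mpr ?_
        rintro _ (⟨o, ⟨z, hz⟩, rfl⟩ | ⟨a, rfl⟩)
        · rw [frobenius_def] at hz
          obtain ⟨b, rfl⟩ := (hLB.mem_range_iff z).mpr (hLB.isOrd.of_pow_mem hp.out.ne_zero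
            (hz ▸ (hLB.mem_range_iff _).mp ⟨o, rfl⟩))
          rw [← map_pow] at hz
          rw [← hLB.injective hz, Derivation.leibniz_pow, ← Nat.cast_smul_eq_nsmul B,
            CharP.cast_eq_zero, zero_smul]
          exact zero_mem _
        · refine ⟨1 ⊗ₜ KaehlerDifferential.D ℤ A a, ?_⟩
          rw [KaehlerDifferential.mapBaseChange_tmul, KaehlerDifferential.map_D, one_smul]
    rw [← hker]
    exact (LinearEquiv.length_eq
      ((KaehlerDifferential.map ℤ A B B).quotKerEquivOfSurjective hsurj)).symm

end Core

/-! ### `p^{-e}`-linear maps on fields -/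

section PInvLinear

open TestIdeal

variable {p : ℕ} [hp : Fact p.Prime] {K L : Type*} [Field K] [Field L] [Algebra K L] [CharP K p]
  [CharP L p]

omit hp [CharP K p] in
theorem TestIdeal.IsPInvLinear.map_pow_mul {e : ℕ} {φ : K →+ K} (hφ : IsPInvLinear K p e φ) (r x : K) :
    φ (r ^ p ^ e * x) = r * φ x := hφ r x

omit hp [CharP K p] in
theorem TestIdeal.IsPInvLinear.comp {e e' : ℕ} {φ ψ : K →+ K} (hφ : IsPInvLinear K p e φ)
    (hψ : IsPInvLinear K p e' ψ) : IsPInvLinear K p (e + e') (φ.comp ψ) := by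
  intro r x
  change φ (ψ (r ^ p ^ (e + e') * x)) = r * φ (ψ x)
  rw [pow_add, pow_mul, hψ.map_pow_mul, hφ.map_pow_mul]

theorem Algebra.trace_pow_char_pow [FiniteDimensional K L] [Algebra.IsSeparable K L] (e : ℕ)
    (w : L) : Algebra.trace K L (w ^ p ^ e) = Algebra.trace K L w ^ p ^ e := by
  have : CharP (AlgebraicClosure L) p :=
    charP_of_injective_algebraMap (algebraMap L (AlgebraicClosure L)).injective p
  apply (algebraMap K (AlgebraicClosure L)).injective
  rw [RingHom.map_pow, trace_eq_sum_embeddings (AlgebraicClosure L),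
    trace_eq_sum_embeddings (AlgebraicClosure L), sum_pow_char_pow]
  simp

variable (L) in
theorem TestIdeal.IsPInvLinear.exists_extend [FiniteDimensional K L] [Algebra.IsSeparable K L]
    {e : ℕ} {φ : K →+ K} (hφ : IsPInvLinear K p e φ) :
    ∃ φL : L →+ L, IsPInvLinear L p e φL ∧ (∀ k, φL (algebraMap K L k) = algebraMap K L (φ k)) ∧
      ∀ z, Algebra.trace K L (φL z) = φ (Algebra.trace K L z) := by
  let b := Module.finBasis K L
  let bq := b.mapPowExpCharPowOfIsSeparable p e
  have hbq : ∀ i, bq i = b i ^ p ^ e := fun i => by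
    simp [bq, Module.Basis.mapPowExpCharPowOfIsSeparable]
  let φL : L →+ L :=
    { toFun := fun z => ∑ i, algebraMap K L (φ (bq.repr z i)) * b i
      map_zero' := by simp
      map_add' := fun x y => by simp [add_mul, Finset.sum_add_distrib] }
  have key : ∀ (k : K) (w : L), φL (algebraMap K L k * w ^ p ^ e) = algebraMap K L (φ k) * w := by
    intro k w
    have h1 : algebraMap K L k * w ^ p ^ e = ∑ j, (b.repr w j ^ p ^ e * k) • bq j := by
      conv_lhs => rw [← b.sum_repr w, sum_pow_char_pow, Finset.mul_sum]
      refine Finset.sum_congr rfl fun j _ => ?_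
      rw [hbq, Algebra.smul_def, Algebra.smul_def, mul_pow, map_mul, map_pow]
      ring
    change ∑ i, algebraMap K L (φ (bq.repr _ i)) * b i = _
    conv_rhs => rw [← b.sum_repr w, Finset.mul_sum]
    refine Finset.sum_congr rfl fun i _ => ?_
    rw [h1, bq.repr_sum_self, hφ.map_pow_mul, map_mul, Algebra.smul_def]
    ring
  have hsum : ∀ z : L, z = ∑ i, algebraMap K L (bq.repr z i) * b i ^ p ^ e := fun z => by
    conv_lhs => rw [← bq.sum_repr z]
    exact Finset.sum_congr rfl fun i _ => by rw [hbq, Algebra.smul_def]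
  refine ⟨φL, fun r z => ?_, fun k => by simpa using key k 1, fun z => ?_⟩
  · change φL (r ^ p ^ e * z) = r * φL z
    rw [hsum z, map_sum, Finset.mul_sum, map_sum, Finset.mul_sum]
    refine Finset.sum_congr rfl fun i _ => ?_
    rw [mul_left_comm, ← mul_pow, key, key]
    ring
  · rw [hsum z, map_sum, map_sum, map_sum, map_sum]
    refine Finset.sum_congr rfl fun i _ => ?_
    rw [key, ← Algebra.smul_def, ← Algebra.smul_def, map_smul, map_smul,
      Algebra.trace_pow_char_pow, smul_eq_mul, smul_eq_mul, mul_comm (bq.repr z i), hφ.map_pow_mul,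
      mul_comm]

theorem TestIdeal.IsPInvLinear.ext_of_algebraMap [Algebra.IsSeparable K L] {e : ℕ} {φ ψ : L →+ L}
    (hφ : IsPInvLinear L p e φ) (hψ : IsPInvLinear L p e ψ)
    (h : ∀ k : K, φ (algebraMap K L k) = ψ (algebraMap K L k)) : φ = ψ := by
  ext z
  have h1 := Field.span_map_pow_expChar_pow_eq_top_of_isSeparable (F := K) (E := L) p e
    (v := (id : L → L)) (by simp)
  have hz : z ∈ Submodule.span K (Set.range fun x : L => id x ^ p ^ e) := h1 ▸ Submodule.mem_top
  rw [Finsupp.mem_span_range_iff_exists_finsupp] at hz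
  obtain ⟨c, rfl⟩ := hz
  rw [Finsupp.sum, map_sum, map_sum]
  refine Finset.sum_congr rfl fun x _ => ?_
  rw [Algebra.smul_def, mul_comm, hφ.map_pow_mul, hψ.map_pow_mul, h]

theorem exists_eq_mul_of_finite {k E : Type*} [Field k] [Field E] (σ : k →+* E) (hσ : σ.Finite)
    {l m : E →+ k} (hl : ∀ r x, l (σ r * x) = r * l x) (hm : ∀ r x, m (σ r * x) = r * m x)
    (hl0 : l ≠ 0) : ∃ c : E, ∀ x, m x = l (c * x) := by
  let : Algebra k E := σ.toAlgebra
  have : FiniteDimensional k E := hσ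
  have hsmul : ∀ (r : k) (x : E), r • x = σ r * x := fun r x => Algebra.smul_def r x
  have hl' : ∀ (r : k) (x : E), l (r • x) = r • l x := fun r x => by rw [hsmul, hl, smul_eq_mul]
  have hm' : ∀ (r : k) (x : E), m (r • x) = r • m x := fun r x => by rw [hsmul, hm, smul_eq_mul]
  let l' : E →ₗ[k] k := { l with map_smul' := hl' }
  let m' : E →ₗ[k] k := { m with map_smul' := hm' }
  let T : E →ₗ[k] Module.Dual k E :=
    { toFun := fun c => l'.comp (LinearMap.mulLeft k c)
      map_add' := fun a b => by ext x; simp [add_mul]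
      map_smul' := fun r c => by ext x; simp }
  have hT : ∀ c x, T c x = l (c * x) := fun c x => rfl
  obtain ⟨x₀, hx₀⟩ : ∃ x, l x ≠ 0 := by
    by_contra! hc
    exact hl0 (AddMonoidHom.ext hc)
  have hinj : Function.Injective T := by
    rw [injective_iff_map_eq_zero]
    intro c hc
    by_contra hc0
    apply hx₀
    have := congrArg (fun f => f (c⁻¹ * x₀)) hc
    simpa [hT, mul_inv_cancel_left₀ hc0] using this
  have hsurj : Function.Surjective T :=
    (LinearMap.injective_iff_surjective_of_finrank_eq_finrank
      (Subspace.dual_finrank_eq (K := k) (V := E)).symm).mp hinj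
  obtain ⟨c, hc⟩ := hsurj m'
  exact ⟨c, fun x => (congrArg (fun f => f x) hc).symm⟩

theorem frobenius_iterate_finite {R : Type*} [CommRing R] [CharP R p]
    (hR : (frobenius R p).Finite) (e : ℕ) : (iterateFrobenius R p e).Finite := by
  induction e with
  | zero =>
    have : iterateFrobenius R p 0 = RingHom.id R := by ext; simp
    rw [this]; exact RingHom.Finite.id R
  | succ e ih =>
    have : iterateFrobenius R p (e + 1) = (iterateFrobenius R p e).comp (frobenius R p) := by
      ext x; simp [iterateFrobenius_def, frobenius_def, pow_succ, pow_mul, pow_right_comm]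
    rw [this]; exact ih.comp hR

theorem TestIdeal.IsPInvLinear.exists_eq_mul (hK : (frobenius K p).Finite) {e : ℕ} {φ ψ : K →+ K}
    (hφ : IsPInvLinear K p e φ) (hψ : IsPInvLinear K p e ψ) (hφ0 : φ ≠ 0) :
    ∃ c : K, ∀ x, ψ x = φ (c * x) :=
  exists_eq_mul_of_finite (iterateFrobenius K p e) (frobenius_iterate_finite hK e)
    (fun r x => by rw [iterateFrobenius_def, hφ.map_pow_mul])
    (fun r x => by rw [iterateFrobenius_def, hψ.map_pow_mul]) hφ0

/-- `φ` generates the `p^{-e}`-linear maps with values in the integers on the elements of valuation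
at least `m`. -/
def IsOrd.IsGen {ord : K → ℤ} (h : IsOrd ord) (φ : K →+ K) (m : ℤ) : Prop :=
  ∀ f, (∀ a ∈ h.filt 0, φ (f * a) ∈ h.filt 0) ↔ f ∈ h.filt m

theorem IsOrd.exists_eq {ord : K → ℤ} (h : IsOrd ord) (n : ℤ) : ∃ w : K, w ≠ 0 ∧ ord w = n := by
  obtain ⟨w, hw0, hw⟩ := h.exists_eq_one
  exact ⟨w ^ n, zpow_ne_zero _ hw0, by rw [h.map_zpow hw0, hw, mul_one]⟩

theorem IsOrd.IsGen.ne_zero {ord : K → ℤ} {h : IsOrd ord} {φ : K →+ K} {m : ℤ}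
    (hφ : h.IsGen φ m) : φ ≠ 0 := by
  rintro rfl
  obtain ⟨w, hw0, hw⟩ := h.exists_eq (m - 1)
  have := (hφ w).mp (fun _ _ => zero_mem _) hw0
  omega

theorem IsOrd.IsGen.comp {ord : K → ℤ} {h : IsOrd ord} {e' : ℕ} {φ ψ : K →+ K} {m m' : ℤ}
    (hφ : h.IsGen φ m) (hψ : h.IsGen ψ m')
    (hψl : IsPInvLinear K p e' ψ) : h.IsGen (φ.comp ψ) (m' + p ^ e' * m) := by
  intro f
  obtain ⟨w, hw0, hw⟩ := h.exists_eq m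
  have h1 : (∀ a ∈ h.filt 0, φ.comp ψ (f * a) ∈ h.filt 0) ↔
      ∀ a ∈ h.filt 0, ψ (f * a) ∈ h.filt m := by
    constructor
    · intro H a ha
      rw [← hφ]
      intro b hb
      have := H (b ^ p ^ e' * a) (h.mul_mem_zero (h.pow_mem hb _) ha)
      rwa [AddMonoidHom.comp_apply, mul_left_comm, hψl.map_pow_mul, mul_comm] at this
    · intro H a ha
      have := (hφ _).mpr (H a ha) 1 h.one_mem
      rwa [mul_one] at this
  have h2 : ∀ a, ψ (f * a) ∈ h.filt m ↔ ψ (w⁻¹ ^ p ^ e' * f * a) ∈ h.filt 0 := fun a => by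
    rw [mul_assoc, hψl.map_pow_mul, h.mul_mem_iff (inv_ne_zero hw0), h.map_inv hw0, hw]; simp
  rw [h1]
  simp_rw [h2]
  rw [hψ, h.mul_mem_iff (pow_ne_zero _ (inv_ne_zero hw0)), h.map_pow (inv_ne_zero hw0),
    h.map_inv hw0, hw]
  push_cast
  rw [mul_neg, sub_neg_eq_add]

/-- The `e`-th iterate of an additive endomorphism. -/
def iterMap (φ : K →+ K) : ℕ → (K →+ K)
  | 0 => AddMonoidHom.id K
  | e + 1 => (iterMap φ e).comp φ

theorem isPInvLinear_iterMap {φ : K →+ K} (hφ : IsPInvLinear K p 1 φ) (e : ℕ) :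
    IsPInvLinear K p e (iterMap φ e) := by
  induction e with
  | zero => intro r x; simp [iterMap]
  | succ e ih => exact ih.comp hφ

theorem IsOrd.IsGen.iterMap {ord : K → ℤ} {h : IsOrd ord} {φ : K →+ K} {n : ℤ}
    (hφ : h.IsGen φ ((p - 1) * n)) (hφl : IsPInvLinear K p 1 φ) (e : ℕ) :
    h.IsGen (iterMap φ e) (((p : ℤ) ^ e - 1) * n) := by
  induction e with
  | zero =>
    intro f
    simp only [_root_.iterMap, pow_zero, sub_self, zero_mul]
    exact ⟨fun H => by simpa using H 1 h.one_mem, fun hf a ha => h.mul_mem_zero hf ha⟩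
  | succ e ih =>
    have h1 := ih.comp hφ hφl
    have h2 : ((p : ℤ) ^ (e + 1) - 1) * n = (p - 1) * n + p ^ 1 * (((p : ℤ) ^ e - 1) * n) := by
      ring
    rw [h2]
    exact h1

theorem iterMap_algebraMap {φ : K →+ K} {ψ : L →+ L}
    (h : ∀ k, ψ (algebraMap K L k) = algebraMap K L (φ k)) (e : ℕ) (k : K) :
    iterMap ψ e (algebraMap K L k) = algebraMap K L (iterMap φ e k) := by
  induction e generalizing k with
  | zero => rfl
  | succ e ih => exact (congrArg _ (h k)).trans (ih _)

end PInvLinear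

/-! ### Krull domains -/

/-- `A` is a Krull domain, defined by the discrete valuations `ord i` of `K`. -/
structure IsKrull (A : Type*) {K ι : Type*} [CommRing A] [Field K] [Algebra A K]
    (ord : ι → K → ℤ) : Prop where
  isOrd : ∀ i, IsOrd (ord i)
  mem_range_iff : ∀ f : K, f ∈ (algebraMap A K).range ↔ ∀ i, f ∈ (isOrd i).filt 0
  finite : ∀ f : K, f ≠ 0 → {i | ord i f ≠ 0}.Finite
  separate : ∀ i j, i ≠ j → ∃ a : A, algebraMap A K a ≠ 0 ∧ ord i (algebraMap A K a) = 0 ∧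
    0 < ord j (algebraMap A K a)

namespace IsKrull

variable {A K ι : Type*} [CommRing A] [Field K] [Algebra A K] {ord : ι → K → ℤ}
  (h : IsKrull A ord)
include h

theorem algebraMap_mem (a : A) (i : ι) : algebraMap A K a ∈ (h.isOrd i).filt 0 :=
  (h.mem_range_iff _).mp ⟨a, rfl⟩ i

theorem ord_algebraMap_nonneg {a : A} (ha : algebraMap A K a ≠ 0) (i : ι) :
    0 ≤ ord i (algebraMap A K a) := h.algebraMap_mem a i ha

theorem exists_forall_le_ord_of {P : K → Prop} (h1 : P 1) (hmul : ∀ x y, P x → P y → P (x * y))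
    (S : Finset ι)
    (hS : ∀ j ∈ S, ∃ a : A, algebraMap A K a ≠ 0 ∧ P (algebraMap A K a) ∧
      0 < ord j (algebraMap A K a)) (n : ℕ) :
    ∃ a : A, algebraMap A K a ≠ 0 ∧ P (algebraMap A K a) ∧
      ∀ j ∈ S, (n : ℤ) ≤ ord j (algebraMap A K a) := by
  classical
  induction S using Finset.induction_on with
  | empty => exact ⟨1, by simp, by simpa using h1, by simp⟩
  | insert j S hj ih =>
    obtain ⟨a, ha0, haP, ha⟩ := ih fun k hk => hS k (Finset.mem_insert_of_mem hk)
    obtain ⟨b, hb0, hbP, hb⟩ := hS j (Finset.mem_insert_self _ _)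
    have hbn0 : algebraMap A K b ^ n ≠ 0 := pow_ne_zero _ hb0
    have hbn : ∀ m : ℕ, P (algebraMap A K b ^ m) := fun m => by
      induction m with
      | zero => simpa using h1
      | succ m ihm => rw [pow_succ]; exact hmul _ _ ihm hbP
    refine ⟨a * b ^ n, ?_, ?_, fun k hk => ?_⟩
    · rw [map_mul, map_pow]; exact mul_ne_zero ha0 hbn0
    · rw [map_mul, map_pow]; exact hmul _ _ haP (hbn n)
    · rw [map_mul, map_pow, (h.isOrd k).map_mul ha0 hbn0, (h.isOrd k).map_pow hb0]
      rcases Finset.mem_insert.mp hk with rfl | hk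
      · have := h.ord_algebraMap_nonneg ha0 k
        nlinarith
      · have h1 := ha k hk
        have h2 := mul_nonneg (Int.natCast_nonneg n) (h.ord_algebraMap_nonneg hb0 k)
        omega

theorem exists_forall_le_ord_of_ne (i : ι) (S : Finset ι) (n : ℕ) :
    ∃ a : A, algebraMap A K a ≠ 0 ∧ ord i (algebraMap A K a) = 0 ∧
      ∀ j ∈ S, j ≠ i → (n : ℤ) ≤ ord j (algebraMap A K a) := by
  classical
  obtain ⟨a, ha0, ⟨-, ha1⟩, ha⟩ := h.exists_forall_le_ord_of
    (P := fun x => x ≠ 0 ∧ ord i x = 0) ⟨one_ne_zero, (h.isOrd i).map_one⟩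
    (fun x y hx hy => ⟨mul_ne_zero hx.1 hy.1, by rw [(h.isOrd i).map_mul hx.1 hy.1, hx.2, hy.2]; rfl⟩)
    (S.erase i) (fun j hj => by
      obtain ⟨a, ha0, ha1, ha2⟩ := h.separate i j (Finset.ne_of_mem_erase hj).symm
      exact ⟨a, ha0, ⟨ha0, ha1⟩, ha2⟩) n
  exact ⟨a, ha0, ha1, fun j hj hji => ha j (Finset.mem_erase.mpr ⟨hji, hj⟩)⟩

theorem exists_ord_pos [IsFractionRing A K] (j : ι) :
    ∃ a : A, algebraMap A K a ≠ 0 ∧ 0 < ord j (algebraMap A K a) := by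
  obtain ⟨w, hw0, hw⟩ := (h.isOrd j).exists_eq_one
  obtain ⟨a, b, hb, rfl⟩ := IsFractionRing.div_surjective (A := A) w
  have hb0 : algebraMap A K b ≠ 0 := fun h0 => hw0 (by rw [h0, div_zero])
  have ha0 : algebraMap A K a ≠ 0 := fun h0 => hw0 (by rw [h0, zero_div])
  refine ⟨a, ha0, ?_⟩
  rw [div_eq_mul_inv, (h.isOrd j).map_mul ha0 (inv_ne_zero hb0), (h.isOrd j).map_inv hb0] at hw
  have := h.ord_algebraMap_nonneg hb0 j
  omega

theorem exists_forall_le_ord [IsFractionRing A K] (S : Finset ι) (n : ℕ) :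
    ∃ a : A, algebraMap A K a ≠ 0 ∧ ∀ j ∈ S, (n : ℤ) ≤ ord j (algebraMap A K a) := by
  obtain ⟨a, ha0, -, ha⟩ := h.exists_forall_le_ord_of (P := fun _ => True) trivial
    (fun _ _ _ _ => trivial) S (fun j _ => by
      obtain ⟨a, ha0, ha⟩ := h.exists_ord_pos j
      exact ⟨a, ha0, trivial, ha⟩) n
  exact ⟨a, ha0, ha⟩

/-- A divisor of finite support is bounded by a principal divisor. -/
theorem exists_forall_abs_le_ord [IsFractionRing A K] {D : ι → ℤ} (hD : {i | D i ≠ 0}.Finite) :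
    ∃ a : A, algebraMap A K a ≠ 0 ∧ ∀ j, |D j| ≤ ord j (algebraMap A K a) := by
  obtain ⟨a, ha0, ha⟩ := h.exists_forall_le_ord hD.toFinset (∑ i ∈ hD.toFinset, (D i).natAbs)
  refine ⟨a, ha0, fun j => ?_⟩
  by_cases hj : D j = 0
  · simpa [hj] using h.ord_algebraMap_nonneg ha0 j
  · have hj' : j ∈ hD.toFinset := by simpa using hj
    refine le_trans ?_ (ha j hj')
    rw [Int.abs_eq_natAbs]
    exact_mod_cast Finset.single_le_sum (f := fun i => (D i).natAbs) (fun _ _ => Nat.zero_le _) hj'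

end IsKrull

/-! ### Maps compatible with a divisor -/

section Compat

open TestIdeal

variable {A K ι : Type*} [CommRing A] [Field K] [Algebra A K] {ord : ι → K → ℤ}

/-- `φ` is a `p^{-e}`-linear map that sends `𝒪(D)` to `𝒪` locally at each of the valuations. -/
structure IsKrull.Compat (h : IsKrull A ord) (p e : ℕ) (D : ι → ℤ) (φ : K →+ K) : Prop where
  linear : IsPInvLinear K p e φ
  map_mem : ∀ i, ∀ f ∈ (h.isOrd i).filt (-D i), φ f ∈ (h.isOrd i).filt 0

variable {h : IsKrull A ord} {p e e' : ℕ} {D D' : ι → ℤ} {φ ψ : K →+ K}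

theorem IsKrull.Compat.of_sections [hp : Fact p.Prime] (hD : {i | D i ≠ 0}.Finite)
    (hφ : IsPInvLinear K p e φ)
    (hmem : ∀ f, (∀ i, f ∈ (h.isOrd i).filt (-D i)) → φ f ∈ (algebraMap A K).range) :
    h.Compat p e D φ := by
  classical
  refine ⟨hφ, fun i f hf => ?_⟩
  rcases eq_or_ne f 0 with rfl | hf0
  · simp
  let S := hD.toFinset ∪ (h.finite f hf0).toFinset
  obtain ⟨s, hs0, hsi, hs⟩ := h.exists_forall_le_ord_of_ne i S
    (∑ j ∈ S, ((D j).natAbs + (ord j f).natAbs))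
  have hq : 1 ≤ p ^ e := Nat.one_le_pow _ _ hp.out.pos
  have h1 : algebraMap A K s * φ f ∈ (h.isOrd i).filt 0 := by
    rw [← hφ.map_pow_mul]
    refine (h.mem_range_iff _).mp (hmem _ fun j => ?_) i
    rw [(h.isOrd j).mul_mem_iff (pow_ne_zero _ hs0), (h.isOrd j).map_pow hs0,
      (h.isOrd j).mem_filt_of_ne hf0]
    have hsn := h.ord_algebraMap_nonneg hs0 j
    by_cases hji : j = i
    · subst hji
      rw [hsi, mul_zero, sub_zero]; exact hf hf0
    by_cases hj : j ∈ S
    · have h2 := hs j hj hji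
      have h3 := Finset.single_le_sum (f := fun j => (D j).natAbs + (ord j f).natAbs)
        (fun _ _ => Nat.zero_le _) hj
      have h4 : ord j (algebraMap A K s) ≤ ((p ^ e : ℕ) : ℤ) * ord j (algebraMap A K s) :=
        le_mul_of_one_le_left hsn (by exact_mod_cast hq)
      have h3' : (((D j).natAbs + (ord j f).natAbs : ℕ) : ℤ) ≤
        ((∑ j ∈ S, ((D j).natAbs + (ord j f).natAbs) : ℕ) : ℤ) := by exact_mod_cast h3
      omega
    · have h2 : D j = 0 ∧ ord j f = 0 := by simpa [S, not_or] using hj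
      rw [h2.1, h2.2]
      have := mul_nonneg (Int.natCast_nonneg (p ^ e)) hsn
      omega
  rwa [(h.isOrd i).mul_mem_iff hs0, hsi, sub_zero] at h1

theorem IsKrull.Compat.map_sections (hφ : h.Compat p e D φ) {f : K}
    (hf : ∀ i, f ∈ (h.isOrd i).filt (-D i)) : φ f ∈ (algebraMap A K).range :=
  (h.mem_range_iff _).mpr fun i => hφ.map_mem i f (hf i)

theorem IsKrull.compat_id : h.Compat p 0 0 (AddMonoidHom.id K) :=
  ⟨fun r x => by simp, fun i f hf => by simpa using hf⟩

theorem IsKrull.Compat.comp (hφ : h.Compat p e D φ) (hψ : h.Compat p e' D' ψ) {D'' : ι → ℤ}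
    (hD : ∀ i, D'' i ≤ p ^ e' * D i + D' i) : h.Compat p (e + e') D'' (φ.comp ψ) := by
  refine ⟨hφ.linear.comp hψ.linear, fun i f hf => ?_⟩
  obtain ⟨w, hw0, hw⟩ := (h.isOrd i).exists_eq (D i)
  refine hφ.map_mem i _ ?_
  have h1 : w * ψ f ∈ (h.isOrd i).filt 0 := by
    rw [← hψ.linear.map_pow_mul]
    refine hψ.map_mem i _ ?_
    rw [(h.isOrd i).mul_mem_iff (pow_ne_zero _ hw0), (h.isOrd i).map_pow hw0, hw]
    refine (h.isOrd i).filt_mono ?_ hf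
    have := hD i
    push_cast
    linarith
  rwa [(h.isOrd i).mul_mem_iff hw0, hw, zero_sub] at h1

theorem IsKrull.Compat.mul (hφ : h.Compat p e D φ) {c : K} (hc : c ≠ 0) {D' : ι → ℤ}
    (hD : ∀ i, D' i ≤ D i + ord i c) : h.Compat p e D' (φ.comp (AddMonoidHom.mulLeft c)) := by
  refine ⟨fun r x => ?_, fun i f hf => hφ.map_mem i _ ?_⟩
  · change φ (c * (r ^ p ^ e * x)) = r * φ (c * x)
    rw [mul_left_comm, hφ.linear.map_pow_mul]
  · change c * f ∈ _
    rw [(h.isOrd i).mul_mem_iff hc]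
    exact (h.isOrd i).filt_mono (by linarith [hD i]) hf

end Compat

/-! ### Existence of test elements -/

section TestElement

open TestIdeal

variable {p : ℕ} [hp : Fact p.Prime] {A K : Type*} [CommRing A] [IsDomain A] [IsNoetherianRing A]
  [Field K] [Algebra A K] [IsFractionRing A K]

theorem Ideal.exists_pow_mem_of_span_mul_le {J : Ideal A} (hJ : J ≠ ⊥) {c : A} (hc : c ≠ 0)
    {n : ℕ} (hn : 2 ≤ n) (hle : Ideal.span {c} * J ≤ J ^ n) : ∃ k, c ^ k ∈ J := by
  have hdom : IsDomain (Localization.Away c) :=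
    IsLocalization.isDomain_localization (powers_le_nonZeroDivisors_of_noZeroDivisors hc)
  have hnoeth : IsNoetherianRing (Localization.Away c) :=
    IsLocalization.isNoetherianRing (Submonoid.powers c) _ inferInstance
  let J' := J.map (algebraMap A (Localization.Away c))
  have h1 : (Ideal.span {c}).map (algebraMap A (Localization.Away c)) = ⊤ := by
    rw [Ideal.map_span, Set.image_singleton, Ideal.span_singleton_eq_top]
    exact IsLocalization.Away.algebraMap_isUnit c
  have h2 : J' ≤ J' ^ 2 := by
    have := Ideal.map_mono (f := algebraMap A (Localization.Away c)) hle
    rw [Ideal.map_mul, h1, Ideal.map_pow, ← Ideal.one_eq_top, one_mul] at this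
    exact this.trans (Ideal.pow_le_pow_right hn)
  have h3 : IsIdempotentElem J' := by
    rw [IsIdempotentElem, ← pow_two]
    exact le_antisymm (Ideal.pow_le_self two_ne_zero) h2
  rcases (Ideal.isIdempotentElem_iff_eq_bot_or_top J' (IsNoetherian.noetherian J')).mp h3 with h | h
  · exfalso
    apply hJ
    rw [eq_bot_iff]
    intro x hx
    have h4 : algebraMap A (Localization.Away c) x ∈ J' := Ideal.mem_map_of_mem _ hx
    rw [h, Ideal.mem_bot] at h4
    exact (IsLocalization.injective (Localization.Away c)
      (powers_le_nonZeroDivisors_of_noZeroDivisors hc)) (by rw [h4, map_zero])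
  · by_contra! hcon
    refine (IsLocalization.map_algebraMap_ne_top_iff_disjoint (Submonoid.powers c)
      (Localization.Away c) J).mpr ?_ h
    rw [Set.disjoint_left]
    rintro _ ⟨k, rfl⟩ hk
    exact hcon k hk

theorem exists_mem_of_forall_ideal {n : ℕ} {φ : Fin n → K →+ K} {b : Fin n → K}
    (hsum : ∀ x, x = ∑ j, φ j x ^ p * b j) {φ₀ : K →+ K} (hφ₀ : IsPInvLinear K p 1 φ₀)
    (hone : φ₀ 1 = 1) {d : A} (hd : d ≠ 0) :
    ∃ c : A, c ≠ 0 ∧ ∀ J : Ideal A, J ≠ ⊥ →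
      (∀ j, ∀ x ∈ J, ∃ y ∈ J, φ j (algebraMap A K (d * x)) = algebraMap A K y) →
      (∀ x ∈ J, ∃ y ∈ J, φ₀ (algebraMap A K (d * x)) = algebraMap A K y) → c ∈ J := by
  classical
  have hinj : Function.Injective (algebraMap A K) := IsFractionRing.injective A K
  obtain ⟨⟨g, hg⟩, hgb⟩ := IsLocalization.exist_integer_multiples_of_finite (nonZeroDivisors A) b
  have hg0 : g ≠ 0 := nonZeroDivisors.ne_zero hg
  choose β hβ using hgb
  refine ⟨(d * g) ^ 2, pow_ne_zero _ (mul_ne_zero hd hg0), fun J hJ h1 h2 => ?_⟩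
  have hle : Ideal.span {d * g} * J ≤ J ^ p := by
    rw [Ideal.span_singleton_mul_le_iff]
    intro x hx
    choose y hy hyx using fun j => h1 j x hx
    have : d * g * x = ∑ j, y j ^ p * β j := by
      apply hinj
      rw [mul_right_comm, map_mul, hsum (algebraMap A K (d * x)), map_sum, Finset.sum_mul]
      refine Finset.sum_congr rfl fun j _ => ?_
      have := hβ j
      simp only [Algebra.smul_def] at this
      rw [hyx, map_mul, map_pow, this]
      ring
    rw [this]
    exact Ideal.sum_mem _ fun j _ => Ideal.mul_mem_right _ _ (Ideal.pow_mem_pow (hy j) p)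
  have hred : ∀ m, m ≠ 0 → (d * g) ^ (p * m - 1) ∈ J → (d * g) ^ m ∈ J := by
    intro m hm hmem
    obtain ⟨y, hy, hyx⟩ := h2 (g * (d * g) ^ (p * m - 1)) (J.mul_mem_left _ hmem)
    have hpm : p * m ≠ 0 := mul_ne_zero hp.out.ne_zero hm
    rw [← mul_assoc, mul_pow_sub_one hpm, mul_comm p m, pow_mul, map_pow] at hyx
    have := hφ₀.map_pow_mul (algebraMap A K ((d * g) ^ m)) 1
    rw [pow_one, mul_one, hone, mul_one, hyx] at this
    rwa [← hinj this]
  obtain ⟨k, hk⟩ := Ideal.exists_pow_mem_of_span_mul_le hJ (mul_ne_zero hd hg0) hp.out.two_le hle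
  induction k using Nat.strong_induction_on with
  | _ k ih =>
    by_cases hk2 : k ≤ 2
    · exact J.pow_mem_of_pow_mem hk hk2
    · refine ih (k - 1) (by omega) (hred _ (by omega) (J.pow_mem_of_pow_mem hk ?_))
      have : 2 * (k - 1) ≤ p * (k - 1) := Nat.mul_le_mul_right _ hp.out.two_le
      omega

variable [CharP A p] [CharP K p]

omit hp [IsDomain A] [IsNoetherianRing A] [Field K] [Algebra A K] [IsFractionRing A K] [CharP A p]
  [CharP K p] in
theorem exists_coord_of_finite {k E : Type*} [Field k] [Field E] (σ : k →+* E) (hσ : σ.Finite) :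
    ∃ (n : ℕ) (φ : Fin n → E →+ k) (b : Fin n → E), (∀ j r x, φ j (σ r * x) = r * φ j x) ∧
      ∀ x, x = ∑ j, σ (φ j x) * b j := by
  let : Algebra k E := σ.toAlgebra
  have : FiniteDimensional k E := hσ
  have hsmul : ∀ (r : k) (x : E), r • x = σ r * x := fun r x => Algebra.smul_def r x
  let b := Module.finBasis k E
  refine ⟨_, fun j => (b.coord j).toAddMonoidHom, b, fun j r x => ?_, fun x => ?_⟩
  · rw [← hsmul]
    exact (b.coord j).map_smul r x
  · conv_lhs => rw [← b.sum_repr x]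
    exact Finset.sum_congr rfl fun j _ => hsmul _ _

omit hp [IsDomain A] [IsNoetherianRing A] [Field K] [Algebra A K] [IsFractionRing A K] [CharP A p]
  [CharP K p] in
theorem RingHom.Finite.exists_generators {R S : Type*} [CommRing R] [CommRing S] {σ : R →+* S}
    (hσ : σ.Finite) : ∃ (n : ℕ) (g : Fin n → S), ∀ a, ∃ r : Fin n → R, ∑ k, σ (r k) * g k = a := by
  let : Algebra R S := σ.toAlgebra
  have : Module.Finite R S := hσ
  obtain ⟨n, g, hg⟩ := Module.Finite.exists_fin (R := R) (M := S)
  refine ⟨n, g, fun a => ?_⟩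
  have ha : a ∈ Submodule.span R (Set.range g) := hg ▸ Submodule.mem_top
  obtain ⟨r, hr⟩ := (Submodule.mem_span_range_iff_exists_fun R).mp ha
  exact ⟨r, by rw [← hr]; exact Finset.sum_congr rfl fun k _ => (Algebra.smul_def _ _).symm⟩

variable {ι : Type*} {ord : ι → K → ℤ} {h : IsKrull A ord}

omit hp [IsDomain A] [IsNoetherianRing A] [IsFractionRing A K] [CharP A p] [CharP K p] in
theorem IsKrull.Compat.mono {e : ℕ} {D D' : ι → ℤ} {φ : K →+ K} (hφ : h.Compat p e D φ)
    (hD : ∀ i, D' i ≤ D i) : h.Compat p e D' φ :=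
  ⟨hφ.linear, fun i f hf => hφ.map_mem i f ((h.isOrd i).filt_mono (neg_le_neg (hD i)) hf)⟩

theorem IsKrull.exists_compat (hA : (frobenius A p).Finite) {e : ℕ} {φ : K →+ K}
    (hφ : IsPInvLinear K p e φ) {D : ι → ℤ} (hD : {i | D i ≠ 0}.Finite) :
    ∃ d : A, d ≠ 0 ∧ h.Compat p e D (φ.comp (AddMonoidHom.mulLeft (algebraMap A K d))) := by
  obtain ⟨n, g, hg⟩ : ∃ (n : ℕ) (g : Fin n → A),
      ∀ a, ∃ r : Fin n → A, ∑ k, r k ^ p ^ e * g k = a := by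
    simpa only [iterateFrobenius_def] using (frobenius_iterate_finite hA e).exists_generators
  obtain ⟨⟨s, hs⟩, hsg⟩ := IsLocalization.exist_integer_multiples_of_finite (nonZeroDivisors A)
    fun k => φ (algebraMap A K (g k))
  choose y hy using hsg
  simp only [Algebra.smul_def] at hy
  have hs0 : s ≠ 0 := nonZeroDivisors.ne_zero hs
  have h1 : ∀ a : A, φ (algebraMap A K (s ^ p ^ e * a)) ∈ (algebraMap A K).range := by
    intro a
    obtain ⟨r, rfl⟩ := hg a
    rw [Finset.mul_sum, map_sum, map_sum]
    refine sum_mem fun k _ => ⟨r k * y k, ?_⟩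
    rw [← mul_assoc, ← mul_pow, map_mul, map_mul, map_pow, hφ.map_pow_mul, map_mul, hy]
    ring
  obtain ⟨c, hc0, hc⟩ := h.exists_forall_abs_le_ord hD
  have hc0' : c ≠ 0 := fun h0 => hc0 (by rw [h0, map_zero])
  refine ⟨s ^ p ^ e * c, mul_ne_zero (pow_ne_zero _ hs0) hc0', IsKrull.Compat.of_sections hD ?_ ?_⟩
  · intro r x
    change φ (_ * (r ^ p ^ e * x)) = r * φ (_ * x)
    rw [mul_left_comm, hφ.map_pow_mul]
  · intro f hf
    obtain ⟨a, ha⟩ : algebraMap A K c * f ∈ (algebraMap A K).range := by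
      rw [h.mem_range_iff]
      intro i
      rw [(h.isOrd i).mul_mem_iff hc0]
      refine (h.isOrd i).filt_mono ?_ (hf i)
      have := (le_abs_self (D i)).trans (hc i)
      omega
    change φ (_ * f) ∈ _
    rw [map_mul (algebraMap A K), mul_assoc, ← ha, ← map_mul]
    exact h1 a

end TestElement

/-! ### Stable submodules -/

section Stable

open TestIdeal

/-- The integral divisor `⌈(p^e - 1) Δ⌉`. -/
def ceilDivisor {ι : Type*} (p e : ℕ) (Δ : ι → ℚ) : ι → ℤ := fun i => ⌈((p : ℚ) ^ e - 1) * Δ i⌉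

variable {p : ℕ} {A K ι : Type*} [CommRing A] [Field K] [Algebra A K] {ord : ι → K → ℤ}

/-- The nonzero fractional ideals that are stable under all maps compatible with `(Δ, 𝔞 ^ t)`. -/
structure IsKrull.Stable (h : IsKrull A ord) (p : ℕ) (Δ : ι → ℚ) (𝔞 : Ideal A) (t : ℝ)
    (M : Submodule A K) : Prop where
  ne_bot : M ≠ ⊥
  map_mem : ∀ e φ, h.Compat p e (ceilDivisor p e Δ) φ →
    ∀ z ∈ 𝔞 ^ ⌈t * ((p : ℝ) ^ e - 1)⌉₊, ∀ m ∈ M, φ (algebraMap A K z * m) ∈ M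

theorem finite_ceilDivisor_ne_zero {Δ : ι → ℚ} (hΔ : {i | Δ i ≠ 0}.Finite) (e : ℕ) :
    {i | ceilDivisor p e Δ i ≠ 0}.Finite :=
  hΔ.subset fun i hi h0 => hi (by simp [ceilDivisor, h0])

theorem Submodule.exists_algebraMap_mem [IsFractionRing A K] {M : Submodule A K} (hM : M ≠ ⊥) :
    ∃ a : A, a ≠ 0 ∧ algebraMap A K a ∈ M := by
  obtain ⟨m, hm, hm0⟩ := Submodule.exists_mem_ne_zero_of_ne_bot hM
  obtain ⟨a, b, hb, rfl⟩ := IsFractionRing.div_surjective (A := A) m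
  have hb0 : algebraMap A K b ≠ 0 := fun h0 => hm0 (by rw [h0, div_zero])
  refine ⟨a, fun h0 => hm0 (by rw [h0, map_zero, zero_div]), ?_⟩
  have := M.smul_mem b hm
  rwa [Algebra.smul_def, mul_div_cancel₀ _ hb0] at this

theorem IsKrull.exists_isLeast_stable (h : IsKrull A ord) [hp : Fact p.Prime] [IsDomain A]
    [IsNoetherianRing A] [IsFractionRing A K] [CharP A p] [CharP K p] (hA : (frobenius A p).Finite)
    {Δ : ι → ℚ} (hΔ : {i | Δ i ≠ 0}.Finite) {𝔞 : Ideal A} (h𝔞 : 𝔞 ≠ ⊥) (t : ℝ) :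
    ∃ M, IsLeast {M | h.Stable p Δ 𝔞 t M} M := by
  have hinj : Function.Injective (algebraMap A K) := IsFractionRing.injective A K
  obtain ⟨n, φ, b, hφ, hsum⟩ := exists_coord_of_finite (frobenius K p)
    (frobenius_finite_of_isLocalization (nonZeroDivisors A) hA)
  have hφ' : ∀ j, IsPInvLinear K p 1 (φ j) := fun j r x => by
    rw [pow_one]; exact hφ j r x
  obtain ⟨i₀, hi₀⟩ : ∃ j, φ j 1 ≠ 0 := by
    by_contra! hcon
    have := hsum 1
    simp [hcon] at this
  let φ₀ : K →+ K := (φ i₀).comp (AddMonoidHom.mulLeft ((φ i₀ 1)⁻¹ ^ p ^ 1))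
  have hφ₀ : IsPInvLinear K p 1 φ₀ := fun r x => by
    change φ i₀ (_ * (r ^ p ^ 1 * x)) = r * φ i₀ (_ * x)
    rw [mul_left_comm, (hφ' i₀).map_pow_mul]
  have hone : φ₀ 1 = 1 := by
    change φ i₀ (_ * 1) = 1
    rw [(hφ' i₀).map_pow_mul, inv_mul_cancel₀ hi₀]
  let D : ι → ℤ := fun i => |ceilDivisor p 1 Δ i|
  have hD : {i | D i ≠ 0}.Finite :=
    (finite_ceilDivisor_ne_zero (p := p) hΔ 1).subset fun i hi h0 => hi (by simp [D, h0])
  choose d hd0 hd using fun j => h.exists_compat hA (hφ' j) hD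
  obtain ⟨d₀, hd₀0, hd₀⟩ := h.exists_compat hA hφ₀ hD
  obtain ⟨z, hz, hz0⟩ := Submodule.exists_mem_ne_zero_of_ne_bot
    (pow_ne_zero ⌈t * ((p : ℝ) ^ 1 - 1)⌉₊ h𝔞 : 𝔞 ^ _ ≠ ⊥)
  have key : ∀ (ψ : K →+ K) (d' c : A), h.Compat p 1 D
      (ψ.comp (AddMonoidHom.mulLeft (algebraMap A K d'))) → d' ∣ c → ∀ M, h.Stable p Δ 𝔞 t M →
      ∀ x ∈ M.comap (Algebra.linearMap A K), ∃ y ∈ M.comap (Algebra.linearMap A K),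
        ψ (algebraMap A K (c * z * x)) = algebraMap A K y := by
    rintro ψ d' _ hψ ⟨g, rfl⟩ M hM x hx
    have e1 : ψ (algebraMap A K (d' * g * z * x)) =
        (ψ.comp (AddMonoidHom.mulLeft (algebraMap A K d')))
          (algebraMap A K z * algebraMap A K (g * x)) := by
      rw [← map_mul, AddMonoidHom.comp_apply, AddMonoidHom.coe_mulLeft, ← map_mul]
      congr 2; ring
    have h1 : ψ (algebraMap A K (d' * g * z * x)) ∈ M := by
      rw [e1]
      refine hM.map_mem 1 _ (hψ.mono fun i => le_abs_self _) z hz _ ?_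
      rw [map_mul, ← Algebra.smul_def]
      exact M.smul_mem _ hx
    obtain ⟨y, hy⟩ : ψ (algebraMap A K (d' * g * z * x)) ∈ (algebraMap A K).range := by
      rw [e1, ← map_mul]
      refine hψ.map_sections fun i => (h.isOrd i).filt_mono ?_ (h.algebraMap_mem _ i)
      exact neg_nonpos.mpr (abs_nonneg _)
    exact ⟨y, by rw [Submodule.mem_comap, Algebra.linearMap_apply, hy]; exact h1, hy.symm⟩
  have hdz : (∏ j, d j) * d₀ * z ≠ 0 :=
    mul_ne_zero (mul_ne_zero (Finset.prod_ne_zero_iff.mpr fun j _ => hd0 j) hd₀0) hz0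
  obtain ⟨c, hc0, hc⟩ := exists_mem_of_forall_ideal hsum hφ₀ hone hdz
  have hcM : ∀ M, h.Stable p Δ 𝔞 t M → algebraMap A K c ∈ M := by
    intro M hM
    refine hc (M.comap (Algebra.linearMap A K)) ?_ (fun j => ?_) ?_
    · obtain ⟨a, ha0, ha⟩ := Submodule.exists_algebraMap_mem hM.ne_bot
      exact fun hbot => ha0 ((Submodule.mem_bot A).mp (hbot ▸ ha))
    · exact key _ _ _ (hd j) ((Finset.dvd_prod_of_mem d (Finset.mem_univ j)).mul_right _) M hM
    · exact key _ _ _ hd₀ (dvd_mul_left _ _) M hM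
  refine ⟨sInf {M | h.Stable p Δ 𝔞 t M}, ⟨fun hbot => ?_, ?_⟩, fun M hM => sInf_le hM⟩
  · have : algebraMap A K c ∈ sInf {M | h.Stable p Δ 𝔞 t M} :=
      (Submodule.mem_sInf).mpr fun M hM => hcM M hM
    rw [hbot, Submodule.mem_bot] at this
    exact hc0 (hinj (by rw [this, map_zero]))
  · intro e ψ hψ z hz m hm
    rw [Submodule.mem_sInf] at hm ⊢
    exact fun M hM => hM.map_mem e ψ hψ z hz m (hm M hM)

end Stable

section StableSpan

open TestIdeal

variable {p : ℕ} {A K ι : Type*} [CommRing A] [Field K] [Algebra A K] {ord : ι → K → ℤ}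

theorem ceilDivisor_add_le (Δ : ι → ℚ) (e e' : ℕ) (i : ι) :
    ceilDivisor p (e + e') Δ i ≤ p ^ e' * ceilDivisor p e Δ i + ceilDivisor p e' Δ i := by
  unfold ceilDivisor
  rw [Int.ceil_le]
  push_cast
  have h1 := Int.le_ceil (((p : ℚ) ^ e - 1) * Δ i)
  have h2 := Int.le_ceil (((p : ℚ) ^ e' - 1) * Δ i)
  have h3 := mul_le_mul_of_nonneg_left h1 (by positivity : (0 : ℚ) ≤ (p : ℚ) ^ e')
  rw [pow_add]
  linarith

/-- The submodule obtained by applying all compatible maps to a principal ideal. -/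
def IsKrull.stableSpan (h : IsKrull A ord) (p : ℕ) (Δ : ι → ℚ) (𝔞 : Ideal A) (t : ℝ) (c : A) :
    Submodule A K :=
  Submodule.span A {x | ∃ e φ, h.Compat p e (ceilDivisor p e Δ) φ ∧
    ∃ z ∈ 𝔞 ^ ⌈t * ((p : ℝ) ^ e - 1)⌉₊, ∃ a : A, x = φ (algebraMap A K (z * c * a))}

theorem IsKrull.stable_stableSpan [IsFractionRing A K] (h : IsKrull A ord) (Δ : ι → ℚ)
    (𝔞 : Ideal A) (t : ℝ) {c : A} (hc : c ≠ 0) : h.Stable p Δ 𝔞 t (h.stableSpan p Δ 𝔞 t c) := by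
  refine ⟨fun hbot => ?_, fun e' φ' hφ' => ?_⟩
  · have h0 : ceilDivisor p 0 Δ = 0 := by ext i; simp [ceilDivisor]
    have : algebraMap A K c ∈ h.stableSpan p Δ 𝔞 t c :=
      Submodule.subset_span ⟨0, AddMonoidHom.id K, h0 ▸ h.compat_id, 1, by simp, 1, by simp⟩
    rw [hbot, Submodule.mem_bot] at this
    exact hc (IsFractionRing.injective A K (by rw [this, map_zero]))
  · intro z' hz' m hm
    induction hm using Submodule.span_induction generalizing z' with
    | mem x hx =>
      obtain ⟨e, φ, hφ, z, hz, a, rfl⟩ := hx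
      refine Submodule.subset_span ⟨e' + e, φ'.comp φ,
        hφ'.comp hφ (ceilDivisor_add_le Δ e' e), z' ^ p ^ e * z, ?_, a, ?_⟩
      · have h1 := Ideal.mul_mem_mul (Ideal.pow_mem_pow hz' (p ^ e)) hz
        rw [← pow_mul, ← pow_add] at h1
        refine Ideal.pow_le_pow_right ?_ h1
        rw [Nat.ceil_le]
        push_cast
        have h2 := Nat.le_ceil (t * ((p : ℝ) ^ e' - 1))
        have h3 := Nat.le_ceil (t * ((p : ℝ) ^ e - 1))
        have h4 := mul_le_mul_of_nonneg_right h2 (by positivity : (0 : ℝ) ≤ (p : ℝ) ^ e)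
        rw [pow_add]
        linarith
      · rw [AddMonoidHom.comp_apply, ← hφ.linear.map_pow_mul, ← map_pow, ← map_mul]
        congr 3; ring
    | zero => simp
    | add x y _ _ hx hy => rw [mul_add, map_add]; exact add_mem (hx z' hz') (hy z' hz')
    | smul a x _ hx =>
      rw [Algebra.smul_def, ← mul_assoc, ← map_mul]
      exact hx _ (Ideal.mul_mem_right _ _ hz')

end StableSpan

/-! ### The trace formula -/

section Trace

open TestIdeal

variable {p : ℕ} [hp : Fact p.Prime] {A B K L ι κ : Type*} [CommRing A] [CommRing B] [Field K]
  [Field L] [Algebra A B] [Algebra A K] [Algebra B L] [Algebra K L] [Algebra A L]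
  [IsScalarTower A B L] [IsScalarTower A K L] [CharP K p] [CharP L p]
  [IsFractionRing A K] [FiniteDimensional K L] [Algebra.IsSeparable K L]
  {ordK : ι → K → ℤ} {ordL : κ → L → ℤ} {hA : IsKrull A ordK} {hB : IsKrull B ordL}
  {ρ : κ → ι} {r n : κ → ℕ}

theorem IsOrd.filt_algebraMap {oK : K → ℤ} {oL : L → ℤ} (hK : IsOrd oK) (hL : IsOrd oL) {r : ℕ}
    (hr : ∀ k : K, k ≠ 0 → oL (algebraMap K L k) = r * oK k) {m : ℤ} {k : K} (hk : k ∈ hK.filt m) :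
    algebraMap K L k ∈ hL.filt (r * m) := by
  intro h0
  have hk0 : k ≠ 0 := fun h => h0 (by rw [h, map_zero])
  rw [hr k hk0]
  exact mul_le_mul_of_nonneg_left (hk hk0) (Int.natCast_nonneg r)

theorem IsOrd.IsGen.mem_filt {oK : K → ℤ} {hK : IsOrd oK} {φ : K →+ K} {m D : ℤ} {k : K}
    (hφ : hK.IsGen φ m) (h : ∀ f ∈ hK.filt (-D), φ (k * f) ∈ hK.filt 0) : k ∈ hK.filt (m + D) := by
  obtain ⟨w, hw0, hw⟩ := hK.exists_eq (-D)
  have : w * k ∈ hK.filt m := by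
    rw [← hφ]
    intro a ha
    rw [mul_comm w, mul_assoc]
    refine h _ ?_
    rw [hK.mul_mem_iff hw0, hw]
    simpa using ha
  rwa [hK.mul_mem_iff hw0, hw, sub_neg_eq_add] at this

theorem IsOrd.IsGen.map_mem {oK : K → ℤ} {hK : IsOrd oK} {φ : K →+ K} {m : ℤ} {k : K}
    (hφ : hK.IsGen φ m) (h : k ∈ hK.filt m) : φ k ∈ hK.filt 0 := by
  simpa using (hφ k).mpr h 1 hK.one_mem

/-- The extension of a generator to `L` does not depend on the generator up to units. -/
theorem IsOrd.IsGen.of_extend (hKf : (frobenius K p).Finite) {oK : K → ℤ} {oL : L → ℤ}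
    {hK : IsOrd oK} {hL : IsOrd oL} {r : ℕ}
    (hr : ∀ k : K, k ≠ 0 → oL (algebraMap K L k) = r * oK k) {φ φ' : K →+ K} {ψ ψ' : L →+ L}
    {m : ℤ} (hφ : hK.IsGen φ 0) (hφl : IsPInvLinear K p 1 φ) (hψl : IsPInvLinear L p 1 ψ)
    (hφψ : ∀ k, ψ (algebraMap K L k) = algebraMap K L (φ k)) (hφ' : hK.IsGen φ' 0)
    (hφl' : IsPInvLinear K p 1 φ') (hψl' : IsPInvLinear L p 1 ψ')
    (hφψ' : ∀ k, ψ' (algebraMap K L k) = algebraMap K L (φ' k)) (hψ' : hL.IsGen ψ' m) :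
    hL.IsGen ψ m := by
  obtain ⟨c, hc⟩ := hφl.exists_eq_mul hKf hφl' hφ.ne_zero
  have hc0 : c ≠ 0 := by
    rintro rfl
    exact hφ'.ne_zero (by ext x; simp [hc])
  have hiff : ∀ f, f ∈ hK.filt 0 ↔ f ∈ hK.filt (-oK c) := fun f => by
    rw [← hφ' f]
    simp_rw [hc, ← mul_assoc]
    rw [hφ (c * f), hK.mul_mem_iff hc0, zero_sub]
  have hord : oK c = 0 := by
    obtain ⟨w, hw0, hw⟩ := hK.exists_eq (-oK c)
    have h1 := (hiff 1).mp hK.one_mem one_ne_zero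
    have h2 := (hiff w).mpr (fun _ => hw.ge) hw0
    rw [hK.map_one] at h1
    omega
  have hc0' : algebraMap K L c ≠ 0 := by simpa using hc0
  have hψeq : ψ' = ψ.comp (AddMonoidHom.mulLeft (algebraMap K L c)) := by
    refine hψl'.ext_of_algebraMap (K := K) (fun x y => ?_) fun k => ?_
    · change ψ (_ * (x ^ p ^ 1 * y)) = x * ψ (_ * y)
      rw [mul_left_comm, hψl.map_pow_mul]
    · change _ = ψ (_ * _)
      rw [← _root_.map_mul, hφψ, hφψ', hc]
  intro f
  have h1 := hψ' ((algebraMap K L c)⁻¹ * f)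
  rw [hL.mul_mem_iff (inv_ne_zero hc0'), hL.map_inv hc0', hr c hc0, hord] at h1
  simp only [mul_zero, neg_zero, sub_zero] at h1
  rw [← h1, hψeq]
  simp only [AddMonoidHom.comp_apply, AddMonoidHom.coe_mulLeft, mul_assoc,
    mul_inv_cancel_left₀ hc0']

/-- The extension to `L` of a map compatible with `Δ` is compatible with `π^* Δ - Ram`. -/
theorem IsKrull.Compat.extend (hKf : (frobenius K p).Finite)
    (hr : ∀ j, ∀ k : K, k ≠ 0 → ordL j (algebraMap K L k) = r j * ordK (ρ j) k)
    (hgen : ∀ j, ∃ (φ : K →+ K) (ψ : L →+ L), IsPInvLinear K p 1 φ ∧ IsPInvLinear L p 1 ψ ∧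
      (∀ k, ψ (algebraMap K L k) = algebraMap K L (φ k)) ∧ (hA.isOrd (ρ j)).IsGen φ 0 ∧
      (hB.isOrd j).IsGen ψ ((p - 1) * n j))
    {Δ : ι → ℚ} {e : ℕ} {φ : K →+ K} {φL : L →+ L} (hφ : hA.Compat p e (ceilDivisor p e Δ) φ)
    (hφL : IsPInvLinear L p e φL) (hφφL : ∀ k, φL (algebraMap K L k) = algebraMap K L (φ k)) :
    hB.Compat p e (ceilDivisor p e fun j => Δ (ρ j) * r j - n j) φL := by
  refine ⟨hφL, fun j f hf => ?_⟩
  obtain ⟨φ₀, ψ₀, hφ₀, hψ₀, hφψ, hφg, hψg⟩ := hgen j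
  have hφg' : (hA.isOrd (ρ j)).IsGen φ₀ ((p - 1) * 0) := by rwa [mul_zero]
  have hφge := hφg'.iterMap hφ₀ e
  have hψge := hψg.iterMap hψ₀ e
  obtain ⟨c, hc⟩ := (isPInvLinear_iterMap hφ₀ e).exists_eq_mul hKf hφ.linear hφge.ne_zero
  have hcD : c ∈ (hA.isOrd (ρ j)).filt (ceilDivisor p e Δ (ρ j)) := by
    have := hφge.mem_filt (D := ceilDivisor p e Δ (ρ j)) (k := c)
      fun f hf => by rw [← hc]; exact hφ.map_mem _ f hf
    simpa using this
  have heq : φL = (iterMap ψ₀ e).comp (AddMonoidHom.mulLeft (algebraMap K L c)) := by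
    refine hφL.ext_of_algebraMap (K := K) (fun x y => ?_) fun k => ?_
    · change iterMap ψ₀ e (_ * (x ^ p ^ e * y)) = x * iterMap ψ₀ e (_ * y)
      rw [mul_left_comm, (isPInvLinear_iterMap hψ₀ e).map_pow_mul]
    · change _ = iterMap ψ₀ e (_ * _)
      rw [← map_mul, iterMap_algebraMap hφψ, hφφL, hc]
  rw [heq]
  refine hψge.map_mem ?_
  have h1 := IsOrd.filt_algebraMap (hA.isOrd (ρ j)) (hB.isOrd j) (hr j) hcD
  refine (hB.isOrd j).filt_mono ?_ ((hB.isOrd j).mul_mem h1 hf)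
  have hle : ceilDivisor p e (fun j => Δ (ρ j) * r j - n j) j ≤
      r j * ceilDivisor p e Δ (ρ j) - ((p : ℤ) ^ e - 1) * n j := by
    unfold ceilDivisor
    rw [Int.ceil_le]
    push_cast
    have := mul_le_mul_of_nonneg_left (Int.le_ceil (((p : ℚ) ^ e - 1) * Δ (ρ j)))
      (by positivity : (0 : ℚ) ≤ r j)
    linarith
  linarith

theorem IsKrull.trace_mem_filt [IsIntegrallyClosed A] [Algebra.IsIntegral A B]
    (hr : ∀ j, ∀ k : K, k ≠ 0 → ordL j (algebraMap K L k) = r j * ordK (ρ j) k)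
    (hr0 : ∀ j, 0 < r j) {i : ι} {x : L}
    (hx : ∀ j, ρ j = i → x ∈ (hB.isOrd j).filt 0) : Algebra.trace K L x ∈ (hA.isOrd i).filt 0 := by
  classical
  rcases eq_or_ne x 0 with rfl | hx0
  · simp
  let S := (hB.finite x hx0).toFinset
  obtain ⟨s, hs0, hsi, hs⟩ := hA.exists_forall_le_ord_of_ne i (S.image ρ)
    (∑ j ∈ S, (ordL j x).natAbs)
  have hsL : algebraMap K L (algebraMap A K s) ≠ 0 := by simpa using hs0
  obtain ⟨b, hb⟩ : algebraMap K L (algebraMap A K s) * x ∈ (algebraMap B L).range := by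
    rw [hB.mem_range_iff]
    intro j
    by_cases hj : ρ j = i
    · refine (hB.isOrd j).mul_mem_zero ?_ (hx j hj)
      simpa using IsOrd.filt_algebraMap (hA.isOrd (ρ j)) (hB.isOrd j) (hr j)
        (hA.algebraMap_mem s (ρ j))
    rw [(hB.isOrd j).mul_mem_iff hsL, (hB.isOrd j).mem_filt_of_ne hx0, hr j _ hs0]
    have hsn := hA.ord_algebraMap_nonneg hs0 (ρ j)
    have hr1 : (1 : ℤ) ≤ r j := by exact_mod_cast hr0 j
    have h4 := le_mul_of_one_le_left hsn hr1
    by_cases hjS : j ∈ S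
    · have h2 := hs (ρ j) (Finset.mem_image_of_mem _ hjS) hj
      have h3 := Finset.single_le_sum (f := fun j => (ordL j x).natAbs)
        (fun _ _ => Nat.zero_le _) hjS
      have h3' : (((ordL j x).natAbs : ℕ) : ℤ) ≤ ((∑ j ∈ S, (ordL j x).natAbs : ℕ) : ℤ) := by
        exact_mod_cast h3
      omega
    · have h2 : ordL j x = 0 := by simpa [S] using hjS
      omega
  have hint : IsIntegral A (algebraMap K L (algebraMap A K s) * x) := by
    rw [← hb]
    exact (Algebra.IsIntegral.isIntegral (R := A) b).algebraMap
  obtain ⟨a, ha⟩ := IsIntegrallyClosed.isIntegral_iff.mp (Algebra.isIntegral_trace (L := K) hint)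
  rw [← Algebra.smul_def, map_smul, smul_eq_mul] at ha
  have := hA.algebraMap_mem a i
  rwa [ha, (hA.isOrd i).mul_mem_iff hs0, hsi, sub_zero] at this

/-- Traces of maps compatible with `π^* Δ - Ram` are compatible with `Δ`, up to a multiplier that
vanishes along the support of `Δ`. -/
theorem IsKrull.Compat.trace [IsIntegrallyClosed A] [Algebra.IsIntegral A B]
    (hKf : (frobenius K p).Finite) (hLf : (frobenius L p).Finite)
    (hr : ∀ j, ∀ k : K, k ≠ 0 → ordL j (algebraMap K L k) = r j * ordK (ρ j) k)
    (hr0 : ∀ j, 0 < r j)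
    (hgenK : ∀ i, ∃ φ : K →+ K, IsPInvLinear K p 1 φ ∧ (hA.isOrd i).IsGen φ 0)
    (hgen : ∀ j, ∃ (φ : K →+ K) (ψ : L →+ L), IsPInvLinear K p 1 φ ∧ IsPInvLinear L p 1 ψ ∧
      (∀ k, ψ (algebraMap K L k) = algebraMap K L (φ k)) ∧ (hA.isOrd (ρ j)).IsGen φ 0 ∧
      (hB.isOrd j).IsGen ψ ((p - 1) * n j))
    {Δ : ι → ℚ} {c : K} (hc : ∀ i, c ∈ (hA.isOrd i).filt 0)
    (hcΔ : ∀ i, Δ i ≠ 0 → c ∈ (hA.isOrd i).filt 1) (b : B) {e : ℕ} {φ : L →+ L}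
    (hφ : hB.Compat p e (ceilDivisor p e fun j => Δ (ρ j) * r j - n j) φ) {ψ : K →+ K}
    (hψ : ∀ k, ψ k =
      Algebra.trace K L (φ (algebraMap K L c * algebraMap B L b * algebraMap K L k))) :
    hA.Compat p e (ceilDivisor p e Δ) ψ := by
  refine ⟨fun x y => ?_, fun i f hf => ?_⟩
  · rw [hψ, hψ, smul_eq_mul, smul_eq_mul, map_mul (algebraMap K L), map_pow, mul_left_comm, 
      hφ.linear.map_pow_mul, ← Algebra.smul_def, map_smul, smul_eq_mul]
  obtain ⟨φ₀, hφ₀, hφg⟩ := hgenK i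
  obtain ⟨ψ₀, hψ₀, hφψ, htr⟩ := hφ₀.exists_extend L
  have hψg : ∀ j, ρ j = i → (hB.isOrd j).IsGen ψ₀ ((p - 1) * n j) := by
    rintro j rfl
    obtain ⟨φ', ψ', hφ', hψ', hφψ', hφg', hψg'⟩ := hgen j
    exact hφg.of_extend hKf (hr j) hφ₀ hψ₀ hφψ hφg' hφ' hψ' hφψ' hψg'
  have htre : ∀ (m : ℕ) z, Algebra.trace K L (iterMap ψ₀ m z) =
      iterMap φ₀ m (Algebra.trace K L z) := by
    intro m
    induction m with
    | zero => intro z; rfl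
    | succ m ih => intro z; exact (ih (ψ₀ z)).trans (congrArg _ (htr z))
  have hφg' : (hA.isOrd i).IsGen φ₀ ((p - 1) * 0) := by rwa [mul_zero]
  have hφge := hφg'.iterMap hφ₀ e
  have hne : iterMap ψ₀ e ≠ 0 := by
    intro h0
    apply hφge.ne_zero
    ext k
    apply (algebraMap K L).injective
    rw [← iterMap_algebraMap hφψ, h0]; simp
  obtain ⟨h, hh⟩ := (isPInvLinear_iterMap hψ₀ e).exists_eq_mul hLf hφ.linear hne
  rw [hψ, hh, htre]
  refine hφge.map_mem ?_
  rw [mul_zero]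
  refine IsKrull.trace_mem_filt (hA := hA) (hB := hB) hr hr0 fun j hj => ?_
  subst hj
  have h1 : h ∈ (hB.isOrd j).filt (⌈((p : ℚ) ^ e - 1) * (Δ (ρ j) * r j)⌉) := by
    have := ((hψg j rfl).iterMap hψ₀ e).mem_filt (k := h)
      (D := ceilDivisor p e (fun j => Δ (ρ j) * r j - n j) j)
      fun f hf => by rw [← hh]; exact hφ.map_mem _ f hf
    refine (hB.isOrd j).filt_mono ?_ this
    unfold ceilDivisor
    rw [Int.ceil_le]
    push_cast
    have := Int.le_ceil (((p : ℚ) ^ e - 1) * (Δ (ρ j) * r j - n j))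
    linarith
  have hf' := IsOrd.filt_algebraMap (hA.isOrd (ρ j)) (hB.isOrd j) (hr j) hf
  by_cases hΔ : Δ (ρ j) = 0
  · have hc' := IsOrd.filt_algebraMap (hA.isOrd (ρ j)) (hB.isOrd j) (hr j) (hc (ρ j))
    refine (hB.isOrd j).filt_mono ?_ ((hB.isOrd j).mul_mem h1 ((hB.isOrd j).mul_mem
      ((hB.isOrd j).mul_mem hc' (hB.algebraMap_mem b j)) hf'))
    simp [ceilDivisor, hΔ]
  · have hc' := IsOrd.filt_algebraMap (hA.isOrd (ρ j)) (hB.isOrd j) (hr j) (hcΔ (ρ j) hΔ)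
    refine (hB.isOrd j).filt_mono ?_ ((hB.isOrd j).mul_mem h1 ((hB.isOrd j).mul_mem
      ((hB.isOrd j).mul_mem hc' (hB.algebraMap_mem b j)) hf'))
    have h2 : r j * ceilDivisor p e Δ (ρ j) ≤
        ⌈((p : ℚ) ^ e - 1) * (Δ (ρ j) * r j)⌉ + r j := by
      unfold ceilDivisor
      have h3 := Int.le_ceil (((p : ℚ) ^ e - 1) * (Δ (ρ j) * r j))
      have h4 := (Int.ceil_lt_add_one (((p : ℚ) ^ e - 1) * Δ (ρ j))).le
      have h5 := mul_le_mul_of_nonneg_left h4 (by positivity : (0 : ℚ) ≤ r j)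
      have : (r j : ℚ) * ⌈((p : ℚ) ^ e - 1) * Δ (ρ j)⌉ ≤
          ⌈((p : ℚ) ^ e - 1) * (Δ (ρ j) * r j)⌉ + r j := by linarith
      exact_mod_cast this
    linarith

/-- The trace maps the smallest stable fractional ideal of `(π^* Δ - Ram, (𝔞 B) ^ t)` onto the
smallest stable fractional ideal of `(Δ, 𝔞 ^ t)`. -/
theorem IsKrull.trace_image_eq [IsDomain A] [IsIntegrallyClosed A] [Algebra.IsIntegral A B]
    [IsFractionRing B L] [IsDomain B] [IsIntegrallyClosed B]
    (hKf : (frobenius K p).Finite) (hLf : (frobenius L p).Finite)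
    (hr : ∀ j, ∀ k : K, k ≠ 0 → ordL j (algebraMap K L k) = r j * ordK (ρ j) k)
    (hr0 : ∀ j, 0 < r j)
    (hgenK : ∀ i, ∃ φ : K →+ K, IsPInvLinear K p 1 φ ∧ (hA.isOrd i).IsGen φ 0)
    (hgen : ∀ j, ∃ (φ : K →+ K) (ψ : L →+ L), IsPInvLinear K p 1 φ ∧ IsPInvLinear L p 1 ψ ∧
      (∀ k, ψ (algebraMap K L k) = algebraMap K L (φ k)) ∧ (hA.isOrd (ρ j)).IsGen φ 0 ∧
      (hB.isOrd j).IsGen ψ ((p - 1) * n j))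
    {Δ : ι → ℚ} (hΔ : {i | Δ i ≠ 0}.Finite) {𝔞 : Ideal A} {t : ℝ}
    {M : Submodule A K} (hM : IsLeast {M | hA.Stable p Δ 𝔞 t M} M) {N : Submodule B L}
    (hN : IsLeast {N | hB.Stable p (fun j => Δ (ρ j) * r j - n j) (𝔞.map (algebraMap A B)) t N} N) :
    Algebra.trace K L '' N = M := by
  let T : L →ₗ[A] K := (Algebra.trace K L).restrictScalars A
  have hinj : Function.Injective (algebraMap A K) := IsFractionRing.injective A K
  have hAL : ∀ (a : A) (x : L), algebraMap B L (algebraMap A B a) * x = a • x := fun a x => by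
    rw [← IsScalarTower.algebraMap_apply, Algebra.smul_def]
  have hAKL : ∀ a : A, algebraMap K L (algebraMap A K a) = algebraMap B L (algebraMap A B a) :=
    fun a => by rw [← IsScalarTower.algebraMap_apply, ← IsScalarTower.algebraMap_apply]
  apply subset_antisymm
  · obtain ⟨c₂, hc₂0, hc₂⟩ := Submodule.exists_algebraMap_mem hM.1.ne_bot
    obtain ⟨c₁, hc₁0, hc₁⟩ := hA.exists_forall_le_ord hΔ.toFinset 1
    have hc₁0' : c₁ ≠ 0 := fun h0 => hc₁0 (by rw [h0, map_zero])
    have hBinj : Function.Injective (algebraMap A B) := by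
      intro x y hxy
      apply hinj
      apply (algebraMap K L).injective
      rw [hAKL, hAKL, hxy]
    have hc0 : algebraMap A B (c₁ * c₂) ≠ 0 := fun h0 =>
      mul_ne_zero hc₁0' hc₂0 (hBinj (by rw [h0, map_zero]))
    have hle := hN.2 (hB.stable_stableSpan _ _ t hc0)
    suffices hmem : ∀ x ∈ hB.stableSpan p (fun j => Δ (ρ j) * r j - n j)
        (𝔞.map (algebraMap A B)) t (algebraMap A B (c₁ * c₂)),
        ∀ b : B, Algebra.trace K L (algebraMap B L b * x) ∈ M by
      rintro _ ⟨x, hx, rfl⟩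
      simpa using hmem x (hle hx) 1
    intro x hx
    induction hx using Submodule.span_induction with
    | zero => intro b; simp
    | add x y _ _ hx hy => intro b; rw [mul_add, map_add]; exact add_mem (hx b) (hy b)
    | smul b' x _ hx => intro b; rw [Algebra.smul_def, ← mul_assoc, ← map_mul]; exact hx _
    | mem x hx =>
      obtain ⟨e, φ, hφ, z, hz, a, rfl⟩ := hx
      intro b
      rw [← hφ.linear.map_pow_mul, ← map_pow, ← map_mul]
      suffices ∀ z ∈ (𝔞.map (algebraMap A B)) ^ ⌈t * ((p : ℝ) ^ e - 1)⌉₊, ∀ b : B,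
          Algebra.trace K L (φ (algebraMap B L (z * algebraMap A B (c₁ * c₂) * b))) ∈ M by
        convert this z hz (b ^ p ^ e * a) using 4
        ring
      clear hz z
      intro z hz
      rw [← Ideal.map_pow] at hz
      induction hz using Submodule.span_induction with
      | zero => intro b; simp
      | add x y _ _ hx hy =>
        intro b
        rw [add_mul, add_mul, map_add, map_add, map_add]; exact add_mem (hx b) (hy b)
      | smul b' x _ hx =>
        intro b
        have := hx (b' * b)
        convert this using 4
        rw [smul_eq_mul]; ring
      | mem z hz =>
        obtain ⟨z, hz, rfl⟩ := hz
        intro b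
        let ψ : K →+ K := (Algebra.trace K L).toAddMonoidHom.comp (φ.comp ((AddMonoidHom.mulLeft
          (algebraMap K L (algebraMap A K c₁) * algebraMap B L b)).comp
            (algebraMap K L).toAddMonoidHom))
        have hψ : hA.Compat p e (ceilDivisor p e Δ) ψ :=
          IsKrull.Compat.trace hKf hLf hr hr0 hgenK hgen (fun i => hA.algebraMap_mem c₁ i)
            (fun i hi _ => by simpa using hc₁ i (by simpa using hi)) b hφ (fun k => rfl)
        have := hM.1.map_mem e ψ hψ z hz _ hc₂
        convert this using 1
        change _ = Algebra.trace K L (φ (_ * algebraMap K L _))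
        rw [← map_mul (algebraMap A K), hAKL, hAKL, ← map_mul, ← map_mul]
        congr 3
        simp only [map_mul]
        ring
  · have hstab : hA.Stable p Δ 𝔞 t ((N.restrictScalars A).map T) := by
      refine ⟨fun hbot => ?_, ?_⟩
      · obtain ⟨m, hm, hm0⟩ := Submodule.exists_mem_ne_zero_of_ne_bot hN.1.ne_bot
        apply hm0
        apply (traceForm_nondegenerate K L).1 m
        intro y
        have halg : IsAlgebraic A y :=
          (IsFractionRing.isAlgebraic_iff A K L).mpr (Algebra.IsAlgebraic.isAlgebraic y)
        obtain ⟨a, ha0, ha⟩ := halg.exists_integral_multiple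
        obtain ⟨b, hb⟩ := IsIntegrallyClosed.isIntegral_iff.mp (ha.tower_top (A := B))
        have h1 : T (b • m) ∈ (N.restrictScalars A).map T := ⟨_, N.smul_mem b hm, rfl⟩
        rw [hbot, Submodule.mem_bot, Algebra.smul_def, hb, smul_mul_assoc, map_smul, mul_comm,
          Algebra.smul_def] at h1
        refine (mul_eq_zero.mp h1).resolve_left fun h0 => ha0 (hinj ?_)
        rw [h0, map_zero]
      · rintro e φ hφ z hz _ ⟨m, hm, rfl⟩
        obtain ⟨φL, hφL, hφφL, htr⟩ := hφ.linear.exists_extend L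
        have hcomp := hφ.extend hKf hr hgen (hB := hB) hφL hφφL
        refine ⟨φL (algebraMap B L (algebraMap A B z) * m), hN.1.map_mem e φL hcomp _ ?_ m hm, ?_⟩
        · rw [← Ideal.map_pow]; exact Ideal.mem_map_of_mem _ hz
        · rw [hAL]
          change Algebra.trace K L (φL (z • m)) = φ (_ * T m)
          rw [htr, ← Algebra.smul_def, ← map_smul]
          rfl
    exact hM.2 hstab

end Trace

/-! ### Big test ideals as smallest stable fractional ideals -/

section Extend

open TestIdeal

variable {p : ℕ} [hp : Fact p.Prime] {A K : Type*} [CommRing A] [IsDomain A] [Field K] [Algebra A K]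
  [IsFractionRing A K]

theorem TestIdeal.IsPInvLinear.exists_extend_fractionRing {e : ℕ} {φ : A →+ A}
    (hφ : IsPInvLinear A p e φ) : ∃ φK : K →+ K, IsPInvLinear K p e φK ∧
      ∀ a, φK (algebraMap A K a) = algebraMap A K (φ a) := by
  have hinj : Function.Injective (algebraMap A K) := IsFractionRing.injective A K
  have hq : p ^ e ≠ 0 := pow_ne_zero _ hp.out.ne_zero
  have hφ' : ∀ r x, φ (r ^ p ^ e * x) = r * φ x := hφ
  have hex : ∀ x : K, ∃ s a : A, s ≠ 0 ∧ algebraMap A K s ^ p ^ e * x = algebraMap A K a := by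
    intro x
    obtain ⟨a, s, hs, rfl⟩ := IsFractionRing.div_surjective (A := A) x
    have hs0 : algebraMap A K s ≠ 0 := by
      simpa using nonZeroDivisors.ne_zero hs
    refine ⟨s, s ^ (p ^ e - 1) * a, nonZeroDivisors.ne_zero hs, ?_⟩
    rw [map_mul, map_pow, ← mul_pow_sub_one hq (algebraMap A K s)]
    field_simp
  choose s a hs hsa using hex
  have hsK : ∀ x, algebraMap A K (s x) ≠ 0 := fun x => by simpa using hs x
  let F : K → K := fun x => algebraMap A K (φ (a x)) / algebraMap A K (s x)
  have hF : ∀ (x : K) (s' a' : A), s' ≠ 0 → algebraMap A K s' ^ p ^ e * x = algebraMap A K a' →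
      algebraMap A K s' * F x = algebraMap A K (φ a') := by
    intro x s' a' hs' hsa'
    have h1 : s' ^ p ^ e * a x = s x ^ p ^ e * a' := by
      apply hinj
      rw [map_mul, map_mul, map_pow, map_pow, ← hsa, ← hsa']
      ring
    have h2 : s' * φ (a x) = s x * φ a' := by rw [← hφ', ← hφ', h1]
    have h3 := congrArg (algebraMap A K) h2
    rw [map_mul, map_mul] at h3
    have := hsK x
    change algebraMap A K s' * (algebraMap A K (φ (a x)) / algebraMap A K (s x)) = _
    rw [← mul_div_assoc, h3, mul_div_cancel_left₀ _ this]
  have hadd : ∀ x y, F (x + y) = F x + F y := by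
    intro x y
    have hxy : s x * s y ≠ 0 := mul_ne_zero (hs x) (hs y)
    have h0 : algebraMap A K (s x * s y) ≠ 0 := by simpa using hxy
    apply mul_left_cancel₀ h0
    have e1 : algebraMap A K (s x * s y) ^ p ^ e * x = algebraMap A K (s y ^ p ^ e * a x) := by
      rw [map_mul, map_mul, mul_pow, mul_right_comm, hsa, map_pow, mul_comm]
    have e2 : algebraMap A K (s x * s y) ^ p ^ e * y = algebraMap A K (s x ^ p ^ e * a y) := by
      rw [map_mul, map_mul, mul_pow, mul_assoc, hsa, map_pow]
    rw [mul_add, hF x _ _ hxy e1, hF y _ _ hxy e2, hF (x + y) _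
      (s y ^ p ^ e * a x + s x ^ p ^ e * a y) hxy (by rw [mul_add, e1, e2, map_add]), map_add,
      map_add]
  have hzero : F 0 = 0 := by simpa using hadd 0 0
  refine ⟨⟨⟨F, hzero⟩, hadd⟩, fun r x => ?_, fun b => ?_⟩
  · change F (r ^ p ^ e * x) = r * F x
    obtain ⟨c, d, hd, rfl⟩ := IsFractionRing.div_surjective (A := A) r
    have hd0 : d ≠ 0 := nonZeroDivisors.ne_zero hd
    have hdK : algebraMap A K d ≠ 0 := by simpa using hd0
    have h0 : algebraMap A K (d * s x) ≠ 0 := by simpa using ⟨hd0, hs x⟩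
    apply mul_left_cancel₀ h0
    rw [hF _ (d * s x) (c ^ p ^ e * a x) (mul_ne_zero hd0 (hs x)), hφ', map_mul, map_mul,
      ← hF x _ _ (hs x) (hsa x)]
    · field_simp
    · rw [map_mul, map_mul, map_pow, ← hsa, div_pow, mul_pow]
      field_simp
  · have := hF (algebraMap A K b) 1 b one_ne_zero (by simp)
    simpa using this

end Extend

namespace TestIdeal

section Affine

variable {X : Scheme.{u}} [IsIntegral X] [IsLocallyNoetherian X] [IsNormalScheme X]
  (U : X.Opens) [Nonempty U]

/-- The prime divisors of `U`. -/
abbrev DivisorOn (U : X.Opens) : Type u := {x : PrimeDivisor X // x.1 ∈ U}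

/-- The valuations of the function field given by the prime divisors of `U`. -/
noncomputable def ordOn (x : DivisorOn U) (f : X.functionField) : ℤ := Scheme.ord f x.1.1

variable {U}

theorem mem_divisorSections_iff (h : IsKrull Γ(X, U) (ordOn U)) {D : PrimeDivisor X → ℤ}
    {f : X.functionField} :
    f ∈ divisorSections U D ↔ ∀ i : DivisorOn U, f ∈ (h.isOrd i).filt (-D i.1) := by
  constructor
  · intro hf i h0
    have := hf h0 i.1 i.2
    change -D i.1 ≤ Scheme.ord f i.1.1
    omega
  · intro hf h0 x hx
    have : -D x ≤ Scheme.ord f x.1 := hf ⟨x, hx⟩ h0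
    omega

variable {p : ℕ} [hp : Fact p.Prime] [hfr : IsFractionRing Γ(X, U) X.functionField]

theorem IsCompatibleMap.exists_compat (h : IsKrull Γ(X, U) (ordOn U)) {e : ℕ}
    {Δ : PrimeDivisor X → ℚ} (hΔ : {i : DivisorOn U | Δ i.1 ≠ 0}.Finite)
    {φ : Γ(X, U) →+ Γ(X, U)} (hφ : IsCompatibleMap U p e Δ φ) :
    ∃ φK, h.Compat p e (ceilDivisor p e fun i => Δ i.1) φK ∧
      ∀ a, φK (algebraMap Γ(X, U) X.functionField a) =
        algebraMap Γ(X, U) X.functionField (φ a) := by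
  obtain ⟨hφl, ψ, hψl, hψφ⟩ := hφ
  obtain ⟨φK, hφKl, hφK⟩ := hφl.exists_extend_fractionRing (K := X.functionField)
  refine ⟨φK, IsKrull.Compat.of_sections (finite_ceilDivisor_ne_zero hΔ e) hφKl ?_, hφK⟩
  intro f hf
  have hf' : f ∈ divisorSections U (ceilMul p e Δ) := (mem_divisorSections_iff h).mpr hf
  obtain ⟨a, s, hs, hfas⟩ := IsFractionRing.div_surjective (A := Γ(X, U)) f
  have hs0 : algebraMap Γ(X, U) X.functionField s ≠ 0 := by
    simpa using nonZeroDivisors.ne_zero hs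
  have hq : p ^ e ≠ 0 := pow_ne_zero _ hp.out.ne_zero
  have hsa : s ^ p ^ e • f = algebraMap Γ(X, U) X.functionField (s ^ (p ^ e - 1) * a) := by
    rw [Algebra.smul_def, map_mul, map_pow, map_pow, ← hfas,
      ← mul_pow_sub_one hq (algebraMap Γ(X, U) X.functionField s)]
    field_simp
  have hmem := (divisorSections U (ceilMul p e Δ)).smul_mem (s ^ p ^ e) hf'
  have h1 : ψ (s ^ p ^ e • ⟨f, hf'⟩) = φ (s ^ (p ^ e - 1) * a) := by
    rw [← hψφ _ (hsa ▸ hmem)]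
    congr 1
    exact Subtype.ext hsa
  rw [hψl] at h1
  refine ⟨ψ ⟨f, hf'⟩, ?_⟩
  apply mul_left_cancel₀ hs0
  rw [← map_mul, ← smul_eq_mul, h1, ← hφK, ← hsa, Algebra.smul_def, map_pow, hφKl.map_pow_mul]

theorem isCompatibleMap_of_compat (h : IsKrull Γ(X, U) (ordOn U)) {e : ℕ}
    {Δ : PrimeDivisor X → ℚ} (hΔ0 : EffectiveOn U Δ) {φK : X.functionField →+ X.functionField}
    (hφK : h.Compat p e (ceilDivisor p e fun i => Δ i.1) φK) :
    ∃ φ, IsCompatibleMap U p e Δ φ ∧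
      ∀ a, φK (algebraMap Γ(X, U) X.functionField a) =
        algebraMap Γ(X, U) X.functionField (φ a) := by
  have hinj : Function.Injective (algebraMap Γ(X, U) X.functionField) :=
    IsFractionRing.injective _ _
  have hex : ∀ f : divisorSections U (ceilMul p e Δ), ∃ a,
      algebraMap Γ(X, U) X.functionField a = φK f := fun f =>
    hφK.map_sections ((mem_divisorSections_iff h).mp f.2)
  choose F hF using hex
  have hA : ∀ a, algebraMap Γ(X, U) X.functionField a ∈ divisorSections U (ceilMul p e Δ) := by
    intro a
    rw [mem_divisorSections_iff h]
    intro i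
    refine (h.isOrd i).filt_mono ?_ (h.algebraMap_mem a i)
    have h1 : (0 : ℚ) ≤ (p : ℚ) ^ e - 1 :=
      sub_nonneg.mpr (one_le_pow₀ (by exact_mod_cast hp.out.one_le))
    exact neg_nonpos.mpr (Int.ceil_nonneg (mul_nonneg h1 (hΔ0 i.1 i.2)))
  let ψ : divisorSections U (ceilMul p e Δ) →+ Γ(X, U) :=
    { toFun := F
      map_zero' := hinj (by rw [hF]; simp)
      map_add' := fun x y => hinj (by rw [map_add, hF, hF, hF]; simp) }
  have hψ : ∀ f, algebraMap Γ(X, U) X.functionField (ψ f) = φK f := hF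
  have hψl : IsPInvLinear Γ(X, U) p e ψ := fun r x => hinj (by
    rw [hψ, smul_eq_mul, map_mul, hψ, ← hφK.linear.map_pow_mul, ← map_pow, ← Algebra.smul_def]
    rfl)
  let φ : Γ(X, U) →+ Γ(X, U) :=
    { toFun := fun a => ψ ⟨_, hA a⟩
      map_zero' := hinj (by rw [hψ]; simp)
      map_add' := fun x y => hinj (by
        rw [map_add (algebraMap _ X.functionField) (ψ _), hψ, hψ, hψ]; simp) }
  have hφ : ∀ a, φK (algebraMap Γ(X, U) X.functionField a) =
      algebraMap Γ(X, U) X.functionField (φ a) := fun a => (hψ ⟨_, hA a⟩).symm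
  refine ⟨φ, ⟨fun r x => hinj ?_, ψ, hψl, fun r hr => rfl⟩, hφ⟩
  rw [← hφ, smul_eq_mul, map_mul, map_pow, hφK.linear.map_pow_mul, hφ, smul_eq_mul, map_mul]

theorem isBigTestIdeal_of_isLeast (h : IsKrull Γ(X, U) (ordOn U)) {Δ : PrimeDivisor X → ℚ}
    (hΔ : {i : DivisorOn U | Δ i.1 ≠ 0}.Finite) {𝔞 : Ideal Γ(X, U)} {t : ℝ}
    {M : Submodule Γ(X, U) X.functionField}
    (hM : IsLeast {M | h.Stable p (fun i => Δ i.1) 𝔞 t M} M) : IsBigTestIdeal U p Δ 𝔞 t M := by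
  have hinj : Function.Injective (algebraMap Γ(X, U) X.functionField) :=
    IsFractionRing.injective _ _
  refine ⟨?_, fun f hf hΔf => ?_⟩
  · obtain ⟨a, ha0, ha⟩ := h.exists_forall_abs_le_ord (D := fun i => ⌈-Δ i.1⌉)
      (hΔ.subset fun i hi h0 => hi (by simp [h0]))
    refine ⟨a, fun h0 => ha0 (by rw [h0, map_zero]), fun x hx => ?_⟩
    have h1 : ⌈-Δ x⌉ ≤ Scheme.ord (algebraMap Γ(X, U) X.functionField a) x.1 :=
      (le_abs_self _).trans (ha ⟨x, hx⟩)
    rw [Int.ceil_le] at h1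
    unfold addDiv
    linarith
  set fK := algebraMap Γ(X, U) X.functionField f with hfK
  have hfK0 : fK ≠ 0 := by simpa [hfK] using hf
  have hq : ∀ e, p ^ e ≠ 0 := fun e => pow_ne_zero _ hp.out.ne_zero
  have hceil : ∀ e (i : DivisorOn U), ceilDivisor p e (fun i => addDiv Δ fK i.1) i =
      ceilDivisor p e (fun i => Δ i.1) i + ((p ^ e - 1 : ℕ) : ℤ) * ordOn U i fK := by
    intro e i
    have : (((p ^ e - 1 : ℕ) : ℤ) : ℚ) = (p : ℚ) ^ e - 1 := by
      rw [Nat.cast_sub (Nat.one_le_iff_ne_zero.mpr (hq e))]; push_cast; ring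
    unfold ceilDivisor addDiv
    rw [← Int.ceil_add_intCast]
    push_cast
    rw [← this]
    congr 1
    push_cast
    change _ * (_ + ((ordOn U i fK : ℤ) : ℚ)) = _
    ring
  have hΔ' : {i : DivisorOn U | addDiv Δ fK i.1 ≠ 0}.Finite :=
    (hΔ.union (h.finite fK hfK0)).subset fun i hi => by
      by_contra hcon
      simp only [Set.mem_union, Set.mem_ofPred_eq, not_or, not_not] at hcon
      apply hi
      have h2 : Scheme.ord fK i.1.1 = 0 := hcon.2
      simp [addDiv, hcon.1, h2]
  -- passing between maps compatible with `Δ` and maps compatible with `Δ + div f`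
  have htwist : ∀ e φ, h.Compat p e (ceilDivisor p e fun i => Δ i.1) φ →
      h.Compat p e (ceilDivisor p e fun i => addDiv Δ fK i.1)
        (φ.comp (AddMonoidHom.mulLeft (fK ^ (p ^ e - 1)))) := fun e φ hφ =>
    hφ.mul (pow_ne_zero _ hfK0) fun i => by rw [hceil, (h.isOrd i).map_pow hfK0]
  have huntwist : ∀ e φ, h.Compat p e (ceilDivisor p e fun i => addDiv Δ fK i.1) φ →
      h.Compat p e (ceilDivisor p e fun i => Δ i.1)
        (φ.comp (AddMonoidHom.mulLeft (fK⁻¹ ^ (p ^ e - 1)))) := fun e φ hφ =>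
    hφ.mul (pow_ne_zero _ (inv_ne_zero hfK0)) fun i => by
      rw [hceil, (h.isOrd i).map_pow (inv_ne_zero hfK0), (h.isOrd i).map_inv hfK0]
      linarith
  -- ideals that are stable for `Δ + div f` give fractional ideals that are stable for `Δ`
  have hdown : ∀ J ∈ stableIdeals U p (addDiv Δ fK) 𝔞 t, ∀ y ∈ M, ∃ x ∈ J,
      fK * y = algebraMap Γ(X, U) X.functionField x := by
    rintro J ⟨hJ0, hJ⟩
    let M' : Submodule Γ(X, U) X.functionField := (Submodule.map (Algebra.linearMap _ _) J).comap
      (LinearMap.mulLeft Γ(X, U) fK)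
    have hM' : ∀ y, y ∈ M' ↔ ∃ x ∈ J, algebraMap Γ(X, U) X.functionField x = fK * y :=
      fun y => Iff.rfl
    have hst : h.Stable p (fun i => Δ i.1) 𝔞 t M' := by
      refine ⟨fun hbot => ?_, fun e φ hφ z hz m hm => ?_⟩
      · obtain ⟨x, hx, hx0⟩ := Submodule.exists_mem_ne_zero_of_ne_bot hJ0
        have : fK⁻¹ * algebraMap Γ(X, U) X.functionField x ∈ M' := by
          rw [hM']; exact ⟨x, hx, by rw [mul_inv_cancel_left₀ hfK0]⟩
        rw [hbot, Submodule.mem_bot] at this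
        rcases mul_eq_zero.mp this with h0 | h0
        · exact inv_ne_zero hfK0 h0
        · exact hx0 (hinj (by rw [h0, map_zero]))
      · rw [hM'] at hm ⊢
        obtain ⟨x, hx, hxm⟩ := hm
        obtain ⟨φA, hφA, hφφA⟩ := isCompatibleMap_of_compat h hΔf (htwist e φ hφ)
        refine ⟨φA (z * x), hJ e φA hφA _ (Ideal.mul_mem_mul hz hx), ?_⟩
        rw [← hφφA, ← hφ.linear.map_pow_mul, map_mul, hxm]
        change φ (_ * _) = _
        congr 1
        rw [← mul_pow_sub_one (hq e) fK]
        ring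
    intro y hy
    obtain ⟨x, hx, hxy⟩ := (hM' y).mp (hM.2 hst hy)
    exact ⟨x, hx, hxy.symm⟩
  have htop : (⊤ : Ideal Γ(X, U)) ∈ stableIdeals U p (addDiv Δ fK) 𝔞 t :=
    ⟨top_ne_bot, fun _ _ _ _ _ => Submodule.mem_top⟩
  let J : Ideal Γ(X, U) := (M.comap (LinearMap.mulLeft Γ(X, U) fK⁻¹)).comap
    (Algebra.linearMap Γ(X, U) X.functionField)
  have hJmem : ∀ x, x ∈ J ↔ fK⁻¹ * algebraMap Γ(X, U) X.functionField x ∈ M := fun x => Iff.rfl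
  refine ⟨J, ⟨⟨fun hbot => ?_, fun e φ hφ x hx => ?_⟩, fun J' hJ' x hx => ?_⟩, ?_⟩
  · obtain ⟨m, hm, hm0⟩ := Submodule.exists_mem_ne_zero_of_ne_bot hM.1.ne_bot
    obtain ⟨x, -, hx⟩ := hdown _ htop m hm
    have hxJ : x ∈ J := by rw [hJmem, ← hx, inv_mul_cancel_left₀ hfK0]; exact hm
    rw [hbot, Ideal.mem_bot] at hxJ
    rw [hxJ, map_zero] at hx
    exact (mul_ne_zero hfK0 hm0) hx
  · obtain ⟨φK, hφK, hφφK⟩ := hφ.exists_compat h hΔ'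
    induction hx using Submodule.mul_induction_on' with
    | mem_mul_mem z hz x hx =>
      have := hM.1.map_mem e _ (huntwist e φK hφK) z hz _ ((hJmem x).mp hx)
      rw [hJmem, ← hφφK, ← hφK.linear.map_pow_mul]
      convert this using 1
      change _ = φK (_ * _)
      congr 1
      rw [map_mul, ← mul_pow_sub_one (hq e) fK⁻¹]
      ring
    | add x _ y _ hx hy => rw [map_add]; exact add_mem hx hy
  · obtain ⟨x', hx', hxx'⟩ := hdown J' hJ' _ ((hJmem x).mp hx)
    rw [mul_inv_cancel_left₀ hfK0] at hxx'
    rwa [hinj hxx']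
  · ext y
    constructor
    · intro hy
      obtain ⟨x, -, hx⟩ := hdown _ htop y hy
      refine ⟨x, ?_, ?_⟩
      · rw [hJmem, ← hx, inv_mul_cancel_left₀ hfK0]; exact hy
      · rw [← hx, mul_div_cancel_left₀ _ hfK0]
    · rintro ⟨x, hx, rfl⟩
      rw [div_eq_inv_mul]
      exact hx

end Affine

end TestIdeal

/-! ### Noetherian normal domains are Krull domains -/

section HeightOne

variable {A : Type*} [CommRing A] [IsDomain A] [IsNoetherianRing A]

theorem Ideal.height_eq_one_iff {P : Ideal A} [P.IsPrime] :
    P.height = 1 ↔ P ≠ ⊥ ∧ ∀ Q : Ideal A, Q.IsPrime → Q < P → Q = ⊥ := by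
  have hzero : ∀ Q : Ideal A, Q.IsPrime → Q.height = 0 → Q = ⊥ := fun Q hQ h0 => by
    rw [Ideal.height_eq_zero_iff, IsDomain.minimalPrimes_eq_singleton_bot] at h0
    exact h0
  constructor
  · intro h
    refine ⟨?_, fun Q hQ hlt => hzero Q hQ ?_⟩
    · rintro rfl
      rw [Ideal.height_bot] at h
      exact zero_ne_one h
    · have := Ideal.height_strict_mono_of_isPrime hlt
      rw [h] at this
      exact Order.lt_one_iff.mp this
  · rintro ⟨h0, h⟩
    apply le_antisymm
    · refine Ideal.height_le_iff.mpr fun Q hQ hlt => ?_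
      rw [h Q hQ hlt, Ideal.height_bot]
      exact zero_lt_one
    · rw [Order.one_le_iff_ne_zero]
      exact fun h' => h0 (hzero P inferInstance h')

theorem Ideal.eq_of_le_of_height_eq_one {P Q : Ideal A} [P.IsPrime] [hQ : Q.IsPrime]
    (hP : P.height = 1) (hQ0 : Q ≠ ⊥) (hle : Q ≤ P) : Q = P :=
  hle.eq_or_lt.resolve_right fun hlt => hQ0 ((Ideal.height_eq_one_iff.mp hP).2 Q hQ hlt)

variable {K : Type*} [Field K] [Algebra A K] [IsFractionRing A K]

theorem mem_range_of_forall_height_eq_one [IsIntegrallyClosed A] {f : K}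
    (hf : ∀ P : Ideal A, P.IsPrime → P.height = 1 →
      ∃ s ∉ P, algebraMap A K s * f ∈ (algebraMap A K).range) : f ∈ (algebraMap A K).range := by
  let N : Submodule A K := LinearMap.range (Algebra.linearMap A K)
  have hN : ∀ g : K, g ∈ N ↔ g ∈ (algebraMap A K).range := fun g => Iff.rfl
  by_contra hfN
  obtain ⟨P, hP, hfP⟩ := exists_le_isAssociatedPrime_of_isNoetherianRing A (N.mkQ f)
    (by rwa [ne_eq, Submodule.mkQ_apply, Submodule.Quotient.mk_eq_zero, hN])
  obtain ⟨hPp, g, hPg⟩ := isAssociatedPrime_iff.mp hP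
  obtain ⟨g, rfl⟩ := N.mkQ_surjective g
  have hcolon : ∀ (g : K) (s : A), s ∈ (⊥ : Submodule A (K ⧸ N)).colon {N.mkQ g} ↔
      algebraMap A K s * g ∈ (algebraMap A K).range := fun g s => by
    rw [Submodule.mem_colon_singleton, Submodule.mem_bot, ← map_smul, Submodule.mkQ_apply,
      Submodule.Quotient.mk_eq_zero, hN, Algebra.smul_def]
  have hPg' : ∀ s, s ∈ P ↔ algebraMap A K s * g ∈ (algebraMap A K).range := fun s => by
    rw [hPg, hcolon]
  have hinj : Function.Injective (algebraMap A K) := IsFractionRing.injective A K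
  have hP0 : P ≠ ⊥ := by
    obtain ⟨a, b, hb, rfl⟩ := IsFractionRing.div_surjective (A := A) g
    have hb0 : b ≠ 0 := nonZeroDivisors.ne_zero hb
    have hbP : b ∈ P := (hPg' b).mpr
      ⟨a, by rw [mul_div_cancel₀]; simpa using hb0⟩
    exact fun h => hb0 ((Submodule.mem_bot A).mp (h ▸ hbP))
  have hP1 : P.height = 1 := by
    by_cases hcase : ∀ x ∈ P, ∃ y ∈ P, algebraMap A K x * g = algebraMap A K y
    · exfalso
      have hint : IsIntegral A g := by
        refine isIntegral_of_smul_mem_submodule (Submodule.map (Algebra.linearMap A K) P) ?_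
          ((IsNoetherian.noetherian P).map _) g ?_
        · intro h
          apply hP0
          exact Submodule.map_injective_of_injective (f := Algebra.linearMap A K) hinj
            (h.trans (Submodule.map_bot _).symm)
        · rintro _ ⟨x, hx, rfl⟩
          obtain ⟨y, hy, hxy⟩ := hcase x hx
          exact ⟨y, hy, by rw [smul_eq_mul, mul_comm]; exact hxy.symm⟩
      obtain ⟨a, ha⟩ := IsIntegrallyClosed.isIntegral_iff.mp hint
      apply hPp.ne_top
      rw [Ideal.eq_top_iff_one, hPg', map_one, one_mul]
      exact ⟨a, ha⟩
    · push Not at hcase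
      obtain ⟨x, hx, hxu⟩ := hcase
      obtain ⟨u, hu⟩ := (hPg' x).mp hx
      have huP : u ∉ P := fun h => hxu u h hu.symm
      have hmin : P ∈ (Ideal.span {x}).minimalPrimes := by
        refine ⟨⟨hPp, by rwa [Ideal.span_singleton_le_iff_mem]⟩, fun Q hQ hQP y hy => ?_⟩
        obtain ⟨z, hz⟩ := (hPg' y).mp hy
        have : u * y = z * x := by
          apply hinj
          rw [map_mul, map_mul, hu, hz]; ring
        refine (hQ.1.mem_or_mem (x := u) (y := y) ?_).resolve_left fun h => huP (hQP h)
        rw [this]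
        exact Q.mul_mem_left _ (hQ.2 (Ideal.mem_span_singleton_self x))
      refine le_antisymm (Ideal.height_le_one_of_isPrincipal_of_mem_minimalPrimes _ _ hmin) ?_
      rw [Order.one_le_iff_ne_zero]
      intro h0
      rw [Ideal.height_eq_zero_iff, IsDomain.minimalPrimes_eq_singleton_bot] at h0
      exact hP0 h0
  obtain ⟨s, hsP, hs⟩ := hf P hPp hP1
  exact hsP (hfP ((hcolon f s).mpr hs))

theorem IsKrull.of_height_eq_one [IsIntegrallyClosed A] {ι : Type*} {P : ι → Ideal A}
    [hPp : ∀ i, (P i).IsPrime] (hP1 : ∀ i, (P i).height = 1) (hPinj : Function.Injective P)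
    (hPsurj : ∀ Q : Ideal A, Q.IsPrime → Q.height = 1 → ∃ i, P i = Q) {ord : ι → K → ℤ}
    (hord : ∀ i, IsOrd (ord i))
    (hmem : ∀ i f, f ∈ (hord i).filt 0 ↔
      ∃ s ∉ P i, algebraMap A K s * f ∈ (algebraMap A K).range) : IsKrull A ord := by
  have hA : ∀ (a : A) i, algebraMap A K a ∈ (hord i).filt 0 := fun a i =>
    (hmem i _).mpr ⟨1, (Ideal.ne_top_iff_one _).mp (hPp i).ne_top, 1 * a, by rw [map_mul]⟩
  have hinj : Function.Injective (algebraMap A K) := IsFractionRing.injective A K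
  have hne : ∀ {a : A}, a ≠ 0 → algebraMap A K a ≠ 0 := fun {a} ha => by simpa using ha
  have hzero : ∀ {a : A} {i}, a ≠ 0 → (ord i (algebraMap A K a) = 0 ↔ a ∉ P i) := by
    intro a i ha
    have h1 : (algebraMap A K a)⁻¹ ∈ (hord i).filt 0 ↔ a ∉ P i := by
      rw [hmem]
      constructor
      · rintro ⟨s, hs, b, hb⟩ haP
        apply hs
        have : s = b * a := by
          apply hinj
          rw [map_mul, hb, inv_mul_cancel_right₀ (hne ha)]
        rw [this]
        exact (P i).mul_mem_left _ haP
      · exact fun haP => ⟨a, haP, 1, by rw [map_one, mul_inv_cancel₀ (hne ha)]⟩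
    rw [← h1, (hord i).mem_filt_of_ne (inv_ne_zero (hne ha)), (hord i).map_inv (hne ha)]
    have := hA a i (hne ha)
    omega
  refine ⟨hord, fun f => ⟨?_, fun hf => ?_⟩, fun f hf => ?_, fun i j hij => ?_⟩
  · rintro ⟨a, rfl⟩ i
    exact hA a i
  · refine mem_range_of_forall_height_eq_one fun Q hQ hQ1 => ?_
    obtain ⟨i, rfl⟩ := hPsurj Q hQ hQ1
    exact (hmem i f).mp (hf i)
  · have hfin : ∀ a : A, a ≠ 0 → {i | ord i (algebraMap A K a) ≠ 0}.Finite := by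
      intro a ha
      refine Set.Finite.of_finite_image (f := P)
        ((Ideal.finite_minimalPrimes_of_isNoetherianRing A (Ideal.span {a})).subset ?_)
        hPinj.injOn
      rintro _ ⟨i, hi, rfl⟩
      have haP : a ∈ P i := by
        by_contra h
        exact hi ((hzero ha).mpr h)
      refine ⟨⟨hPp i, by rwa [Ideal.span_singleton_le_iff_mem]⟩, fun Q hQ hQP => ?_⟩
      have := hQ.1
      refine (Ideal.eq_of_le_of_height_eq_one (hP1 i) ?_ hQP).ge
      intro h0
      have := hQ.2 (Ideal.mem_span_singleton_self a)
      rw [h0] at this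
      exact ha this
    obtain ⟨a, b, hb, rfl⟩ := IsFractionRing.div_surjective (A := A) f
    have hb0 : b ≠ 0 := nonZeroDivisors.ne_zero hb
    have ha0 : a ≠ 0 := fun h => hf (by rw [h, map_zero, zero_div])
    refine ((hfin a ha0).union (hfin b hb0)).subset fun i hi => ?_
    by_contra hcon
    simp only [Set.mem_union, Set.mem_ofPred_eq, not_or, not_not] at hcon
    apply hi
    rw [div_eq_mul_inv, (hord i).map_mul (hne ha0) (inv_ne_zero (hne hb0)),
      (hord i).map_inv (hne hb0), hcon.1, hcon.2]
    simp
  · obtain ⟨a, haj, hai⟩ : ∃ a ∈ P j, a ∉ P i := by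
      by_contra! hcon
      exact hij (hPinj (Ideal.eq_of_le_of_height_eq_one (hP1 i)
        (Ideal.height_eq_one_iff.mp (hP1 j)).1 hcon)).symm
    have ha0 : a ≠ 0 := fun h => hai (h ▸ (P i).zero_mem)
    refine ⟨a, hne ha0, (hzero ha0).mpr hai, ?_⟩
    refine lt_of_le_of_ne (hA a j (hne ha0)) fun h => ?_
    exact (hzero ha0).mp h.symm haj

theorem Ideal.height_under_eq_one {B : Type*} [CommRing B] [IsDomain B] [IsNoetherianRing B]
    [Algebra A B] [FaithfulSMul A B] [Algebra.IsIntegral A B] [IsIntegrallyClosed A] {P : Ideal B}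
    [P.IsPrime] (hP : P.height = 1) : (P.under A).height = 1 := by
  rw [Ideal.height_eq_one_iff] at hP ⊢
  refine ⟨fun h => hP.1 (Ideal.eq_bot_of_comap_eq_bot (R := A) h), fun Q hQ hQP => ?_⟩
  obtain ⟨P', hP'P, hP', hover⟩ := Ideal.exists_ideal_le_liesOver_of_le (q := P.under A) P hQP.le
  have hlt : P' < P := by
    refine lt_of_le_of_ne hP'P ?_
    rintro rfl
    exact hQP.ne hover.over
  rw [hover.over, hP.2 P' hP' hlt]
  exact Ideal.comap_bot_of_injective _ (FaithfulSMul.algebraMap_injective A B)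

end HeightOne

/-! ### Local rings and affine opens of normal `F`-finite schemes -/

theorem IsFFiniteDVR.of_length {p : ℕ} {R K : Type*} [CommRing R] [IsDomain R]
    [IsDiscreteValuationRing R] [Field K] [Algebra R K] [IsFractionRing R K] [ExpChar R p]
    (hF : (frobenius R p).Finite) {ord : K → ℤ}
    (hmul : ∀ {f g : K}, f ≠ 0 → g ≠ 0 → ord (f * g) = ord f + ord g)
    (hadd : ∀ {f g : K}, f ≠ 0 → g ≠ 0 → f + g ≠ 0 → min (ord f) (ord g) ≤ ord (f + g))
    (hlen : ∀ b : R, b ≠ 0 → ∃ n : ℕ, Module.length R (R ⧸ Ideal.span {b}) = n ∧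
      ord (algebraMap R K b) = n) : IsFFiniteDVR p R ord := by
  have hne : ∀ {a : R}, a ≠ 0 → algebraMap R K a ≠ 0 := fun {a} ha => by simpa using ha
  have hord : IsOrd ord := by
    refine ⟨hmul, hadd, ?_⟩
    obtain ⟨ϖ, hϖ⟩ := IsDiscreteValuationRing.exists_irreducible R
    obtain ⟨n, hn, hn'⟩ := hlen ϖ hϖ.ne_zero
    have h1 : Module.length R (R ⧸ Ideal.span {ϖ}) = 1 := Ring.ord_of_irreducible hϖ
    refine ⟨algebraMap R K ϖ, hne hϖ.ne_zero, ?_⟩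
    rw [h1] at hn
    rw [hn']
    exact_mod_cast hn.symm
  refine ⟨hord, IsFractionRing.injective R K, fun f => ⟨?_, fun hf => ?_⟩, hF, fun b hb => ?_⟩
  · rintro ⟨b, rfl⟩ hb0
    obtain ⟨n, -, hn⟩ := hlen b (fun h => hb0 (by rw [h, map_zero]))
    rw [hn]; exact Int.natCast_nonneg n
  · rcases eq_or_ne f 0 with rfl | hf0
    · exact zero_mem _
    rcases ValuationRing.isInteger_or_isInteger R f with h | ⟨b, hb⟩
    · exact h
    · have hb0 : b ≠ 0 := by
        rintro rfl
        rw [map_zero] at hb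
        exact inv_ne_zero hf0 hb.symm
      obtain ⟨n, hn, hn'⟩ := hlen b hb0
      rw [hb, hord.map_inv hf0] at hn'
      have hn0 : n = 0 := by
        have := hf hf0
        omega
      rw [hn0, Nat.cast_zero, Module.length_eq_zero_iff, Submodule.Quotient.subsingleton_iff,
        Ideal.span_singleton_eq_top] at hn
      obtain ⟨u, rfl⟩ := hn
      refine ⟨(u⁻¹ : Rˣ), ?_⟩
      rw [← inv_inv f, ← hb, map_units_inv]
  · obtain ⟨n, hn, hn'⟩ := hlen b hb
    rw [hn, hn', Int.toNat_natCast]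

theorem IsLocalization.AtPrime.mem_range_iff {A R K : Type*} [CommRing A] [CommRing R] [Field K]
    [Algebra A R] [Algebra A K] [Algebra R K] [IsScalarTower A R K] (P : Ideal A) [P.IsPrime]
    [IsLocalization.AtPrime R P] (f : K) : f ∈ (algebraMap R K).range ↔
      ∃ s ∉ P, algebraMap A K s * f ∈ (algebraMap A K).range := by
  constructor
  · rintro ⟨b, rfl⟩
    obtain ⟨a, ⟨s, hs⟩, rfl⟩ := IsLocalization.exists_mk'_eq P.primeCompl b
    refine ⟨s, hs, a, ?_⟩
    rw [IsScalarTower.algebraMap_apply A R K s, ← map_mul, mul_comm, IsLocalization.mk'_spec,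
      ← IsScalarTower.algebraMap_apply]
  · rintro ⟨s, hs, a, ha⟩
    have hu := IsLocalization.map_units R (⟨s, hs⟩ : P.primeCompl)
    obtain ⟨u, hu⟩ := hu
    refine ⟨(u⁻¹ : Rˣ) * algebraMap A R a, ?_⟩
    rw [map_mul, ← IsScalarTower.algebraMap_apply, ha, IsScalarTower.algebraMap_apply A R K s,
      ← mul_assoc, ← map_mul]
    change algebraMap R K (_ * algebraMap A R (⟨s, hs⟩ : P.primeCompl)) * f = f
    rw [← hu, Units.inv_mul, map_one, one_mul]

theorem charP_of_natCast_eq_zero {p : ℕ} [hp : Fact p.Prime] {R : Type*} [CommRing R] [Nontrivial R]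
    (h : (p : R) = 0) : CharP R p :=
  (CharP.charP_iff_prime_eq_zero hp.out).mpr h

namespace TestIdeal

section Scheme

variable {p : ℕ} [hp : Fact p.Prime] {X : Scheme.{u}} [IsIntegral X] (hX : IsFFinite p X)
include hX

theorem IsFFinite.charP_section (U : X.Opens) [Nonempty U] : CharP Γ(X, U) p := by
  apply charP_of_natCast_eq_zero
  have := congrArg (X.presheaf.map (homOfLE le_top : U ⟶ ⊤).op).hom hX.char
  simpa using this

theorem IsFFinite.charP_stalk (x : X) : CharP (X.presheaf.stalk x) p := by
  apply charP_of_natCast_eq_zero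
  have := congrArg (X.presheaf.germ ⊤ x trivial).hom hX.char
  simpa using this

theorem IsFFinite.charP_functionField : CharP X.functionField p := hX.charP_stalk _

theorem IsFFinite.finite_frobenius_section {U : X.Opens} (hU : IsAffineOpen U) [Nonempty U] :
    haveI := hX.charP_section U
    (frobenius Γ(X, U) p).Finite :=
  haveI := hX.charP_section U
  hX.finite_frobenius ⟨U, hU⟩ inferInstance

theorem IsFFinite.finite_frobenius_stalk (x : X) :
    haveI := hX.charP_stalk x
    (frobenius (X.presheaf.stalk x) p).Finite := by
  obtain ⟨_, ⟨U, hU, rfl⟩, hxU, -⟩ :=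
    X.isBasis_affineOpens.exists_subset_of_mem_open (Set.mem_univ x) isOpen_univ
  have : Nonempty U := ⟨⟨x, hxU⟩⟩
  have := hX.charP_section U
  have := hX.charP_stalk x
  let := X.presheaf.algebra_section_stalk ⟨x, hxU⟩
  have := hU.isLocalization_stalk ⟨x, hxU⟩
  exact frobenius_finite_of_isLocalization (hU.primeIdealOf ⟨x, hxU⟩).asIdeal.primeCompl
    (hX.finite_frobenius_section hU)

variable [IsLocallyNoetherian X] [IsNormalScheme X]

theorem IsFFinite.isFFiniteDVR (x : PrimeDivisor X) :
    haveI := hX.charP_stalk x.1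
    IsFFiniteDVR p (X.presheaf.stalk x.1) (fun f : X.functionField => Scheme.ord f x.1) := by
  have := hX.charP_stalk x.1
  have := isDiscreteValuationRing_stalk x
  have : Ring.KrullDimLE 1 (X.presheaf.stalk x.1) := krullDimLE_of_coheight_le x.2.le
  refine IsFFiniteDVR.of_length (hX.finite_frobenius_stalk x.1) Scheme.ord_mul
    (fun _ _ h => Scheme.ord_add h) fun b hb => ?_
  have hb' : b ∈ nonZeroDivisors (X.presheaf.stalk x.1) := mem_nonZeroDivisors_of_ne_zero hb
  obtain ⟨n, hn⟩ := ENat.ne_top_iff_exists.mp (Ring.ord_ne_top hb')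
  refine ⟨n, hn.symm, ?_⟩
  rw [Scheme.ord_eq_iff x.2 (by simpa using hb)]
  have h1 := Ring.ordFrac_eq_ord (K := X.functionField) (X.presheaf.stalk x.1) hb
  exact h1.trans (Ring.ordMonoidWithZeroHom_eq_coe _ hb' hn.symm)

theorem IsFFinite.isOrd (x : PrimeDivisor X) :
    IsOrd (fun f : X.functionField => Scheme.ord f x.1) :=
  haveI := hX.charP_stalk x.1
  (hX.isFFiniteDVR x).isOrd

omit hX hp [IsIntegral X] [IsLocallyNoetherian X] [IsNormalScheme X] in
theorem exists_primeIdealOf_eq {U : X.Opens} (hU : IsAffineOpen U) (Q : PrimeSpectrum Γ(X, U)) :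
    ∃ x : U, hU.primeIdealOf x = Q := by
  have hmem : hU.fromSpec Q ∈ U := by
    rw [← SetLike.mem_coe, ← hU.range_fromSpec]
    exact ⟨Q, rfl⟩
  refine ⟨⟨_, hmem⟩, ?_⟩
  apply hU.fromSpec.isOpenEmbedding.injective
  rw [hU.fromSpec_primeIdealOf]

omit hX hp [IsLocallyNoetherian X] [IsNormalScheme X] in
theorem mem_range_stalk_iff {U : X.Opens} (hU : IsAffineOpen U) [Nonempty U] (x : U)
    (f : X.functionField) : f ∈ (algebraMap (X.presheaf.stalk x.1) X.functionField).range ↔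
      ∃ s ∉ (hU.primeIdealOf x).asIdeal, algebraMap Γ(X, U) X.functionField s * f ∈
        (algebraMap Γ(X, U) X.functionField).range := by
  have := hU.isLocalization_stalk x
  exact IsLocalization.AtPrime.mem_range_iff _ _

omit hX hp [IsLocallyNoetherian X] in
theorem isIntegrallyClosed_section {U : X.Opens} (hU : IsAffineOpen U) [Nonempty U] :
    IsIntegrallyClosed Γ(X, U) := by
  have := functionField_isFractionRing_of_isAffineOpen X U hU
  rw [isIntegrallyClosed_iff X.functionField]
  intro f hf
  let I : Ideal Γ(X, U) := (LinearMap.range (Algebra.linearMap Γ(X, U) X.functionField)).comap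
    (LinearMap.toSpanSingleton Γ(X, U) X.functionField f)
  have hI : ∀ s, s ∈ I ↔ algebraMap Γ(X, U) X.functionField s * f ∈
      (algebraMap Γ(X, U) X.functionField).range := fun s => by
    rw [← Algebra.smul_def]; rfl
  have htop : I = ⊤ := by
    by_contra hne
    obtain ⟨Q, hQ, hIQ⟩ := Ideal.exists_le_maximal I hne
    obtain ⟨x, hx⟩ := exists_primeIdealOf_eq hU ⟨Q, hQ.isPrime⟩
    have := IsNormalScheme.isIntegrallyClosed_stalk x.1
    have h1 : f ∈ (algebraMap (X.presheaf.stalk x.1) X.functionField).range :=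
      IsIntegrallyClosed.isIntegral_iff.mp hf.tower_top
    obtain ⟨s, hs, hsf⟩ := (mem_range_stalk_iff hU x f).mp h1
    rw [hx] at hs
    exact hs (hIQ ((hI s).mpr hsf))
  have h1 : (1 : Γ(X, U)) ∈ I := htop ▸ Submodule.mem_top
  rw [hI, map_one, one_mul] at h1
  exact h1

omit hX hp [IsIntegral X] [IsLocallyNoetherian X] [IsNormalScheme X] in
theorem height_primeIdealOf {U : X.Opens} (hU : IsAffineOpen U) (x : U) :
    (hU.primeIdealOf x).asIdeal.height = Order.coheight x.1 := by
  have := hU.isLocalization_stalk x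
  have h1 := IsLocalization.AtPrime.ringKrullDim_eq_height (hU.primeIdealOf x).asIdeal
    (X.presheaf.stalk x.1)
  rw [ringKrullDim_stalk_eq_coheight] at h1
  exact_mod_cast h1.symm

theorem IsFFinite.isKrull {U : X.Opens} (hU : IsAffineOpen U) [Nonempty U] :
    IsKrull Γ(X, U) (ordOn U) := by
  have := functionField_isFractionRing_of_isAffineOpen X U hU
  have := isIntegrallyClosed_section hU
  have : IsNoetherianRing Γ(X, U) := IsLocallyNoetherian.component_noetherian ⟨U, hU⟩
  refine IsKrull.of_height_eq_one (P := fun x : DivisorOn U =>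
    (hU.primeIdealOf ⟨x.1.1, x.2⟩).asIdeal) (hPp := fun x => inferInstance) (fun x => ?_) ?_ ?_
    (fun x => hX.isOrd x.1) fun x f => ?_
  · exact (height_primeIdealOf hU _).trans x.1.2
  · intro x y hxy
    have h1 := congrArg hU.fromSpec (PrimeSpectrum.ext hxy)
    rw [hU.fromSpec_primeIdealOf, hU.fromSpec_primeIdealOf] at h1
    exact Subtype.ext (Subtype.ext h1)
  · intro Q hQ hQ1
    obtain ⟨x, hx⟩ := exists_primeIdealOf_eq hU ⟨Q, hQ⟩
    have h1 := height_primeIdealOf hU x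
    rw [hx] at h1
    exact ⟨⟨⟨x.1, h1.symm.trans hQ1⟩, x.2⟩, congrArg PrimeSpectrum.asIdeal hx⟩
  · have := hX.charP_stalk x.1.1
    rw [← mem_range_stalk_iff hU ⟨x.1.1, x.2⟩ f]
    exact ((hX.isFFiniteDVR x.1).mem_range_iff f).symm

end Scheme

end TestIdeal

/-! ### Finite separable extensions of normal domains -/

section FiniteExtension

variable {A B K L : Type*} [CommRing A] [CommRing B] [Field K] [Field L] [IsDomain A] [IsDomain B]
  [Algebra A B] [Algebra A K] [Algebra B L] [Algebra K L] [Algebra A L] [IsScalarTower A B L]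
  [IsScalarTower A K L] [IsFractionRing A K] [IsFractionRing B L]

variable (A B K L) in
theorem finiteDimensional_of_isFractionRing [Module.Finite A B] [IsIntegrallyClosed B]
    [FaithfulSMul A B] : FiniteDimensional K L := by
  have : IsIntegralClosure B A L := IsIntegralClosure.of_isIntegrallyClosed _ _ _
  have : Algebra.IsAlgebraic K L := isAlgebraic_of_isFractionRing A B K L
  have : IsLocalization (Algebra.algebraMapSubmonoid B (nonZeroDivisors A)) L :=
    IsIntegralClosure.isLocalization A K L B
  exact Module.Finite.of_isLocalization A B (nonZeroDivisors A)

variable (A B K L) in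
/-- The relative differentials of a finite generically separable extension are torsion. -/
theorem exists_smul_D_eq_zero [Module.Finite A B] [IsIntegrallyClosed A] [FaithfulSMul A B]
    [Algebra.IsSeparable K L] :
    ∃ g : B, g ≠ 0 ∧ ∀ b, g • KaehlerDifferential.D A B b = 0 := by
  have hone : ∀ b : B, Polynomial.aeval b (minpoly A b).derivative ≠ 0 ∧
      Polynomial.aeval b (minpoly A b).derivative • KaehlerDifferential.D A B b = 0 := by
    intro b
    constructor
    · have hsep := Algebra.IsSeparable.isSeparable K (algebraMap B L b)
      have h1 := hsep.aeval_derivative_ne_zero (minpoly.aeval K (algebraMap B L b))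
      rw [minpoly.isIntegrallyClosed_eq_field_fractions K L
          (Algebra.IsIntegral.isIntegral (R := A) b),
        Polynomial.derivative_map, Polynomial.aeval_map_algebraMap,
        Polynomial.aeval_algebraMap_apply] at h1
      exact fun h => h1 (by rw [h, map_zero])
    · rw [← Derivation.map_aeval, minpoly.aeval, map_zero]
  obtain ⟨n, s, hs⟩ := Module.Finite.exists_fin (R := A) (M := B)
  refine ⟨∏ j, Polynomial.aeval (s j) (minpoly A (s j)).derivative,
    Finset.prod_ne_zero_iff.mpr fun j _ => (hone (s j)).1, fun b => ?_⟩
  have hb : b ∈ Submodule.span A (Set.range s) := hs ▸ Submodule.mem_top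
  induction hb using Submodule.span_induction with
  | mem x hx =>
    obtain ⟨j, rfl⟩ := hx
    rw [← Finset.prod_erase_mul _ _ (Finset.mem_univ j), mul_smul, (hone (s j)).2, smul_zero]
  | zero => simp
  | add x y _ _ hx hy => rw [map_add, smul_add, hx, hy, add_zero]
  | smul a x _ hx => rw [Derivation.map_smul, smul_comm, hx, smul_zero]

theorem subsingleton_kaehlerDifferential_of_isUnit {A B R S : Type*} [CommRing A] [CommRing B]
    [CommRing R] [CommRing S] [Algebra A B] [Algebra A R] [Algebra B S] [Algebra R S] [Algebra A S]
    [IsScalarTower A B S] [IsScalarTower A R S] (M : Submonoid B) [IsLocalization M S] {g : B}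
    (hg : ∀ b, g • KaehlerDifferential.D A B b = 0) (hu : IsUnit (algebraMap B S g)) :
    Subsingleton (Ω[S⁄R]) := by
  have h1 : ∀ b : B, KaehlerDifferential.D R S (algebraMap B S b) = 0 := by
    intro b
    have h2 := congrArg (KaehlerDifferential.map A R B S) (hg b)
    rw [map_smul, KaehlerDifferential.map_D, map_zero, ← algebraMap_smul S] at h2
    exact (hu.smul_eq_zero).mp h2
  have h2 : ∀ s : S, KaehlerDifferential.D R S s = 0 := by
    intro s
    obtain ⟨b, u, rfl⟩ := IsLocalization.exists_mk'_eq M s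
    have h3 := congrArg (KaehlerDifferential.D R S) (IsLocalization.mk'_spec S b u)
    rw [Derivation.leibniz, h1, h1, smul_zero, zero_add] at h3
    exact ((IsLocalization.map_units S u).smul_eq_zero).mp h3
  rw [← Submodule.subsingleton_iff S, ← subsingleton_iff_bot_eq_top,
    ← KaehlerDifferential.span_range_derivation]
  symm
  rw [Submodule.span_eq_bot]
  rintro _ ⟨s, rfl⟩
  exact h2 s

end FiniteExtension

section Ramification

variable {p : ℕ} {R S K L : Type*} [CommRing R] [CommRing S] [Field K] [Field L] [IsDomain R]
  [IsDiscreteValuationRing R] [IsLocalRing S] [Algebra R S] [Algebra R K] [Algebra S L]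
  [Algebra K L] [Algebra R L] [IsScalarTower R S L] [IsScalarTower R K L] [ExpChar R p]
  [ExpChar S p] [IsLocalHom (algebraMap R S)] {ordK : K → ℤ} {ordL : L → ℤ}

/-- The valuation of `S` restricts to the ramification index times the valuation of `R`. -/
theorem IsFFiniteDVR.ord_algebraMap (hR : IsFFiniteDVR p R ordK) (hS : IsFFiniteDVR p S ordL)
    {r : ℕ}
    (hr : (Module.length S (S ⧸ (IsLocalRing.maximalIdeal R).map (algebraMap R S))).toNat = r) :
    0 < r ∧ ∀ k : K, k ≠ 0 → ordL (algebraMap K L k) = r * ordK k := by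
  have hRL : ∀ a : R, algebraMap K L (algebraMap R K a) = algebraMap S L (algebraMap R S a) :=
    fun a => by rw [← IsScalarTower.algebraMap_apply, ← IsScalarTower.algebraMap_apply]
  have hnonneg : ∀ k : K, k ≠ 0 → 0 ≤ ordK k → 0 ≤ ordL (algebraMap K L k) := by
    intro k hk0 hk
    obtain ⟨a, rfl⟩ := (hR.mem_range_iff k).mpr fun _ => hk
    rw [hRL]
    refine (hS.mem_range_iff _).mp ⟨_, rfl⟩ ?_
    rw [← hRL]
    simpa using hk0
  obtain ⟨ϖ, hϖ⟩ := IsDiscreteValuationRing.exists_irreducible R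
  have hϖK : algebraMap R K ϖ ≠ 0 := fun h => hϖ.ne_zero (hR.injective (by rw [h, map_zero]))
  have hϖL : algebraMap S L (algebraMap R S ϖ) ≠ 0 := by
    rw [← hRL]; simpa using hϖK
  have hϖS : algebraMap R S ϖ ≠ 0 := fun h => hϖL (by rw [h, map_zero])
  have hϖ1 : ordK (algebraMap R K ϖ) = 1 := by
    have h1 : Module.length R (R ⧸ Ideal.span {ϖ}) = 1 := Ring.ord_of_irreducible hϖ
    have h2 := hR.length_eq ϖ hϖ.ne_zero
    rw [h1] at h2
    have h3 : (1 : ℕ) = (ordK (algebraMap R K ϖ)).toNat := by exact_mod_cast h2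
    omega
  have hr' : ordL (algebraMap K L (algebraMap R K ϖ)) = r := by
    rw [hϖ.maximalIdeal_eq, Ideal.map_span, Set.image_singleton, hS.length_eq _ hϖS,
      ENat.toNat_natCast] at hr
    rw [hRL]
    have : 0 ≤ ordL (algebraMap S L (algebraMap R S ϖ)) :=
      (hS.mem_range_iff _).mp ⟨_, rfl⟩ hϖL
    omega
  refine ⟨Nat.pos_of_ne_zero fun h0 => ?_, fun k hk0 => ?_⟩
  · rw [h0, hRL] at hr'
    obtain ⟨s, hs⟩ := (hS.mem_range_iff (algebraMap S L (algebraMap R S ϖ))⁻¹).mpr fun _ => by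
      rw [hS.isOrd.map_inv hϖL, hr']; simp
    refine hϖ.not_isUnit (isUnit_of_map_unit (algebraMap R S) ϖ (IsUnit.of_mul_eq_one s ?_))
    apply hS.injective
    rw [map_mul, hs, mul_inv_cancel₀ hϖL, map_one]
  · have hu0 : algebraMap R K ϖ ^ (-ordK k) * k ≠ 0 := mul_ne_zero (zpow_ne_zero _ hϖK) hk0
    have hu : ordK (algebraMap R K ϖ ^ (-ordK k) * k) = 0 := by
      rw [hR.isOrd.map_mul (zpow_ne_zero _ hϖK) hk0, hR.isOrd.map_zpow hϖK, hϖ1]; ring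
    have hϖL' : algebraMap K L (algebraMap R K ϖ) ≠ 0 := by simpa using hϖK
    have hk0' : algebraMap K L k ≠ 0 := by simpa using hk0
    have h1 := hnonneg _ hu0 hu.ge
    have h2 := hnonneg _ (inv_ne_zero hu0) (by rw [hR.isOrd.map_inv hu0, hu, neg_zero])
    rw [map_inv₀, hS.isOrd.map_inv ((map_ne_zero _).mpr hu0)] at h2
    have h3 : ordL (algebraMap K L (algebraMap R K ϖ ^ (-ordK k) * k)) =
        -ordK k * r + ordL (algebraMap K L k) := by
      rw [map_mul, map_zpow₀, hS.isOrd.map_mul (zpow_ne_zero _ hϖL') hk0',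
        hS.isOrd.map_zpow hϖL', hr']
    rw [h3] at h1 h2
    linarith

end Ramification

namespace TestIdeal

section Morphism

variable {X Y : Scheme.{u}} [IsIntegral X] [IsIntegral Y] (π : Y ⟶ X) [Surjective π]

theorem functionFieldMap_algebraMap_stalk (y : Y) (a : X.presheaf.stalk (π y)) :
    functionFieldMap π (algebraMap (X.presheaf.stalk (π y)) X.functionField a) =
      algebraMap (Y.presheaf.stalk y) Y.functionField ((π.stalkMap y).hom a) := by
  have h1 := Scheme.Hom.stalkSpecializes_stalkMap π (genericPoint Y) y
    ((genericPoint_spec Y).specializes trivial)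
  have h2 : X.presheaf.stalkSpecializes ((genericPoint_spec X).specializes trivial) ≫
      X.presheaf.stalkSpecializes (map_genericPoint_specializes π) =
      X.presheaf.stalkSpecializes
        (((genericPoint_spec Y).specializes (Set.mem_univ y)).map π.continuous) :=
    TopCat.Presheaf.stalkSpecializes_comp ..
  have h3 := congrArg (fun f => f.hom a) h1
  rw [← h2] at h3
  exact h3

theorem functionFieldMap_algebraMap (U : X.Opens) [Nonempty U] (a : Γ(X, U)) :
    functionFieldMap π (algebraMap Γ(X, U) X.functionField a) =
      algebraMap Γ(Y, π ⁻¹ᵁ U) Y.functionField ((π.app U).hom a) := by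
  obtain ⟨y, hy⟩ := (inferInstance : Nonempty (π ⁻¹ᵁ U))
  have h1 := functionFieldMap_algebraMap_stalk π y (X.presheaf.germ U (π y) hy a)
  have h2 := Scheme.algebraMap_germ_eq_germToFunctionField X (x := π y) hy a
  have h3 := Scheme.algebraMap_germ_eq_germToFunctionField Y (U := π ⁻¹ᵁ U) hy ((π.app U).hom a)
  have h4 := Scheme.Hom.germ_stalkMap_apply π U y hy a
  rw [h2] at h1
  exact (h1.trans (congrArg _ h4)).trans h3

end Morphism

section Ideal

variable {X : Scheme.{u}} [IsIntegral X]

theorem ideal_ne_bot {𝔞 : X.IdealSheafData} (h𝔞 : 𝔞 ≠ ⊥) (U : X.affineOpens) [hU : Nonempty U.1] :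
    𝔞.ideal U ≠ ⊥ := by
  intro hbot
  apply h𝔞
  ext V a
  constructor
  · intro ha
    rw [Scheme.IdealSheafData.ideal_bot]
    by_cases hV : Nonempty V.1
    · have hgen : ∀ W : X.Opens, Nonempty W → genericPoint X ∈ W := fun W hW =>
        ((genericPoint_spec X).mem_open_set_iff W.isOpen).mpr (by simpa using hW)
      obtain ⟨_, ⟨W, hW, rfl⟩, hxW, hWUV⟩ := X.isBasis_affineOpens.exists_subset_of_mem_open
        (show genericPoint X ∈ ((U.1 ⊓ V.1 : X.Opens) : Set X) from ⟨hgen _ hU, hgen _ hV⟩)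
        (U.1 ⊓ V.1).isOpen
      have hWU : W ≤ U.1 := fun x hx => (hWUV hx).1
      have hWV : W ≤ V.1 := fun x hx => (hWUV hx).2
      have h1 : 𝔞.ideal ⟨W, hW⟩ = ⊥ := by
        rw [← 𝔞.map_ideal (U := ⟨W, hW⟩) (V := U) hWU, hbot, Ideal.map_bot]
      have h2 : X.presheaf.map (homOfLE hWV).op a ∈ 𝔞.ideal ⟨W, hW⟩ := by
        rw [← 𝔞.map_ideal (U := ⟨W, hW⟩) (V := V) hWV]
        exact Ideal.mem_map_of_mem _ ha
      rw [h1, Ideal.mem_bot] at h2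
      have h3 : X.presheaf.germ W _ hxW (X.presheaf.map (homOfLE hWV).op a) = 0 := by
        rw [h2, map_zero]
      rw [X.presheaf.germ_res_apply] at h3
      exact germ_injective_of_isIntegral X _ _ (h3.trans (map_zero _).symm)
    · have : V.1 = ⊥ := by
        rw [eq_bot_iff]
        exact fun x hx => hV ⟨x, hx⟩
      have : Subsingleton Γ(X, V.1) := by rw [this]; infer_instance
      rw [Subsingleton.elim a 0]
      exact Ideal.zero_mem _
  · intro ha
    rw [Scheme.IdealSheafData.ideal_bot] at ha
    rw [(Ideal.mem_bot).mp ha]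
    exact Ideal.zero_mem _

end Ideal

section Finite

variable {p : ℕ} [hp : Fact p.Prime] {X Y : Scheme.{u}} [IsIntegral X] [IsIntegral Y]
  [IsLocallyNoetherian X] [IsLocallyNoetherian Y] [IsNormalScheme X] [IsNormalScheme Y]
  (π : Y ⟶ X) [IsFinite π] [Surjective π]

theorem app_injective (U : X.Opens) [Nonempty U] : Function.Injective (π.app U).hom := by
  intro a b hab
  have h1 := functionFieldMap_algebraMap π U a
  rw [hab, ← functionFieldMap_algebraMap π U b] at h1
  exact X.germToFunctionField_injective U ((functionFieldMap π).injective h1)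

theorem coheight_map (y : PrimeDivisor Y) : Order.coheight (π y.1) = 1 := by
  obtain ⟨_, ⟨U, hU, rfl⟩, hxU, -⟩ :=
    X.isBasis_affineOpens.exists_subset_of_mem_open (Set.mem_univ (π y.1)) isOpen_univ
  have : Nonempty U := ⟨⟨_, hxU⟩⟩
  have hV : IsAffineOpen (π ⁻¹ᵁ U) := hU.preimage π
  have := isIntegrallyClosed_section hU
  have : IsNoetherianRing Γ(X, U) := IsLocallyNoetherian.component_noetherian ⟨U, hU⟩
  have : IsNoetherianRing Γ(Y, π ⁻¹ᵁ U) := IsLocallyNoetherian.component_noetherian ⟨_, hV⟩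
  let : Algebra Γ(X, U) Γ(Y, π ⁻¹ᵁ U) := (π.app U).hom.toAlgebra
  have : Module.Finite Γ(X, U) Γ(Y, π ⁻¹ᵁ U) := IsFinite.finite_app π U hU
  have : FaithfulSMul Γ(X, U) Γ(Y, π ⁻¹ᵁ U) :=
    (faithfulSMul_iff_algebraMap_injective _ _).mpr (app_injective π U)
  have h1 := height_primeIdealOf hV ⟨y.1, hxU⟩
  rw [y.2] at h1
  have h2 := Ideal.height_under_eq_one (A := Γ(X, U)) h1
  have h3 := IsAffineOpen.comap_primeIdealOf_appLE U hU (π ⁻¹ᵁ U) hV le_rfl (f := π) hxU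
  rw [Scheme.Hom.appLE_eq_app] at h3
  have h4 := height_primeIdealOf hU ⟨π y.1, hxU⟩
  rw [← h3] at h4
  exact h4.symm.trans h2

theorem finiteDimensional_functionField :
    letI := (functionFieldMap π).toAlgebra
    FiniteDimensional X.functionField Y.functionField := by
  obtain ⟨_, ⟨U, hU, rfl⟩, hxU, -⟩ :=
    X.isBasis_affineOpens.exists_subset_of_mem_open (Set.mem_univ (genericPoint X)) isOpen_univ
  have : Nonempty U := ⟨⟨_, hxU⟩⟩
  have hV : IsAffineOpen (π ⁻¹ᵁ U) := hU.preimage π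
  have := isIntegrallyClosed_section hV
  have := functionField_isFractionRing_of_isAffineOpen X U hU
  have := functionField_isFractionRing_of_isAffineOpen Y _ hV
  let : Algebra X.functionField Y.functionField := (functionFieldMap π).toAlgebra
  let : Algebra Γ(X, U) Γ(Y, π ⁻¹ᵁ U) := (π.app U).hom.toAlgebra
  let : Algebra Γ(X, U) Y.functionField :=
    ((functionFieldMap π).comp (algebraMap Γ(X, U) X.functionField)).toAlgebra
  have : IsScalarTower Γ(X, U) X.functionField Y.functionField :=
    IsScalarTower.of_algebraMap_eq fun _ => rfl
  have : IsScalarTower Γ(X, U) Γ(Y, π ⁻¹ᵁ U) Y.functionField :=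
    IsScalarTower.of_algebraMap_eq (functionFieldMap_algebraMap π U)
  have : Module.Finite Γ(X, U) Γ(Y, π ⁻¹ᵁ U) := IsFinite.finite_app π U hU
  have : FaithfulSMul Γ(X, U) Γ(Y, π ⁻¹ᵁ U) :=
    (faithfulSMul_iff_algebraMap_injective _ _).mpr (app_injective π U)
  exact finiteDimensional_of_isFractionRing Γ(X, U) Γ(Y, π ⁻¹ᵁ U) _ _

/-- The coefficients of the ramification divisor, as natural numbers. -/
noncomputable def ramificationLength (y : Y) : ℕ :=
  letI := (π.stalkMap y).hom.toAlgebra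
  (Module.length (Y.presheaf.stalk y) (Ω[Y.presheaf.stalk y⁄X.presheaf.stalk (π y)])).toNat

theorem ord_functionFieldMap (hX : IsFFinite p X) (hY : IsFFinite p Y) (y : PrimeDivisor Y) :
    0 < ramificationIndex π y.1 ∧ ∀ k : X.functionField, k ≠ 0 →
      Scheme.ord (functionFieldMap π k) y.1 = ramificationIndex π y.1 * Scheme.ord k (π y.1) := by
  let x : PrimeDivisor X := ⟨π y.1, coheight_map π y⟩
  have := hX.charP_stalk (π y.1)
  have := hY.charP_stalk y.1
  have : IsDiscreteValuationRing (X.presheaf.stalk (π y.1)) := isDiscreteValuationRing_stalk x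
  let : Algebra X.functionField Y.functionField := (functionFieldMap π).toAlgebra
  let : Algebra (X.presheaf.stalk (π y.1)) (Y.presheaf.stalk y.1) := (π.stalkMap y.1).hom.toAlgebra
  let : Algebra (X.presheaf.stalk (π y.1)) Y.functionField :=
    ((functionFieldMap π).comp (algebraMap _ X.functionField)).toAlgebra
  have : IsScalarTower (X.presheaf.stalk (π y.1)) X.functionField Y.functionField :=
    IsScalarTower.of_algebraMap_eq fun _ => rfl
  have : IsScalarTower (X.presheaf.stalk (π y.1)) (Y.presheaf.stalk y.1) Y.functionField :=
    IsScalarTower.of_algebraMap_eq (functionFieldMap_algebraMap_stalk π y.1)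
  have : IsLocalHom (algebraMap (X.presheaf.stalk (π y.1)) (Y.presheaf.stalk y.1)) :=
    inferInstanceAs (IsLocalHom (π.stalkMap y.1).hom)
  exact (hX.isFFiniteDVR x).ord_algebraMap (hY.isFFiniteDVR y) rfl

theorem exists_generator_of_primeDivisor (hX : IsFFinite p X) (x : PrimeDivisor X) :
    ∃ φ : X.functionField →+ X.functionField, IsPInvLinear X.functionField p 1 φ ∧
      (hX.isOrd x).IsGen φ 0 := by
  have := hX.charP_stalk x.1
  have := hX.charP_functionField
  obtain ⟨φ, ψ, n, hφ, -, -, hφg, -⟩ := exists_frobenius_generator (hX.isFFiniteDVR x)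
    (hX.isFFiniteDVR x) fun k => Iff.rfl
  exact ⟨φ, hφ, hφg⟩

theorem exists_generators_of_primeDivisor (hX : IsFFinite p X) (hY : IsFFinite p Y)
    (hπ : IsSeparableMorphism π) (y : PrimeDivisor Y) :
    ∃ (φ : X.functionField →+ X.functionField) (ψ : Y.functionField →+ Y.functionField),
      IsPInvLinear X.functionField p 1 φ ∧ IsPInvLinear Y.functionField p 1 ψ ∧
      (∀ k, ψ (functionFieldMap π k) = functionFieldMap π (φ k)) ∧
      (hX.isOrd ⟨π y.1, coheight_map π y⟩).IsGen φ 0 ∧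
      (hY.isOrd y).IsGen ψ ((p - 1) * ramificationLength π y.1) := by
  let x : PrimeDivisor X := ⟨π y.1, coheight_map π y⟩
  have := hX.charP_stalk (π y.1)
  have := hY.charP_stalk y.1
  have := hX.charP_functionField
  have := hY.charP_functionField
  let : Algebra X.functionField Y.functionField := (functionFieldMap π).toAlgebra
  let : Algebra (X.presheaf.stalk (π y.1)) (Y.presheaf.stalk y.1) := (π.stalkMap y.1).hom.toAlgebra
  let : Algebra (X.presheaf.stalk (π y.1)) Y.functionField :=
    ((functionFieldMap π).comp (algebraMap _ X.functionField)).toAlgebra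
  have : IsScalarTower (X.presheaf.stalk (π y.1)) X.functionField Y.functionField :=
    IsScalarTower.of_algebraMap_eq fun _ => rfl
  have : IsScalarTower (X.presheaf.stalk (π y.1)) (Y.presheaf.stalk y.1) Y.functionField :=
    IsScalarTower.of_algebraMap_eq (functionFieldMap_algebraMap_stalk π y.1)
  have : FiniteDimensional X.functionField Y.functionField := finiteDimensional_functionField π
  have : Algebra.IsSeparable X.functionField Y.functionField := hπ
  obtain ⟨hr0, hr⟩ := ord_functionFieldMap π hX hY y
  obtain ⟨φ, ψ, n, hφ, hψ, hφψ, hφg, hψg, hn⟩ := exists_frobenius_generator (hX.isFFiniteDVR x)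
    (hY.isFFiniteDVR y) fun k => by
      rcases eq_or_ne k 0 with rfl | hk0
      · simp
      have hk0' : algebraMap X.functionField Y.functionField k ≠ 0 := by simpa using hk0
      rw [IsOrd.mem_filt_of_ne _ hk0, IsOrd.mem_filt_of_ne _ hk0']
      change 0 ≤ Scheme.ord (functionFieldMap π k) y.1 ↔ 0 ≤ Scheme.ord k (π y.1)
      rw [hr k hk0]
      exact mul_nonneg_iff_of_pos_left (by exact_mod_cast hr0)
  have hn' : ramificationLength π y.1 = n := by
    change (Module.length (Y.presheaf.stalk y.1)
      (Ω[Y.presheaf.stalk y.1⁄X.presheaf.stalk (π y.1)])).toNat = n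
    rw [hn, ENat.toNat_natCast]
  exact ⟨φ, ψ, hφ, hψ, hφψ, hφg, hn' ▸ hψg⟩

end Finite

end TestIdeal

namespace TestIdeal

theorem finite_ramificationLength_ne_zero {p : ℕ} [Fact p.Prime] {X Y : Scheme.{u}} [IsIntegral X]
    [IsIntegral Y] [IsLocallyNoetherian X] [IsLocallyNoetherian Y] [IsNormalScheme X]
    [IsNormalScheme Y] (π : Y ⟶ X) [IsFinite π] [Surjective π]
    (hY : IsFFinite p Y) (hπ : IsSeparableMorphism π) {U : X.Opens} (hU : IsAffineOpen U)
    [Nonempty U] : {y : DivisorOn (π ⁻¹ᵁ U) | ramificationLength π y.1.1 ≠ 0}.Finite := by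
  have hV : IsAffineOpen (π ⁻¹ᵁ U) := hU.preimage π
  have := isIntegrallyClosed_section hU
  have := functionField_isFractionRing_of_isAffineOpen X U hU
  have := functionField_isFractionRing_of_isAffineOpen Y _ hV
  let : Algebra X.functionField Y.functionField := (functionFieldMap π).toAlgebra
  let : Algebra Γ(X, U) Γ(Y, π ⁻¹ᵁ U) := (π.app U).hom.toAlgebra
  let : Algebra Γ(X, U) Y.functionField :=
    ((functionFieldMap π).comp (algebraMap Γ(X, U) X.functionField)).toAlgebra
  have : IsScalarTower Γ(X, U) X.functionField Y.functionField :=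
    IsScalarTower.of_algebraMap_eq fun _ => rfl
  have : IsScalarTower Γ(X, U) Γ(Y, π ⁻¹ᵁ U) Y.functionField :=
    IsScalarTower.of_algebraMap_eq (functionFieldMap_algebraMap π U)
  have : Module.Finite Γ(X, U) Γ(Y, π ⁻¹ᵁ U) := IsFinite.finite_app π U hU
  have : FaithfulSMul Γ(X, U) Γ(Y, π ⁻¹ᵁ U) :=
    (faithfulSMul_iff_algebraMap_injective _ _).mpr (app_injective π U)
  have : Algebra.IsSeparable X.functionField Y.functionField := hπ
  obtain ⟨g, hg0, hg⟩ := exists_smul_D_eq_zero Γ(X, U) Γ(Y, π ⁻¹ᵁ U) X.functionField Y.functionField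
  have hgL : algebraMap Γ(Y, π ⁻¹ᵁ U) Y.functionField g ≠ 0 := by simpa using hg0
  refine ((hY.isKrull hV).finite _ hgL).subset fun y hy hord => hy ?_
  let : Algebra (X.presheaf.stalk (π y.1.1)) (Y.presheaf.stalk y.1.1) :=
    (π.stalkMap y.1.1).hom.toAlgebra
  let : Algebra Γ(X, U) (X.presheaf.stalk (π y.1.1)) :=
    (X.presheaf.germ U (π y.1.1) y.2).hom.toAlgebra
  let : Algebra Γ(Y, π ⁻¹ᵁ U) (Y.presheaf.stalk y.1.1) :=
    (Y.presheaf.germ (π ⁻¹ᵁ U) y.1.1 y.2).hom.toAlgebra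
  let : Algebra Γ(X, U) (Y.presheaf.stalk y.1.1) :=
    ((π.stalkMap y.1.1).hom.comp (X.presheaf.germ U (π y.1.1) y.2).hom).toAlgebra
  have : IsScalarTower Γ(X, U) (X.presheaf.stalk (π y.1.1)) (Y.presheaf.stalk y.1.1) :=
    IsScalarTower.of_algebraMap_eq fun _ => rfl
  have : IsScalarTower Γ(X, U) Γ(Y, π ⁻¹ᵁ U) (Y.presheaf.stalk y.1.1) :=
    IsScalarTower.of_algebraMap_eq fun a => Scheme.Hom.germ_stalkMap_apply π U y.1.1 y.2 a
  have hloc : IsLocalization.AtPrime (Y.presheaf.stalk y.1.1)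
    (hV.primeIdealOf ⟨y.1.1, y.2⟩).asIdeal := hV.isLocalization_stalk ⟨y.1.1, y.2⟩
  have hu : IsUnit (algebraMap Γ(Y, π ⁻¹ᵁ U) (Y.presheaf.stalk y.1.1) g) := by
    have := hY.charP_stalk y.1.1
    have hdvr := hY.isFFiniteDVR y.1
    obtain ⟨s, hs⟩ := (hdvr.mem_range_iff
      (algebraMap Γ(Y, π ⁻¹ᵁ U) Y.functionField g)⁻¹).mpr fun _ =>
        ((hdvr.isOrd.map_inv hgL).trans (neg_eq_zero.mpr hord)).ge
    refine IsUnit.of_mul_eq_one s (hdvr.injective ?_)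
    rw [map_mul, hs, map_one]
    have h1 := Scheme.algebraMap_germ_eq_germToFunctionField Y (U := π ⁻¹ᵁ U) y.2 g
    exact (congrArg (· * _) h1).trans (mul_inv_cancel₀ hgL)
  have hsub := subsingleton_kaehlerDifferential_of_isUnit (A := Γ(X, U))
    (R := X.presheaf.stalk (π y.1.1)) (S := Y.presheaf.stalk y.1.1)
    (hV.primeIdealOf ⟨y.1.1, y.2⟩).asIdeal.primeCompl hg hu
  change (Module.length (Y.presheaf.stalk y.1.1)
    (Ω[Y.presheaf.stalk y.1.1⁄X.presheaf.stalk (π y.1.1)])).toNat = 0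
  rw [Module.length_eq_zero]
  rfl

theorem exists_isBigTestIdeal_fieldTrace_image_eq (p : ℕ) [Fact p.Prime] {X Y : Scheme.{u}}
    [IsIntegral X] [IsLocallyNoetherian X] [IsNormalScheme X]
    [IsIntegral Y] [IsLocallyNoetherian Y] [IsNormalScheme Y]
    (hX : IsFFinite p X) (hY : IsFFinite p Y)
    (π : Y ⟶ X) [IsFinite π] [Surjective π] (hπ : IsSeparableMorphism π)
    (Δ : PrimeDivisor X →₀ ℚ) (𝔞 : X.IdealSheafData) (h𝔞 : 𝔞 ≠ ⊥)
    (t : ℝ) (U : X.affineOpens) [Nonempty U.1] :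
    ∃ (M : Submodule Γ(X, U.1) X.functionField)
      (N : Submodule Γ(Y, π ⁻¹ᵁ U.1) Y.functionField),
      IsBigTestIdeal U.1 p Δ (𝔞.ideal U) t M ∧
      IsBigTestIdeal (π ⁻¹ᵁ U.1) p
        (pullbackDivisor π Δ - ramificationDivisor π)
        ((𝔞.ideal U).map (π.app U.1).hom) t N ∧
      fieldTrace π '' (N : Set Y.functionField) = (M : Set X.functionField) := by
  have hU : IsAffineOpen U.1 := U.2
  have hV : IsAffineOpen (π ⁻¹ᵁ U.1) := hU.preimage π
  have := isIntegrallyClosed_section hU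
  have := isIntegrallyClosed_section hV
  have := functionField_isFractionRing_of_isAffineOpen X U.1 hU
  have := functionField_isFractionRing_of_isAffineOpen Y _ hV
  have : IsNoetherianRing Γ(X, U.1) := IsLocallyNoetherian.component_noetherian U
  have : IsNoetherianRing Γ(Y, π ⁻¹ᵁ U.1) := IsLocallyNoetherian.component_noetherian ⟨_, hV⟩
  have := hX.charP_section U.1
  have := hY.charP_section (π ⁻¹ᵁ U.1)
  have := hX.charP_functionField
  have := hY.charP_functionField
  let : Algebra X.functionField Y.functionField := (functionFieldMap π).toAlgebra
  let : Algebra Γ(X, U.1) Γ(Y, π ⁻¹ᵁ U.1) := (π.app U.1).hom.toAlgebra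
  let : Algebra Γ(X, U.1) Y.functionField :=
    ((functionFieldMap π).comp (algebraMap Γ(X, U.1) X.functionField)).toAlgebra
  have : IsScalarTower Γ(X, U.1) X.functionField Y.functionField :=
    IsScalarTower.of_algebraMap_eq fun _ => rfl
  have : IsScalarTower Γ(X, U.1) Γ(Y, π ⁻¹ᵁ U.1) Y.functionField :=
    IsScalarTower.of_algebraMap_eq (functionFieldMap_algebraMap π U.1)
  have : Module.Finite Γ(X, U.1) Γ(Y, π ⁻¹ᵁ U.1) := IsFinite.finite_app π U.1 hU
  have : FaithfulSMul Γ(X, U.1) Γ(Y, π ⁻¹ᵁ U.1) :=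
    (faithfulSMul_iff_algebraMap_injective _ _).mpr (app_injective π U.1)
  have : FiniteDimensional X.functionField Y.functionField := finiteDimensional_functionField π
  have : Algebra.IsSeparable X.functionField Y.functionField := hπ
  have hA := hX.isKrull hU
  have hB := hY.isKrull hV
  let ρ : DivisorOn (π ⁻¹ᵁ U.1) → DivisorOn U.1 := fun y => ⟨⟨π y.1.1, coheight_map π y.1⟩, y.2⟩
  let r : DivisorOn (π ⁻¹ᵁ U.1) → ℕ := fun y => ramificationIndex π y.1.1
  let n : DivisorOn (π ⁻¹ᵁ U.1) → ℕ := fun y => ramificationLength π y.1.1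
  have hr : ∀ j, ∀ k : X.functionField, k ≠ 0 → ordOn (π ⁻¹ᵁ U.1) j (algebraMap _ _ k) =
      r j * ordOn U.1 (ρ j) k := fun j => (ord_functionFieldMap π hX hY j.1).2
  have hr0 : ∀ j, 0 < r j := fun j => (ord_functionFieldMap π hX hY j.1).1
  have hΔX : {i : DivisorOn U.1 | Δ i.1 ≠ 0}.Finite :=
    (Δ.hasFiniteSupport.preimage Subtype.val_injective.injOn).subset fun i hi => hi
  have hn : {j | n j ≠ 0}.Finite := finite_ramificationLength_ne_zero π hY hπ hU
  have hpull : {j | Δ (ρ j).1 ≠ 0}.Finite := by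
    obtain ⟨g, hg0, hg⟩ := hA.exists_forall_le_ord hΔX.toFinset 1
    refine (hB.finite (algebraMap _ _ (algebraMap Γ(X, U.1) X.functionField g))
      ((map_ne_zero _).mpr hg0)).subset fun j hj => ?_
    have h1 := hg (ρ j) (by simpa using hj)
    have h2 : (0 : ℤ) < r j := by exact_mod_cast hr0 j
    change ordOn _ j _ ≠ 0
    rw [hr j _ hg0]
    exact (mul_pos h2 (by omega)).ne'
  have hΔY : ∀ j : DivisorOn (π ⁻¹ᵁ U.1), (pullbackDivisor π Δ - ramificationDivisor π) j.1 =
      Δ (ρ j).1 * r j - n j := by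
    intro j
    rw [Pi.sub_apply, pullbackDivisor, dif_pos (coheight_map π j.1)]
    rfl
  have hΔYfin : {j : DivisorOn (π ⁻¹ᵁ U.1) |
      (pullbackDivisor π Δ - ramificationDivisor π) j.1 ≠ 0}.Finite := by
    refine (hpull.union hn).subset fun j hj => ?_
    by_contra hcon
    simp only [Set.mem_union, Set.mem_ofPred_eq, not_or, not_not] at hcon
    apply hj
    rw [hΔY, hcon.1, hcon.2]
    simp
  have h𝔞U : 𝔞.ideal U ≠ ⊥ := ideal_ne_bot h𝔞 U
  have h𝔞V : (𝔞.ideal U).map (π.app U.1).hom ≠ ⊥ := by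
    rw [ne_eq, Ideal.map_eq_bot_iff_of_injective (app_injective π U.1)]
    exact h𝔞U
  obtain ⟨M, hM⟩ := hA.exists_isLeast_stable (hX.finite_frobenius_section hU) hΔX h𝔞U t
  obtain ⟨N, hN⟩ := hB.exists_isLeast_stable (hY.finite_frobenius_section hV) hΔYfin h𝔞V t
  refine ⟨M, N, isBigTestIdeal_of_isLeast hA hΔX hM, isBigTestIdeal_of_isLeast hB hΔYfin hN, ?_⟩
  have hN' := hN
  simp_rw [hΔY] at hN'
  exact IsKrull.trace_image_eq
    (frobenius_finite_of_isLocalization (nonZeroDivisors Γ(X, U.1))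
      (hX.finite_frobenius_section hU))
    (frobenius_finite_of_isLocalization (nonZeroDivisors Γ(Y, π ⁻¹ᵁ U.1))
      (hY.finite_frobenius_section hV))
    hr hr0 (fun i => exists_generator_of_primeDivisor hX i.1)
    (fun j => exists_generators_of_primeDivisor π hX hY hπ j.1) hΔX hM hN'

end TestIdeal

theorem mainTheorem2 (p : ℕ) [Fact p.Prime] {X Y : Scheme.{u}}
    [IsIntegral X] [IsNoetherian X] [X.IsSeparated] [TestIdeal.IsNormalScheme X]
    [IsIntegral Y] [IsNoetherian Y] [Y.IsSeparated] [TestIdeal.IsNormalScheme Y]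
    (hX : TestIdeal.IsFFinite p X) (hY : TestIdeal.IsFFinite p Y)
    (π : Y ⟶ X) [IsFinite π] [Surjective π] (hπ : TestIdeal.IsSeparableMorphism π)
    (Δ : TestIdeal.PrimeDivisor X →₀ ℚ) (𝔞 : X.IdealSheafData) (h𝔞 : 𝔞 ≠ ⊥)
    (t : ℝ) (ht : 0 ≤ t) (U : X.affineOpens) [Nonempty U.1] :
    ∃ (M : Submodule Γ(X, U.1) X.functionField)
      (N : Submodule Γ(Y, π ⁻¹ᵁ U.1) Y.functionField),
      TestIdeal.IsBigTestIdeal U.1 p Δ (𝔞.ideal U) t M ∧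
      TestIdeal.IsBigTestIdeal (π ⁻¹ᵁ U.1) p
        (TestIdeal.pullbackDivisor π Δ - TestIdeal.ramificationDivisor π)
        ((𝔞.ideal U).map (π.app U.1).hom) t N ∧
      TestIdeal.fieldTrace π '' (N : Set Y.functionField) = (M : Set X.functionField) := by
  exact TestIdeal.exists_isBigTestIdeal_fieldTrace_image_eq p hX hY π hπ Δ 𝔞 h𝔞 t U
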